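/- **Setting.** Let $d\ge 1$, $m,n\ge 0$, $\mathcal A=\mathbb Z[v,v^{-1}]$, $q=v^2$. Let $W$ be the group of permutations $w$ of $[-d..d]$ with $w(-i)=-w(i)$, with simple reflections $s_0=(-1,1)$, $s_k=(k,k+1)(-k,-k-1)$ $(1\le k<d)$ and length function $\ell$. Let $\mathcal H$ be its Hecke algebra over $\mathcal A$, with basis $T_w$ $(w\in W)$, $T_wT_{w'}=T_{ww'}$ if $\ell(ww')=\ell(w)+\ell(w')$, and $(T_{s_k}+1)(T_{s_k}-q)=0$. Its bar involution is the ring automorphism with $\bar v=v^{-1}$ and $\overline{T_w}=T_{w^{-1}}^{-1}$. Let $\mathbb I=[-m-n..m+n]$, with parity $\hat i=0$ if $|i|\le m$ and $\hat i=1$ otherwise. Let $\Lambda$ be the set of $\lambda=(\lambda_0,\dots,\lambda_{m+n})\in\mathbb N^{m+n+1}$ with sum $d$, and $\tilde\lambda_i=\lambda_0+\dots+\lambda_i$. Put $R_0^\lambda=[-\lambda_0..\lambda_0]$, $R_i^\lambda=[\tilde\lambda_{i-1}+1..\tilde\lambda_i]$ and $R_{-i}^\lambda=-R_i^\lambda$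 for $i\ge1$. Let $W_\lambda$ be generated by the $s_k$ with $k\notin\{\tilde\lambda_0,\dots,\tilde\lambda_{m+n-1}\}$, and let $W_{\lambda^{(0)}}$ (resp. $W_{\lambda^{(1)}}$) be generated by those of these $s_k$ with $k<\tilde\lambda_m$ (resp. $k>\tilde\lambda_m$). Each $w\in W_\lambda$ is uniquely $w=w^{(0)}w^{(1)}$ with $w^{(i)}\in W_{\lambda^{(i)}}$. Put $$[xy]_\lambda=\sum_{w\in W_{\lambda^{(0)}}}T_w\cdot\sum_{w\in W_{\lambda^{(1)}}}(-q)^{-\ell(w)}T_w .$$ For $P\subseteq\Lambda$ let $\mathcal S_P=\operatorname{End}_{\mathcal H}\big(\bigoplus_{\lambda\in P}[xy]_\lambda\mathcal H\big)$ (right $\mathcal H$-modules); extension by zero embeds $\mathcal S_P$ in $\mathcal S_\Lambda$. Put $\mathcal S^{\jmath}_{m|n,d}=\mathcal S_\Lambda$, and for $c\ge0$ let $\mathcal S^{(c)}=\mathcal S_{\Lambda^{(c)}}$, where $\Lambda^{(c)}=\{\lambda\in\Lambda:\lambda_0=c\}$. The variant is $\mathcal S^{\imath}_{m|n,d}=\mathcal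 S^{(0)}$. The bar involution of $\mathcal S_P$ sends $f$ to the $\mathcal H$-linear map $\bar f$ with $\bar f(\overline{[xy]_\lambda})=\overline{f([xy]_\lambda)}$ for all $\lambda\in P$. **Matrices.** Let $\Xi_{m|n,d}$ be the set of $A=(a_{ij})_{i,j\in\mathbb I}$ with entries in $\mathbb N$ such that $\sum a_{ij}=2d+1$, $a_{ij}=a_{-i,-j}$, and $a_{ij}\in\{0,1\}$ if $\hat i\ne\hat j$. Let $\operatorname{row}(A)_0=\frac{a_{00}-1}2+\sum_{j\ge1}a_{0j}$ and $\operatorname{row}(A)_i=\sum_j a_{ij}$ $(i\ge1)$, and let $\operatorname{col}(A)=\operatorname{row}(A^{\mathsf T})$. Let $\Xi^{(c)}=\{A\in\Xi_{m|n,d}:\operatorname{row}(A)_0=\operatorname{col}(A)_0=c\}$ and $\Xi^{\imath}_{m|n,d}=\Xi^{(0)}$. With $\sigma_{ij}(A)=\sum_{x\le i,\,y\ge j}a_{xy}$, write $B<_{\rm alg}A$ if $B\ne A$, $\operatorname{row}(B)=\operatorname{row}(A)$, $\operatorname{col}(B)=\operatorname{col}(A)$ and $\sigma_{ij}(B)\le\sigma_{ij}(A)$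 for all $i<j$. **Standard basis.** For $A\in\Xi_{m|n,d}$ put $\lambda=\operatorname{row}(A)$, $\mu=\operatorname{col}(A)$. There is a unique $g\in W$ which is shortest in $W_\lambda gW_\mu$ and satisfies $|R_i^\lambda\cap gR_j^\mu|=a_{ij}$ for all $i,j$; it satisfies $g^{-1}W_{\lambda^{(1)}}g\cap W_{\mu^{(0)}}=g^{-1}W_{\lambda^{(0)}}g\cap W_{\mu^{(1)}}=\{1\}$. Let $\mathcal D_\delta$ be the set of shortest representatives of the cosets $W_\delta\backslash W$, where $W_\delta=g^{-1}W_\lambda g\cap W_\mu$. Let $e_A$ be the $\mathcal H$-linear map with $$e_A([xy]_\mu)=[xy]_\lambda T_g\sum_{w=w^{(0)}w^{(1)}\in\mathcal D_\delta\cap W_\mu}(-q)^{-\ell(w^{(1)})}T_w ,\qquad e_A([xy]_\nu)=0\quad(\nu\neq\mu).$$ Put $I_c=(\{0\}\times[0..m+n])\sqcup([1..m+n]\times\mathbb I)$, $a^\natural_{00}=\frac{a_{00}-1}2$, $a^\natural_{ij}=a_{ij}$ otherwise, and $$\ell(A)=\tfrac12\sum_{(i,j)\in I_c}\Big(\sum_{k<i,\,l>j}+\sum_{k>i,\,l<j}\Big)a^\natural_{ij}a_{kl},\qquad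 \hat\ell(A)=\ell(A)+\tfrac12\sum_{(i,j)\in I_c}\sum_{l\ne j}(-1)^{\hat i}a^\natural_{ij}a_{il}.$$ Let $A^\circ$ have the entries $a_{ij}$ for $\hat i=1$, the entry $1$ at $(0,0)$, and $0$ elsewhere. Put $[A]=(-1)^{\ell(A^\circ)}v^{-\hat\ell(A)}e_A$. For $P=\Lambda$ or $P=\Lambda^{(c)}$ let $\Xi_P=\Xi_{m|n,d}$ or $\Xi_P=\Xi^{(c)}$, respectively. A *canonical basis* of $\mathcal S_P$ relative to the standard basis $([A])_{A\in\Xi_P}$ is an $\mathcal A$-basis $(\{A\})_{A\in\Xi_P}$ such that $\overline{\{A\}}=\{A\}$ and $\{A\}\in[A]+\sum_{B\in\Xi_P,\,B<_{\rm alg}A}v^{-1}\mathbb Z[v^{-1}][B]$ for all $A\in\Xi_P$; here $([A])_{A\in\Xi_P}$ is required to be an $\mathcal A$-basis of $\mathcal S_P$. **Theorem 6.4.** $\mathcal S^{\jmath}_{m|n,d}$ has a unique canonical basis $(\{A\})_{A\in\Xi_{m|n,d}}$ relative to $([A])_{A\in\Xi_{m|n,d}}$. For every $c\ge0$, in particular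 for $\mathcal S^{\imath}_{m|n,d}$ $(c=0)$, $\mathcal S^{(c)}$ has a unique canonical basis relative to its standard basis $([A])_{A\in\Xi^{(c)}}$; under the inclusion $\mathcal S^{(c)}\subset\mathcal S^{\jmath}_{m|n,d}$, its standard basis element $[A]$ is the element $[A]$ of $\mathcal S^{\jmath}_{m|n,d}$, and its canonical basis is $(\{A\})_{A\in\Xi^{(c)}}$, the restriction of the canonical basis of $\mathcal S^{\jmath}_{m|n,d}$. -/

import Mathlib

namespace IotaSchur

noncomputable section

/-! ### The Weyl group of type `B_d` -/

/-- The Weyl group of type `B_d` as the group of permutations `w` of `[-d..d]` with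
`w (-i) = -w i` (such a permutation is extended by the identity to all of `ℤ`). -/
def weylB (d : ℕ) : Subgroup (Equiv.Perm ℤ) where
  carrier := {w | (∀ i, w (-i) = -w i) ∧ ∀ i : ℤ, (d : ℤ) < |i| → w i = i}
  one_mem' := by simp
  mul_mem' := by
    rintro a b ⟨ha, ha'⟩ ⟨hb, hb'⟩
    refine ⟨fun i => by simp [ha, hb], fun i hi => ?_⟩
    simp [hb' i hi, ha' i hi]
  inv_mem' := by
    rintro a ⟨ha, ha'⟩
    refine ⟨fun i => ?_, fun i hi => ?_⟩
    · rw [Equiv.Perm.inv_eq_iff_eq, ha]; simp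
    · rw [Equiv.Perm.inv_eq_iff_eq, ha' i hi]

/-- The permutation `s_0 = (-1, 1)`, `s_k = (k, k+1)(-k, -k-1)` for `k ≥ 1`. -/
def reflPerm (k : ℕ) : Equiv.Perm ℤ :=
  if k = 0 then Equiv.swap (-1) 1
  else Equiv.swap (k : ℤ) (k + 1) * Equiv.swap (-(k : ℤ)) (-k - 1)

lemma reflPerm_zero_apply (i : ℤ) :
    reflPerm 0 i = if i = -1 then 1 else if i = 1 then -1 else i := by
  simp [reflPerm, Equiv.swap_apply_def]

lemma reflPerm_apply {k : ℕ} (hk : k ≠ 0) (i : ℤ) :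
    reflPerm k i = if i = k then (k : ℤ) + 1 else if i = k + 1 then (k : ℤ)
      else if i = -k then -(k : ℤ) - 1 else if i = -k - 1 then -(k : ℤ) else i := by
  simp only [reflPerm, hk, if_false, Equiv.Perm.mul_apply, Equiv.swap_apply_def]
  split_ifs <;> omega

lemma reflPerm_mem {d k : ℕ} (hk : k < d) : reflPerm k ∈ weylB d := by
  rcases Nat.eq_zero_or_pos k with rfl | h0
  · refine ⟨fun i => ?_, fun i hi => ?_⟩
    · simp only [reflPerm_zero_apply]; split_ifs <;> omega
    · rw [lt_abs] at hi
      simp only [reflPerm_zero_apply]; split_ifs <;> omega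
  · refine ⟨fun i => ?_, fun i hi => ?_⟩
    · simp only [reflPerm_apply h0.ne']; split_ifs <;> omega
    · rw [lt_abs] at hi
      simp only [reflPerm_apply h0.ne']; split_ifs <;> omega

lemma reflPerm_mul_self (k : ℕ) : reflPerm k * reflPerm k = 1 := by
  rcases Nat.eq_zero_or_pos k with rfl | h0
  · simp [reflPerm]
  · ext i
    simp only [Equiv.Perm.mul_apply, reflPerm_apply h0.ne', Equiv.Perm.one_apply]
    split_ifs <;> omega

/-- The simple reflections `s_0, …, s_{d-1}`. -/
def simpleRefl {d : ℕ} (k : Fin d) : weylB d := ⟨reflPerm k, reflPerm_mem k.2⟩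

lemma simpleRefl_mul_self {d : ℕ} (k : Fin d) : simpleRefl k * simpleRefl k = 1 :=
  Subtype.ext (reflPerm_mul_self k)

lemma simpleRefl_inv {d : ℕ} (k : Fin d) : (simpleRefl k)⁻¹ = simpleRefl k :=
  inv_eq_of_mul_eq_one_left (simpleRefl_mul_self k)

lemma weylB_mapsTo {d : ℕ} (w : weylB d) {i : ℤ} (hi : |i| ≤ d) : |w.1 i| ≤ d := by
  by_contra h
  push Not at h
  have := w.2.2 _ h
  have h2 : w.1 i = i := w.1.injective this
  rw [h2] at h
  omega

instance (d : ℕ) : Finite (weylB d) := by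
  let f : weylB d → (Set.Icc (-(d : ℤ)) d → Set.Icc (-(d : ℤ)) d) := fun w i =>
    ⟨w.1 i.1, abs_le.1 (weylB_mapsTo w (abs_le.2 i.2))⟩
  refine Finite.of_injective f fun w w' h => Subtype.ext (Equiv.ext fun i => ?_)
  by_cases hi : |i| ≤ d
  · exact congrArg Subtype.val (congrFun h ⟨i, abs_le.1 hi⟩)
  · push Not at hi
    rw [w.2.2 i hi, w'.2.2 i hi]

instance (d : ℕ) : Fintype (weylB d) := Fintype.ofFinite _

lemma mem_closure_aux {d : ℕ} (e : ℕ) (he : e ≤ d) :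
    ∀ w : weylB d, (∀ i : ℤ, (e : ℤ) < |i| → w.1 i = i) →
      w ∈ Subgroup.closure (Set.range (simpleRefl (d := d))) := by
  induction e with
  | zero =>
    intro w hw
    have : w = 1 := by
      refine Subtype.ext (Equiv.ext fun i => ?_)
      by_cases hi : i = 0
      · have := w.2.1 0
        subst hi
        simp at this ⊢
        omega
      · exact hw i (by simpa using hi)
    rw [this]
    exact one_mem _
  | succ e ih =>
    have key : ∀ t : ℕ, ∀ w : weylB d, (∀ i : ℤ, ((e + 1 : ℕ) : ℤ) < |i| → w.1 i = i) →
        ∀ j : ℤ, w.1 j = e + 1 → (e : ℤ) + 1 - j ≤ t →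
        w ∈ Subgroup.closure (Set.range (simpleRefl (d := d))) := by
      intro t
      induction t with
      | zero =>
        intro w hw j hj ht
        have hje : j = e + 1 := by
          by_contra hne
          have h1 : ((e + 1 : ℕ) : ℤ) < |j| := by rw [lt_abs]; push_cast at ht ⊢; omega
          have := hw j h1
          omega
        refine ih (by omega) w fun i hi => ?_
        rw [lt_abs] at hi
        by_cases h2 : i = e + 1
        · rw [h2, ← hje, hj, hje]
        by_cases h3 : i = -(e + 1)
        · rw [h3, ← hje, w.2.1, hj, hje]
        · exact hw i (by rw [lt_abs]; push_cast; omega)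
      | succ t iht =>
        intro w hw j hj ht
        have hj1 : -((e : ℤ) + 1) ≤ j := by
          by_contra hlt
          have h1 : ((e + 1 : ℕ) : ℤ) < |j| := by rw [lt_abs]; push_cast; omega
          have := hw j h1
          omega
        have hj0 : j ≠ 0 := by
          rintro rfl
          have := w.2.1 0
          simp at this
          omega
        by_cases hje : (e : ℤ) + 1 - j ≤ t
        · exact iht w hw j hj hje
        have step : ∀ k : ℕ, k ≤ e → j < reflPerm k j →
            w ∈ Subgroup.closure (Set.range (simpleRefl (d := d))) := by
          intro k hk h1
          have hfix : ∀ i : ℤ, ((e + 1 : ℕ) : ℤ) < |i| → reflPerm k i = i := fun i hi =>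
            (reflPerm_mem (d := e + 1) (by omega)).2 i hi
          have hinv : reflPerm k (reflPerm k j) = j := by
            rw [← Equiv.Perm.mul_apply, reflPerm_mul_self, Equiv.Perm.one_apply]
          have h := iht (w * simpleRefl ⟨k, by omega⟩)
            (fun i hi => by
              change w.1 (reflPerm k i) = i
              rw [hfix i hi, hw i hi])
            (reflPerm k j)
            (by change w.1 (reflPerm k (reflPerm k j)) = _; rw [hinv, hj])
            (by push_cast at ht; omega)
          have h2 := mul_mem h (Subgroup.subset_closure
            (Set.mem_range_self (f := simpleRefl (d := d)) ⟨k, by omega⟩))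
          rwa [mul_assoc, simpleRefl_mul_self, mul_one] at h2
        rcases lt_trichotomy j 0 with hneg | h0 | hpos
        · by_cases hm1 : j = -1
          · exact step 0 (by omega) (by rw [reflPerm_zero_apply, hm1]; norm_num)
          · refine step (-j - 1).toNat (by omega) ?_
            rw [reflPerm_apply (by omega)]
            split_ifs <;> omega
        · exact absurd h0 hj0
        · by_cases hlast : j = e + 1
          · refine iht w hw j hj (by omega)
          · by_cases hbig : (e : ℤ) + 1 < j
            · exact iht w hw j hj (by omega)
            · refine step j.toNat (by omega) ?_
              rw [reflPerm_apply (by omega)]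
              split_ifs <;> omega
    intro w hw
    exact key _ w hw (w.1.symm (e + 1)) (by simp) (Int.self_le_toNat _)

lemma closure_simpleRefl (d : ℕ) :
    Subgroup.closure (Set.range (simpleRefl (d := d))) = ⊤ :=
  (Subgroup.eq_top_iff' _).2 fun w => mem_closure_aux d le_rfl w w.2.2

lemma exists_word {d : ℕ} (w : weylB d) :
    ∃ l : List (Fin d), (l.map simpleRefl).prod = w := by
  have hw : w ∈ Subgroup.closure (Set.range (simpleRefl (d := d))) := by
    rw [closure_simpleRefl]; trivial
  induction hw using Subgroup.closure_induction with
  | mem x hx => obtain ⟨k, rfl⟩ := hx; exact ⟨[k], by simp⟩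
  | one => exact ⟨[], rfl⟩
  | mul x y _ _ hx hy =>
    obtain ⟨l, rfl⟩ := hx
    obtain ⟨l', rfl⟩ := hy
    exact ⟨l ++ l', by simp⟩
  | inv x _ hx =>
    obtain ⟨l, rfl⟩ := hx
    refine ⟨l.reverse, ?_⟩
    rw [List.prod_inv_reverse, List.map_map, List.map_reverse]
    congr 3
    funext k
    simp [simpleRefl_inv]
/-- The length function of `W` with respect to the simple reflections. -/
def len {d : ℕ} (w : weylB d) : ℕ :=
  sInf {k | ∃ l : List (Fin d), l.length = k ∧ (l.map simpleRefl).prod = w}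

lemma exists_reduced {d : ℕ} (w : weylB d) :
    ∃ l : List (Fin d), l.length = len w ∧ (l.map simpleRefl).prod = w := by
  obtain ⟨l, hl⟩ := exists_word w
  exact Nat.sInf_mem (s := {k | ∃ l : List (Fin d), l.length = k ∧
    (l.map simpleRefl).prod = w}) ⟨l.length, l, rfl, hl⟩

lemma len_le {d : ℕ} (l : List (Fin d)) : len (l.map simpleRefl).prod ≤ l.length :=
  Nat.sInf_le ⟨l, rfl, rfl⟩

lemma len_inv_le {d : ℕ} (w : weylB d) : len w⁻¹ ≤ len w := by
  obtain ⟨l, hl, hw⟩ := exists_reduced w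
  have h : (l.reverse.map simpleRefl).prod = w⁻¹ := by
    rw [← hw, List.prod_inv_reverse, List.map_map, List.map_reverse]
    congr 3
    funext k
    simp [simpleRefl_inv]
  rw [← h, ← hl, ← List.length_reverse]
  exact len_le _

lemma len_inv {d : ℕ} (w : weylB d) : len w⁻¹ = len w :=
  le_antisymm (len_inv_le w) (by simpa using len_inv_le w⁻¹)

lemma len_one (d : ℕ) : len (1 : weylB d) = 0 :=
  Nat.le_zero.1 (len_le (d := d) [])

lemma len_simple_le {d : ℕ} (k : Fin d) : len (simpleRefl k) ≤ 1 := by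
  simpa using len_le [k]

/-! ### The Hecke algebra and its bar involution -/

/-- The ground ring `𝒜 = ℤ[v, v⁻¹]`, in which `v ^ k` is written `LaurentPolynomial.T k`. -/
abbrev Lau : Type := LaurentPolynomial ℤ

/-- `v ^ k`. -/
abbrev vpow (k : ℤ) : Lau := LaurentPolynomial.T k

/-- `q = v ^ 2`. -/
abbrev qq : Lau := vpow 2

/-- The defining relations of the Hecke algebra on generators `T_w`, `w ∈ W`. -/
inductive HeckeRel (d : ℕ) : FreeAlgebra Lau (weylB d) → FreeAlgebra Lau (weylB d) → Prop
  | one : HeckeRel d (FreeAlgebra.ι Lau 1) 1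
  | mul (w w' : weylB d) (h : len (w * w') = len w + len w') :
      HeckeRel d (FreeAlgebra.ι Lau w * FreeAlgebra.ι Lau w') (FreeAlgebra.ι Lau (w * w'))
  | quad (k : Fin d) :
      HeckeRel d ((FreeAlgebra.ι Lau (simpleRefl k) + 1) *
        (FreeAlgebra.ι Lau (simpleRefl k) - algebraMap Lau _ qq)) 0

/-- The Hecke algebra of type `B_d` over `𝒜`. -/
def Hecke (d : ℕ) : Type := RingQuot (HeckeRel d)

instance (d : ℕ) : Ring (Hecke d) := inferInstanceAs (Ring (RingQuot (HeckeRel d)))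

instance (d : ℕ) : Algebra Lau (Hecke d) :=
  inferInstanceAs (Algebra Lau (RingQuot (HeckeRel d)))

/-- The basis element `T_w`. -/
def TT {d : ℕ} (w : weylB d) : Hecke d :=
  RingQuot.mkAlgHom Lau (HeckeRel d) (FreeAlgebra.ι Lau w)

lemma TT_one (d : ℕ) : TT (1 : weylB d) = 1 := by
  have := RingQuot.mkAlgHom_rel Lau (HeckeRel.one (d := d))
  rw [map_one] at this
  exact this

lemma TT_mul {d : ℕ} (w w' : weylB d) (h : len (w * w') = len w + len w') :
    TT w * TT w' = TT (w * w') := by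
  have := RingQuot.mkAlgHom_rel Lau (HeckeRel.mul w w' h)
  rw [map_mul] at this
  exact this

lemma TT_quad {d : ℕ} (k : Fin d) :
    (TT (simpleRefl k) + 1) * (TT (simpleRefl k) - algebraMap Lau _ qq) = 0 := by
  have := RingQuot.mkAlgHom_rel Lau (HeckeRel.quad k)
  rw [map_mul, map_add, map_sub, map_one, map_zero, AlgHom.commutes] at this
  exact this

lemma vpow_mul_neg (k : ℤ) : vpow k * vpow (-k) = 1 := by
  rw [← LaurentPolynomial.T_add]; simp

lemma vpow_neg_mul (k : ℤ) : vpow (-k) * vpow k = 1 := by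
  rw [← LaurentPolynomial.T_add]; simp

lemma len_mul_le {d : ℕ} (w w' : weylB d) : len (w * w') ≤ len w + len w' := by
  obtain ⟨l, hl, rfl⟩ := exists_reduced w
  obtain ⟨l', hl', rfl⟩ := exists_reduced w'
  rw [← hl, ← hl', ← List.length_append, ← List.prod_append, ← List.map_append]
  exact len_le _

/-- The inverse of `T_{s_k}`. -/
def simpleInv {d : ℕ} (k : Fin d) : Hecke d :=
  vpow (-2) • (TT (simpleRefl k) - algebraMap Lau _ qq + 1)

lemma simple_mul_simpleInv {d : ℕ} (k : Fin d) : TT (simpleRefl k) * simpleInv k = 1 := by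
  have h : TT (simpleRefl k) * (TT (simpleRefl k) - algebraMap Lau _ qq + 1) =
      algebraMap Lau _ qq := by
    have := TT_quad k
    rw [← sub_eq_zero, ← this]
    noncomm_ring
  rw [simpleInv, mul_smul_comm, h, Algebra.algebraMap_eq_smul_one, smul_smul, vpow_neg_mul,
    one_smul]

lemma simpleInv_mul_simple {d : ℕ} (k : Fin d) : simpleInv k * TT (simpleRefl k) = 1 := by
  rw [← simple_mul_simpleInv k, simpleInv, smul_mul_assoc, mul_smul_comm]
  congr 1
  have := Algebra.commutes qq (TT (simpleRefl k))
  rw [add_mul, sub_mul, mul_add, mul_sub, this]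
  simp

lemma isUnit_TT_simple {d : ℕ} (k : Fin d) : IsUnit (TT (simpleRefl k)) :=
  ⟨⟨_, _, simple_mul_simpleInv k, simpleInv_mul_simple k⟩, rfl⟩

lemma isUnit_TT {d : ℕ} (w : weylB d) : IsUnit (TT w) := by
  obtain ⟨n, hn⟩ : ∃ n, len w = n := ⟨_, rfl⟩
  induction n generalizing w with
  | zero =>
    obtain ⟨l, hl, rfl⟩ := exists_reduced w
    rw [hn, List.length_eq_zero_iff] at hl
    subst hl
    simp [TT_one]
  | succ n ih =>
    obtain ⟨l, hl, rfl⟩ := exists_reduced w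
    rw [hn] at hl
    cases l with
    | nil => simp at hl
    | cons k l =>
      simp only [List.length_cons, Nat.add_right_cancel_iff] at hl
      simp only [List.map_cons, List.prod_cons] at hn ⊢
      have h1 := len_le l
      have h2 := len_mul_le (simpleRefl k) (l.map simpleRefl).prod
      have h3 := len_simple_le k
      rw [← TT_mul _ _ (by omega)]
      exact (isUnit_TT_simple k).mul (ih _ (by omega))

/-- The element `T_{w⁻¹}⁻¹`, the image of `T_w` under the bar involution. -/
def barTT {d : ℕ} (w : weylB d) : Hecke d := ↑(isUnit_TT w⁻¹).unit⁻¹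

lemma barTT_mul_TT {d : ℕ} (w : weylB d) : barTT w * TT w⁻¹ = 1 :=
  (isUnit_TT w⁻¹).val_inv_mul

lemma TT_mul_barTT {d : ℕ} (w : weylB d) : TT w⁻¹ * barTT w = 1 :=
  (isUnit_TT w⁻¹).mul_val_inv

lemma barTT_eq {d : ℕ} (w : weylB d) (x : Hecke d) (h : TT w⁻¹ * x = 1) : barTT w = x := by
  have := congrArg (barTT w * ·) h
  simp only [← mul_assoc, barTT_mul_TT, one_mul, mul_one] at this
  exact this.symm

/-- The ring homomorphism `𝒜 → 𝓗` which sends `v` to `v⁻¹`. -/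
def barScalar (d : ℕ) : Lau →+* Hecke d :=
  (algebraMap Lau (Hecke d)).comp (LaurentPolynomial.invert (R := ℤ)).toRingEquiv.toRingHom

/-- A copy of the Hecke algebra on which `v` acts as `v⁻¹`. -/
def HeckeTw (d : ℕ) : Type := Hecke d

instance (d : ℕ) : Ring (HeckeTw d) := inferInstanceAs (Ring (Hecke d))

instance (d : ℕ) : Algebra Lau (HeckeTw d) :=
  RingHom.toAlgebra' (S := HeckeTw d) (barScalar d) fun c x =>
    Algebra.commutes (A := Hecke d) (LaurentPolynomial.invert c) x

/-- `w ↦ T_{w⁻¹}⁻¹` as a map into the twisted copy. -/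
def barTw {d : ℕ} (w : weylB d) : HeckeTw d := (barTT w : Hecke d)

lemma algebraMap_tw (d : ℕ) (k : ℤ) :
    algebraMap Lau (HeckeTw d) (vpow k) = algebraMap Lau (Hecke d) (vpow (-k)) := by
  change algebraMap Lau (Hecke d) (LaurentPolynomial.invert (LaurentPolynomial.T k)) = _
  rw [LaurentPolynomial.invert_T]

lemma barRel {d : ℕ} ⦃x y : FreeAlgebra Lau (weylB d)⦄ (h : HeckeRel d x y) :
    FreeAlgebra.lift Lau (barTw (d := d)) x =
      FreeAlgebra.lift Lau (barTw (d := d)) y := by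
  cases h with
  | one =>
    rw [FreeAlgebra.lift_ι_apply, map_one]
    change barTT (1 : weylB d) = (1 : Hecke d)
    exact barTT_eq _ _ (by rw [inv_one, TT_one, mul_one])
  | mul w w' h =>
    rw [map_mul]
    simp only [FreeAlgebra.lift_ι_apply]
    change (barTT w * barTT w' : Hecke d) = barTT (w * w')
    refine (barTT_eq (w * w') (barTT w * barTT w') ?_).symm
    have h1 : TT w'⁻¹ * TT w⁻¹ = TT (w * w')⁻¹ := by
      rw [mul_inv_rev]
      apply TT_mul
      rw [← mul_inv_rev, len_inv, len_inv, len_inv, h, add_comm]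
    rw [← h1, mul_assoc, ← mul_assoc (TT w⁻¹), TT_mul_barTT, one_mul, TT_mul_barTT]
  | quad k =>
    rw [map_mul, map_add, map_sub, map_one, map_zero, AlgHom.commutes, FreeAlgebra.lift_ι_apply,
      algebraMap_tw]
    change (barTT (simpleRefl k) + 1 : Hecke d) *
      (barTT (simpleRefl k) - algebraMap Lau (Hecke d) (vpow (-2))) = 0
    have hb : barTT (simpleRefl k) = simpleInv k :=
      barTT_eq _ _ (by rw [simpleRefl_inv, simple_mul_simpleInv])
    have h1 : (simpleInv k + 1 : Hecke d) = simpleInv k * (TT (simpleRefl k) + 1) := by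
      rw [mul_add, simpleInv_mul_simple, mul_one, add_comm]
    have h2 : (simpleInv k - algebraMap Lau (Hecke d) (vpow (-2)) : Hecke d) =
        -(vpow (-2) • ((TT (simpleRefl k) - algebraMap Lau _ qq) * simpleInv k)) := by
      rw [sub_mul, simple_mul_simpleInv, smul_sub, ← Algebra.smul_def, smul_smul, vpow_neg_mul,
        one_smul, Algebra.algebraMap_eq_smul_one, neg_sub]
    rw [hb, h1, h2, mul_neg, mul_smul_comm, mul_assoc, ← mul_assoc (TT (simpleRefl k) + 1),
      TT_quad, zero_mul, mul_zero, smul_zero, neg_zero]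

/-- The bar involution of the Hecke algebra: the ring homomorphism with `v ↦ v⁻¹` and
`T_w ↦ T_{w⁻¹}⁻¹`. -/
def heckeBar (d : ℕ) : Hecke d →+* Hecke d :=
  (RingQuot.liftAlgHom Lau ⟨FreeAlgebra.lift Lau (barTw (d := d)),
    barRel⟩ : RingQuot (HeckeRel d) →ₐ[Lau] HeckeTw d).toRingHom

lemma heckeBar_TT {d : ℕ} (w : weylB d) : heckeBar d (TT w) = barTT w :=
  (RingQuot.liftAlgHom_mkAlgHom_apply Lau (FreeAlgebra.lift Lau (barTw (d := d))) barRel (FreeAlgebra.ι Lau w)).trans (FreeAlgebra.lift_ι_apply _ _)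

lemma heckeBar_algebraMap {d : ℕ} (c : Lau) :
    heckeBar d (algebraMap Lau _ c) = algebraMap Lau _ (LaurentPolynomial.invert c) :=
  (RingQuot.liftAlgHom Lau ⟨FreeAlgebra.lift Lau (barTw (d := d)),
    barRel⟩ : RingQuot (HeckeRel d) →ₐ[Lau] HeckeTw d).commutes c

/-! ### Compositions, parabolic subgroups, matrices -/

/-- Sequences `λ = (λ_0, …, λ_m | λ_{m+1}, …, λ_{m+n})`. -/
abbrev Comp (m n : ℕ) : Type := Fin (m + n + 1) → ℕ

/-- The set `Λ(m|n, d)` of weak compositions of `d` into `m + n + 1` parts. -/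
def Lam (m n d : ℕ) : Set (Comp m n) := {lam | ∑ i, lam i = d}

/-- The compositions `λ ∈ Λ(m|n, d)` with `λ_0 = c`. -/
def LamFix (m n d c : ℕ) : Set (Comp m n) := {lam | lam ∈ Lam m n d ∧ lam 0 = c}

section

variable {m n d : ℕ}

/-- The partial sum `λ_0 + ⋯ + λ_k`. -/
def psum (lam : Comp m n) (k : ℕ) : ℕ := 
  ∑ j : Fin (m + n + 1), if (j : ℕ) ≤ k then lam j else 0

/-- The interval `R_i^λ` (which is empty for `|i| > m + n` if `λ ∈ Λ(m|n, d)`). -/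
def RR (lam : Comp m n) (i : ℤ) : Finset ℤ :=
  if i = 0 then Finset.Icc (-(psum lam 0 : ℤ)) (psum lam 0)
  else if 0 < i then Finset.Ioc (psum lam (i.natAbs - 1) : ℤ) (psum lam i.natAbs)
  else Finset.Ico (-(psum lam i.natAbs : ℤ)) (-(psum lam (i.natAbs - 1) : ℤ))

/-- The simple reflection `s_k` belongs to `W_λ`. -/
def IsGen (lam : Comp m n) (k : Fin d) : Prop := ∀ i < m + n, (k : ℕ) ≠ psum lam i

/-- The parabolic subgroup `W_λ`. -/
def WW (d : ℕ) (lam : Comp m n) : Subgroup (weylB d) :=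
  Subgroup.closure {s | ∃ k : Fin d, IsGen lam k ∧ s = simpleRefl k}

/-- The even part `W_{λ^(0)}` of `W_λ`. -/
def WEven (d : ℕ) (lam : Comp m n) : Subgroup (weylB d) :=
  Subgroup.closure {s | ∃ k : Fin d, IsGen lam k ∧ (k : ℕ) < psum lam m ∧ s = simpleRefl k}

/-- The odd part `W_{λ^(1)}` of `W_λ`. -/
def WOdd (d : ℕ) (lam : Comp m n) : Subgroup (weylB d) :=
  Subgroup.closure {s | ∃ k : Fin d, IsGen lam k ∧ psum lam m < (k : ℕ) ∧ s = simpleRefl k}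

/-- The set `D_{λμ}` of shortest representatives of the double cosets `W_λ \ W / W_μ`. -/
def DD (d : ℕ) (lam mu : Comp m n) : Set (weylB d) :=
  {g | ∀ x ∈ WW d lam, ∀ y ∈ WW d mu, len g ≤ len (x * g * y)}

/-- The set `D°_{λμ}` of those `g ∈ D_{λμ}` with the even-odd trivial intersection property. -/
def DDo (d : ℕ) (lam mu : Comp m n) : Set (weylB d) :=
  {g | g ∈ DD d lam mu ∧
    (∀ w, g * w * g⁻¹ ∈ WOdd d lam → w ∈ WEven d mu → w = 1) ∧
    (∀ w, g * w * g⁻¹ ∈ WEven d lam → w ∈ WOdd d mu → w = 1)}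

/-- The matrix `κ(λ, g, μ) = (|R_i^λ ∩ g R_j^μ|)_{i,j}`. -/
def kappa (lam : Comp m n) (g : weylB d) (mu : Comp m n) : ℤ → ℤ → ℕ :=
  fun i j => (RR lam i ∩ (RR mu j).image g.1).card

/-- The shortest representatives of `W_δ \ W`, where `W_δ = g⁻¹ W_λ g ∩ W_μ`. -/
def DDelta (d : ℕ) (lam : Comp m n) (g : weylB d) (mu : Comp m n) : Set (weylB d) :=
  {w | ∀ x, g * x * g⁻¹ ∈ WW d lam → x ∈ WW d mu → len w ≤ len (x * w)}

open Classical in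
/-- The element `[xy]_λ = x_{λ^(0)} y_{λ^(1)}` of the Hecke algebra. -/
def xy (d : ℕ) (lam : Comp m n) : Hecke d :=
  (∑ w : WEven d lam, TT w.1) *
    ∑ w : WOdd d lam, ((-1 : Lau) ^ len w.1 * vpow (-2 * (len w.1 : ℤ))) • TT w.1

open Classical in
/-- The element `T_{D_δ ∩ W_μ}`, the sum of `(-q)^{-ℓ(w^(1))} T_w` over all
`w = w^(0) w^(1) ∈ D_δ ∩ W_μ`. -/
def TDelta (lam : Comp m n) (g : weylB d) (mu : Comp m n) : Hecke d :=
  ∑ w₀ : WEven d mu, ∑ w₁ : WOdd d mu,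
    if w₀.1 * w₁.1 ∈ DDelta d lam g mu then
      ((-1 : Lau) ^ len w₁.1 * vpow (-2 * (len w₁.1 : ℤ))) • TT (w₀.1 * w₁.1)
    else 0

/-- The element `T_{W_λ g W_μ} = [xy]_λ T_g T_{D_δ ∩ W_μ}`. -/
def TDouble (lam : Comp m n) (g : weylB d) (mu : Comp m n) : Hecke d :=
  xy d lam * TT g * TDelta lam g mu

end

/-- The index set `𝕀 = [-m-n..m+n]`. -/
def II (m n : ℕ) : Finset ℤ := Finset.Icc (-((m + n : ℕ) : ℤ)) ((m + n : ℕ) : ℤ)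

/-- The set `Ξ_{m|n,d}` of matrices (extended by zero outside `𝕀 × 𝕀`). Here `i ∈ 𝕀` is even if
`|i| ≤ m` and odd otherwise. -/
def Xi (m n d : ℕ) : Set (ℤ → ℤ → ℕ) :=
  {A | (∀ i j, A i j ≠ 0 → i ∈ II m n ∧ j ∈ II m n) ∧
    ∑ i ∈ II m n, ∑ j ∈ II m n, A i j = 2 * d + 1 ∧
    (∀ i j, A i j = A (-i) (-j)) ∧
    ∀ i j : ℤ, ¬ (|i| ≤ m ↔ |j| ≤ m) → A i j = 0 ∨ A i j = 1}

/-- `row(A)`. -/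
def rowW (m n : ℕ) (A : ℤ → ℤ → ℕ) : Comp m n := fun k =>
  if k = 0 then (A 0 0 - 1) / 2 + ∑ j ∈ Finset.Icc (1 : ℤ) (m + n : ℕ), A 0 j
  else ∑ j ∈ II m n, A (k : ℕ) j

/-- `col(A)`. -/
def colW (m n : ℕ) (A : ℤ → ℤ → ℕ) : Comp m n := fun k =>
  if k = 0 then (A 0 0 - 1) / 2 + ∑ i ∈ Finset.Icc (1 : ℤ) (m + n : ℕ), A i 0
  else ∑ i ∈ II m n, A i (k : ℕ)

/-- The matrices `A ∈ Ξ_{m|n,d}` such that `row(A)` and `col(A)` lie in `P`. -/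
def XiOf (m n d : ℕ) (P : Set (Comp m n)) : Set (ℤ → ℤ → ℕ) :=
  {A | A ∈ Xi m n d ∧ rowW m n A ∈ P ∧ colW m n A ∈ P}

/-- `σ_{ij}(A) = ∑_{x ≤ i, y ≥ j} a_{xy}`. -/
def sig (m n : ℕ) (A : ℤ → ℤ → ℕ) (i j : ℤ) : ℕ :=
  ∑ x ∈ II m n with x ≤ i, ∑ y ∈ II m n with j ≤ y, A x y

/-- The partial order `≤_alg`. -/
def algLe (m n : ℕ) (A B : ℤ → ℤ → ℕ) : Prop :=
  rowW m n A = rowW m n B ∧ colW m n A = colW m n B ∧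
    ∀ i ∈ II m n, ∀ j ∈ II m n, i < j → sig m n A i j ≤ sig m n B i j

/-- The strict order `<_alg`. -/
def algLt (m n : ℕ) (A B : ℤ → ℤ → ℕ) : Prop := algLe m n A B ∧ A ≠ B

/-- The matrix `a^♮`, which differs from `A` only in the entry `(a_{00} - 1) / 2` at `(0,0)`. -/
def natural (A : ℤ → ℤ → ℕ) (i j : ℤ) : ℕ :=
  if i = 0 ∧ j = 0 then (A 0 0 - 1) / 2 else A i j

/-- The index set `I_c = ({0} × [0..m+n]) ⊔ ([1..m+n] × 𝕀)`. -/
def Ic (m n : ℕ) : Finset (ℤ × ℤ) :=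
  (II m n ×ˢ II m n).filter fun p => 0 < p.1 ∨ (p.1 = 0 ∧ 0 ≤ p.2)

/-- The length `ℓ(A)`. -/
def ell (m n : ℕ) (A : ℤ → ℤ → ℕ) : ℕ :=
  (∑ p ∈ Ic m n, ∑ r ∈ II m n ×ˢ II m n,
    if (r.1 < p.1 ∧ p.2 < r.2) ∨ (p.1 < r.1 ∧ r.2 < p.2) then
      natural A p.1 p.2 * A r.1 r.2 else 0) / 2

/-- The correction term `ℓ°(A)`, in which rows enter with the sign of their parity. -/
def ellCirc (m n : ℕ) (A : ℤ → ℤ → ℕ) : ℤ :=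
  (∑ p ∈ Ic m n, ∑ l ∈ II m n with l ≠ p.2,
    (if |p.1| ≤ m then 1 else -1) * (natural A p.1 p.2 : ℤ) * (A p.1 l : ℤ)) / 2

/-- `ℓ̂(A) = ℓ(A) + ℓ°(A)`. -/
def ellHat (m n : ℕ) (A : ℤ → ℤ → ℕ) : ℤ := ell m n A + ellCirc m n A

/-- The matrix `A°`: the odd rows of `A`, with a further entry `1` at `(0,0)`. -/
def oddRows (m : ℕ) (A : ℤ → ℤ → ℕ) (i j : ℤ) : ℕ :=
  if (m : ℤ) < |i| then A i j else if i = 0 ∧ j = 0 then 1 else 0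

/-! ### The Schur superalgebras -/

/-- The right ideal `[xy]_λ 𝓗`, as a right `𝓗`-module. -/
abbrev xyMod {m n : ℕ} (d : ℕ) (lam : Comp m n) : Submodule (Hecke d)ᵐᵒᵖ (Hecke d) :=
  Submodule.span (Hecke d)ᵐᵒᵖ {xy d lam}

/-- The generator `[xy]_λ` of `[xy]_λ 𝓗`. -/
def xyGen {m n : ℕ} (d : ℕ) (lam : Comp m n) : xyMod d lam :=
  ⟨xy d lam, Submodule.subset_span rfl⟩

/-- The right `𝓗`-module `⨁_{λ ∈ P} [xy]_λ 𝓗`; it is only used for subsets `P` of the finite set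
`Λ(m|n, d)`, so that the direct sum is the product. -/
abbrev PermMod {m n : ℕ} (d : ℕ) (P : Set (Comp m n)) : Type :=
  ∀ lam : P, xyMod d lam.1

/-- The algebra `End_𝓗 (⨁_{λ ∈ P} [xy]_λ 𝓗)`. For `P = Λ(m|n, d)` this is the `ȷ`-Schur
superalgebra. -/
abbrev Schur {m n : ℕ} (d : ℕ) (P : Set (Comp m n)) : Type :=
  Module.End (Hecke d)ᵐᵒᵖ (PermMod d P)

section

variable {m n d : ℕ} {P : Set (Comp m n)}

open Classical in
/-- The image under `f` of an element of the summand `[xy]_λ 𝓗`, projected to the summand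
`[xy]_μ 𝓗`. -/
def entry (f : Schur d P) (lam mu : P) (x : xyMod d lam.1) : Hecke d :=
  (f (Pi.single lam x) mu : xyMod d mu.1)

/-- The relation `f = e_A`: for the unique `g ∈ D°_{λμ}` with `A = κ(λ, g, μ)`, the map `f` sends
`[xy]_μ` to `T_{W_λ g W_μ} ∈ [xy]_λ 𝓗` and kills the summands `[xy]_ν 𝓗` with `ν ≠ μ`. -/
def IsStd (f : Schur d P) (A : ℤ → ℤ → ℕ) : Prop :=
  ∃ g ∈ DDo d (rowW m n A) (colW m n A), kappa (rowW m n A) g (colW m n A) = A ∧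
    ∀ nu rho : P, entry f nu rho (xyGen d nu.1) =
      if nu.1 = colW m n A ∧ rho.1 = rowW m n A then
        TDouble (rowW m n A) g (colW m n A) else 0

/-- The element `e_A`. -/
def eStd (d : ℕ) (P : Set (Comp m n)) (A : ℤ → ℤ → ℕ) : Schur d P :=
  Classical.epsilon fun f => IsStd f A

/-- The standard basis element `[A] = (-1)^{ℓ(A°)} v^{-ℓ̂(A)} e_A`. -/
def std (d : ℕ) (P : Set (Comp m n)) (A : ℤ → ℤ → ℕ) : Schur d P :=
  ((-1 : Lau) ^ ell m n (oddRows m A) * vpow (-ellHat m n A)) • eStd d P A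

/-- The relation `f' = f̄`: the `𝓗`-linear map `f'` sends the bar conjugate of `[xy]_λ` (which is a
generator of `[xy]_λ 𝓗`) to the bar conjugate of `f([xy]_λ)`. In other words, `f̄` is the
composition of the bar involution of `⨁ [xy]_λ 𝓗`, of `f`, and of the bar involution. -/
def IsBar (f f' : Schur d P) : Prop :=
  ∀ lam : P, ∃ y : xyMod d lam.1, (y : Hecke d) = heckeBar d (xy d lam.1) ∧
    ∀ mu : P, entry f' lam mu y = heckeBar d (entry f lam mu (xyGen d lam.1))

/-- The bar involution of the Schur superalgebra. -/
def schurBar (f : Schur d P) : Schur d P := Classical.epsilon fun f' => IsBar f f'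

/-- A family is a basis of the `𝒜`-module `S`. -/
def IsBasisFamily {ι S : Type*} [AddCommGroup S] [Module Lau S] (b : ι → S) : Prop :=
  LinearIndependent Lau b ∧ Submodule.span Lau (Set.range b) = ⊤

/-- The subgroup `∑_{B <_alg A} v⁻¹ ℤ[v⁻¹] [B]`. -/
def lowerTerms (d : ℕ) (P : Set (Comp m n)) (A : ℤ → ℤ → ℕ) : AddSubgroup (Schur d P) :=
  AddSubgroup.closure {x | ∃ B ∈ XiOf m n d P, algLt m n B A ∧
    ∃ k : ℕ, x = vpow (-(k : ℤ) - 1) • std d P B}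

/-- The family `C = ({A})_A` is a canonical basis relative to the standard basis `([A])_A`. -/
structure IsCanonicalBasis (d : ℕ) (P : Set (Comp m n)) (C : XiOf m n d P → Schur d P) :
    Prop where
  /-- The elements `[A]` form a basis. -/
  standard : IsBasisFamily fun A : XiOf m n d P => std d P A.1
  /-- The elements `{A}` form a basis. -/
  basis : IsBasisFamily C
  /-- The elements `{A}` are bar invariant. -/
  bar_eq : ∀ A, schurBar (C A) = C A
  /-- `{A} ∈ [A] + ∑_{B <_alg A} v⁻¹ ℤ[v⁻¹] [B]`. -/
  triangular : ∀ A, C A - std d P A.1 ∈ lowerTerms d P A.1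

open Classical in
/-- The inclusion of `⨁_{λ ∈ P} [xy]_λ 𝓗` into `⨁_{λ ∈ Q} [xy]_λ 𝓗` for `P ⊆ Q`
(extension by zero). -/
def permIncl (d : ℕ) (P Q : Set (Comp m n)) :
    PermMod d P →ₗ[(Hecke d)ᵐᵒᵖ] PermMod d Q :=
  LinearMap.pi fun lam =>
    if h : lam.1 ∈ P then
      LinearMap.proj (φ := fun lam : P => xyMod d lam.1) (⟨lam.1, h⟩ : P)
    else 0

/-- The projection of `⨁_{λ ∈ Q} [xy]_λ 𝓗` onto the sum of the summands with `λ ∈ P ⊆ Q`. -/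
def permProj (d : ℕ) {P Q : Set (Comp m n)} (h : P ⊆ Q) :
    PermMod d Q →ₗ[(Hecke d)ᵐᵒᵖ] PermMod d P :=
  LinearMap.pi fun lam =>
    LinearMap.proj (φ := fun lam : Q => xyMod d lam.1) (⟨lam.1, h lam.2⟩ : Q)

/-- For `P ⊆ Q`, the inclusion of `End_𝓗 (⨁_{λ ∈ P} [xy]_λ 𝓗)` into
`End_𝓗 (⨁_{λ ∈ Q} [xy]_λ 𝓗)` by extension by zero. -/
def schurIncl (d : ℕ) {P Q : Set (Comp m n)} (h : P ⊆ Q) (f : Schur d P) : Schur d Q :=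
  permIncl d P Q ∘ₗ f ∘ₗ permProj d h

end

lemma lamFix_subset (m n d c : ℕ) : LamFix m n d c ⊆ Lam m n d := fun _ h => h.1

lemma xiOf_mono (m n d : ℕ) {P Q : Set (Comp m n)} (h : P ⊆ Q) :
    XiOf m n d P ⊆ XiOf m n d Q := fun _ hA => ⟨hA.1, h hA.2.1, h hA.2.2⟩

/-- A symmetric sum over `[-N..N]`. -/
lemma sum_symm (N : ℕ) (f : ℤ → ℕ) (hf : ∀ i, f (-i) = f i) :
    ∑ i ∈ Finset.Icc (-(N : ℤ)) N, f i = f 0 + 2 * ∑ i ∈ Finset.Icc (1 : ℤ) N, f i := by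
  have h1 : Finset.Icc (-(N : ℤ)) N =
      insert 0 (Finset.Icc (1 : ℤ) N ∪ (Finset.Icc (1 : ℤ) N).image (fun i => -i)) := by
    ext i
    simp only [Finset.mem_Icc, Finset.mem_insert, Finset.mem_union, Finset.mem_image]
    constructor
    · intro h
      rcases lt_trichotomy i 0 with h0 | h0 | h0
      · exact Or.inr (Or.inr ⟨-i, by omega, by omega⟩)
      · exact Or.inl h0
      · exact Or.inr (Or.inl (by omega))
    · rintro (h | h | ⟨a, h, rfl⟩) <;> omega
  rw [h1, Finset.sum_insert, Finset.sum_union, Finset.sum_image]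
  · simp only [hf]
    ring
  · intro a _ b _ h
    simpa using h
  · rw [Finset.disjoint_left]
    simp only [Finset.mem_Icc, Finset.mem_image, not_exists, not_and]
    intro a h b h'
    omega
  · simp only [Finset.mem_Icc, Finset.mem_union, Finset.mem_image, not_or, not_exists, not_and]
    exact ⟨by omega, fun b h => by omega⟩

lemma sum_comp (m n : ℕ) (a : ℕ) (f : ℤ → ℕ) :
    ∑ k : Fin (m + n + 1), (if k = 0 then a else f (k : ℕ)) =
      a + ∑ i ∈ Finset.Icc (1 : ℤ) (m + n : ℕ), f i := by
  rw [Fin.sum_univ_succ]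
  simp only [if_true, Fin.succ_ne_zero, if_false, Fin.val_succ]
  congr 1
  rw [Fin.sum_univ_eq_sum_range (fun i => f ((i + 1 : ℕ) : ℤ)) (m + n)]
  refine Finset.sum_nbij (fun i => ((i + 1 : ℕ) : ℤ)) ?_ ?_ ?_ ?_
  · intro i hi
    simp only [Finset.mem_range, Finset.mem_Icc] at hi ⊢
    omega
  · intro a _ b _ h
    simpa using h
  · intro i hi
    simp only [Finset.coe_Icc, Set.mem_Icc] at hi
    exact ⟨i.toNat - 1, by simp; omega, by simp; omega⟩
  · intro i _
    rfl

lemma rowW_mem {m n d : ℕ} {A : ℤ → ℤ → ℕ} (hA : A ∈ Xi m n d) : rowW m n A ∈ Lam m n d := by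
  obtain ⟨-, h2, h3, -⟩ := hA
  have hr : ∀ i, ∑ j ∈ II m n, A (-i) j = ∑ j ∈ II m n, A i j := fun i => by
    refine Finset.sum_nbij (fun j => -j) ?_ ?_ ?_ ?_
    · intro j hj
      simp only [II, Finset.mem_Icc] at hj ⊢
      omega
    · intro a _ b _ h
      simpa using h
    · intro j hj
      refine ⟨-j, ?_, by simp⟩
      simp only [II, Finset.coe_Icc, Set.mem_Icc] at hj ⊢
      omega
    · intro j _
      rw [h3, neg_neg]
  have h4 := sum_symm (m + n) (fun i => ∑ j ∈ II m n, A i j) hr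
  have h5 := sum_symm (m + n) (fun j => A 0 j) (fun j => by rw [h3 0 j, neg_zero])
  change ∑ k, rowW m n A k = d
  unfold rowW
  rw [sum_comp m n _ fun i => ∑ j ∈ II m n, A i j]
  simp only [II] at h2 h4 h5 ⊢
  omega

lemma colW_mem {m n d : ℕ} {A : ℤ → ℤ → ℕ} (hA : A ∈ Xi m n d) : colW m n A ∈ Lam m n d := by
  refine rowW_mem (A := fun i j => A j i) (n := n) ?_
  obtain ⟨h1, h2, h3, h4⟩ := hA
  refine ⟨fun i j h => (h1 j i h).symm, ?_, fun i j => h3 j i, fun i j h => h4 j i ?_⟩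
  · rw [Finset.sum_comm]
    exact h2
  · rwa [iff_comm]

/-- For `P = Λ(m|n, d)` the index set is all of `Ξ_{m|n,d}`. -/
lemma xiOf_lam (m n d : ℕ) : XiOf m n d (Lam m n d) = Xi m n d :=
  Set.ext fun _ => ⟨fun h => h.1, fun h => ⟨h, rowW_mem h, colW_mem h⟩⟩

end

end IotaSchur

open IotaSchur

namespace IotaSchur

noncomputable section

/-! ### Lengths and inversions in the group of signed permutations -/

/-! A homomorphism from `[xy]_μ 𝓗` to `[xy]_λ 𝓗` is determined by the image `z` of `[xy]_μ`, and the
possible `z` are the elements of `𝓗` on which the generators of `W_λ` act from the left, and those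
of `W_μ` from the right, by `q` (even blocks) or `-1` (odd blocks). Such a `z` is a left multiple of
`[xy]_μ` (`exists_mul_xy`) and lies in `[xy]_λ 𝓗` (`mem_xyMod_of_eig`), so it comes from a
homomorphism (`exists_genEntry`).

In terms of coefficients, the eigenvector conditions fix the ratio of neighbouring coefficients in
`W_λ g W_μ`, so one value, at the shortest element, determines the whole double coset. Double cosets
correspond to the matrices `kappa` of common block sizes. If an entry of mixed parity exceeds 1,
some reflection is even on one side and odd on the other, and comparing both sides forces the value
to vanish (`step_eq_zero`). Otherwise `(-q)^(-N)`, with `N` the number of inversions inside odd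
blocks (`oddLen`), is a solution, and it is the coefficient function of `T_{W_λ g W_μ}`
(`TDouble_eq`). Hence the `e_A` with `A ∈ Ξ` form a basis (`isBasisFamily_std`).

The bar involution of `𝓗` preserves both eigenvector conditions. It is triangular with respect to
comparison of rank functions (`coef_heckeBar_TT`), and the numbers `σ_{ij}` are values of rank
functions at block boundaries up to a constant, so on matrices it is triangular for `≤_alg`
(`RankLe.sig_le`, `algLe_antisymm`). The diagonal coefficient is found at the longest element of the
double coset, where only one term contributes. With `topLen` the length of that element minus twice
its odd length, the coefficient of `e_A` in its conjugate is a power of `v` with exponent `-2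
(topLen A - topLen (diag (col A)))`, and a double count of inversions shows that the bracket is
`ℓ̂(A)` (`ellHat_eq`). The factor `v^{-ℓ̂(A)}` in `[A]` therefore makes the bar involution
unitriangular.

The rest is the Kazhdan–Lusztig argument for a finite ordered basis with a unitriangular semilinear
involution (`BarModule.exists_canonical`, `BarModule.unique`). Extension by zero commutes with the
bar involution, fixes the names `[A]` and preserves the lower terms, so uniqueness in the larger
algebra identifies the canonical basis of the smaller one with a restriction. -/

/-- The smaller of the two adjacent points exchanged by `s_k`. -/
def rootLo (k : ℕ) : ℤ := if k = 0 then -1 else k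

/-- The larger of the two adjacent points exchanged by `s_k`. -/
def rootHi (k : ℕ) : ℤ := k + 1

lemma simpleRefl_val {d : ℕ} (k : Fin d) : (simpleRefl k).1 = reflPerm k := rfl

lemma weylB_neg {d : ℕ} (w : weylB d) (i : ℤ) : w.1 (-i) = -w.1 i := w.2.1 i

lemma weylB_zero {d : ℕ} (w : weylB d) : w.1 0 = 0 := by
  have := w.2.1 0
  simp at this
  omega

lemma mul_val_apply {d : ℕ} (w w' : weylB d) (i : ℤ) : (w * w').1 i = w.1 (w'.1 i) := rfl

lemma inv_val_apply_val {d : ℕ} (w : weylB d) (i : ℤ) : w⁻¹.1 (w.1 i) = i := by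
  rw [← mul_val_apply, inv_mul_cancel]; rfl

lemma val_apply_inv_val {d : ℕ} (w : weylB d) (i : ℤ) : w.1 (w⁻¹.1 i) = i := by
  rw [← mul_val_apply, mul_inv_cancel]; rfl

lemma inv_val_eq_iff {d : ℕ} (w : weylB d) (i j : ℤ) : w⁻¹.1 i = j ↔ i = w.1 j :=
  ⟨fun h => by rw [← h, val_apply_inv_val], fun h => by rw [h, inv_val_apply_val]⟩

lemma reflPerm_reflPerm (k : ℕ) (i : ℤ) : reflPerm k (reflPerm k i) = i := by
  rw [← Equiv.Perm.mul_apply, reflPerm_mul_self, Equiv.Perm.one_apply]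

lemma reflPerm_rootLo (k : ℕ) : reflPerm k (rootLo k) = rootHi k := by
  rcases Nat.eq_zero_or_pos k with rfl | h
  · simp [reflPerm_zero_apply, rootLo, rootHi]
  · simp [reflPerm_apply h.ne', rootLo, rootHi, h.ne']

lemma reflPerm_rootHi (k : ℕ) : reflPerm k (rootHi k) = rootLo k := by
  rw [← reflPerm_rootLo, reflPerm_reflPerm]

lemma rootLo_lt_rootHi (k : ℕ) : rootLo k < rootHi k := by
  unfold rootLo rootHi; split_ifs <;> omega

lemma reflPerm_eq_self {k : ℕ} {i : ℤ} (h1 : i ≠ rootLo k) (h2 : i ≠ rootHi k)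
    (h3 : i ≠ -rootLo k) (h4 : i ≠ -rootHi k) : reflPerm k i = i := by
  unfold rootLo rootHi at *
  rcases Nat.eq_zero_or_pos k with rfl | h
  · rw [reflPerm_zero_apply]
    simp at h1 h2 h3 h4
    simp [h1, h2]
  · rw [reflPerm_apply h.ne']
    simp only [h.ne', if_false] at *
    split_ifs <;> omega

/-- Adjacent transpositions preserve the order of all other pairs of non-zero points. -/
lemma reflPerm_lt_iff {k : ℕ} {a b : ℤ} (ha : a ≠ 0) (hb : b ≠ 0)
    (h1 : ¬ (a = rootLo k ∧ b = rootHi k)) (h2 : ¬ (a = rootHi k ∧ b = rootLo k))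
    (h3 : ¬ (a = -rootLo k ∧ b = -rootHi k)) (h4 : ¬ (a = -rootHi k ∧ b = -rootLo k)) :
    reflPerm k a < reflPerm k b ↔ a < b := by
  unfold rootLo rootHi at *
  rcases Nat.eq_zero_or_pos k with rfl | h
  · simp only [reflPerm_zero_apply]
    simp only [if_true] at *
    split_ifs <;> omega
  · simp only [reflPerm_apply h.ne']
    simp only [h.ne', if_false] at *
    split_ifs <;> omega

/-- The points `-d, …, d`. -/
abbrev pts (d : ℕ) : Finset ℤ := Finset.Icc (-(d : ℤ)) d

lemma mem_pts {d : ℕ} {i : ℤ} : i ∈ pts d ↔ |i| ≤ d := by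
  rw [abs_le, Finset.mem_Icc]

lemma weylB_mem_pts {d : ℕ} (w : weylB d) {i : ℤ} : w.1 i ∈ pts d ↔ i ∈ pts d := by
  rw [mem_pts, mem_pts]
  refine ⟨fun h => ?_, weylB_mapsTo w⟩
  have := weylB_mapsTo w⁻¹ h
  rwa [inv_val_apply_val] at this

lemma neg_mem_pts {d : ℕ} {i : ℤ} : -i ∈ pts d ↔ i ∈ pts d := by
  rw [mem_pts, mem_pts, abs_neg]

lemma zero_mem_pts (d : ℕ) : (0 : ℤ) ∈ pts d := by simp

lemma rootLo_mem_pts {d : ℕ} (k : Fin d) : rootLo k ∈ pts d := by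
  have := k.2
  rw [Finset.mem_Icc]; unfold rootLo; split_ifs <;> omega

lemma rootHi_mem_pts {d : ℕ} (k : Fin d) : rootHi k ∈ pts d := by
  have := k.2
  rw [Finset.mem_Icc]; unfold rootHi; omega

/-- The pair `(x, y)` is inverted by `f`. -/
def Inverted (f : ℤ → ℤ) (x y : ℤ) : Prop := (x < y ∧ f y < f x) ∨ (y < x ∧ f x < f y)

instance (f : ℤ → ℤ) (x y : ℤ) : Decidable (Inverted f x y) := by
  unfold Inverted; infer_instance

/-- The set of ordered pairs `(x, y)` with `x ≠ 0` which are inverted by `w`. -/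
def invPairs {d : ℕ} (w : weylB d) : Finset (ℤ × ℤ) :=
  ((pts d).erase 0 ×ˢ pts d).filter fun p => Inverted w.1 p.1 p.2

/-- The four pairs `(x, y)` with `x ≠ 0` whose order is reversed by `s_k`. -/
def rootPairs (k : ℕ) : Finset (ℤ × ℤ) :=
  if k = 0 then {(-1, 1), (1, -1), (1, 0), (-1, 0)}
  else {((k : ℤ), (k : ℤ) + 1), ((k : ℤ) + 1, (k : ℤ)), (-(k : ℤ), -(k : ℤ) - 1),
    (-(k : ℤ) - 1, -(k : ℤ))}

/-- Excluding a zero first coordinate is what makes the number four for every `k`: `s_0` reverses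
six ordered pairs in all, because both `1` and `-1` also pass `0`. -/
lemma card_rootPairs (k : ℕ) : (rootPairs k).card = 4 := by
  unfold rootPairs
  split_ifs with h
  · decide
  · rw [Finset.card_insert_of_notMem, Finset.card_insert_of_notMem,
      Finset.card_insert_of_notMem, Finset.card_singleton]
    all_goals
      simp only [Finset.mem_insert, Finset.mem_singleton, Prod.mk.injEq, not_or, not_and]
      omega

lemma mem_rootPairs {d : ℕ} {k : Fin d} {p : ℤ × ℤ} (h : p ∈ rootPairs k) :
    p.1 ∈ (pts d).erase 0 ∧ p.2 ∈ pts d := by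
  have := k.2
  unfold rootPairs at h
  simp only [Finset.mem_erase, Finset.mem_Icc]
  split_ifs at h with h0 <;>
  · simp only [Finset.mem_insert, Finset.mem_singleton, Prod.ext_iff] at h
    omega

lemma inverted_simple_mul_of_mem {d : ℕ} (w : weylB d) (k : Fin d)
    (h : w⁻¹.1 (rootLo k) < w⁻¹.1 (rootHi k)) (p : ℤ × ℤ) (hp : p ∈ rootPairs k) :
    ¬ Inverted w.1 (w⁻¹.1 p.1) (w⁻¹.1 p.2) ∧
      Inverted (simpleRefl k * w).1 (w⁻¹.1 p.1) (w⁻¹.1 p.2) := by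
  obtain ⟨a, b⟩ := p
  simp only [Inverted, mul_val_apply, val_apply_inv_val, simpleRefl_val]
  unfold rootPairs at hp
  unfold rootLo rootHi at h
  have e := weylB_neg w⁻¹
  have e0 := weylB_zero w⁻¹
  split_ifs at h hp with h0
  · simp only [h0, reflPerm_zero_apply, Finset.mem_insert, Finset.mem_singleton, Prod.mk.injEq]
      at h hp ⊢
    have e1 := e 1
    generalize w⁻¹.1 = f at e0 e1 h ⊢
    norm_num at h
    rcases hp with ⟨rfl, rfl⟩ | ⟨rfl, rfl⟩ | ⟨rfl, rfl⟩ | ⟨rfl, rfl⟩ <;> norm_num <;> omega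
  · simp only [reflPerm_apply h0, Finset.mem_insert, Finset.mem_singleton, Prod.mk.injEq]
      at hp ⊢
    have e1 := e (k : ℕ)
    have e2 := e ((k : ℕ) + 1)
    rw [neg_add, ← sub_eq_add_neg] at e2
    rcases hp with ⟨rfl, rfl⟩ | ⟨rfl, rfl⟩ | ⟨rfl, rfl⟩ | ⟨rfl, rfl⟩ <;>
      split_ifs <;> omega

lemma inverted_simple_mul_of_notMem {d : ℕ} (w : weylB d) (k : Fin d) (x y : ℤ)
    (hx : x ≠ 0) (hp : (w.1 x, w.1 y) ∉ rootPairs k) :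
    Inverted (simpleRefl k * w).1 x y ↔ Inverted w.1 x y := by
  simp only [Inverted, mul_val_apply, simpleRefl_val]
  have hx' : w.1 x ≠ 0 := fun h => hx (by
    rw [← weylB_zero w] at h
    exact w.1.injective h)
  unfold rootPairs at hp
  split_ifs at hp with h0
  · simp only [h0, reflPerm_zero_apply, Finset.mem_insert, Finset.mem_singleton, Prod.mk.injEq]
      at hp ⊢
    split_ifs <;> omega
  · simp only [reflPerm_apply h0, Finset.mem_insert, Finset.mem_singleton, Prod.mk.injEq]
      at hp ⊢
    split_ifs <;> omega

/-- The four pairs that `w` carries to root pairs of `s_k` become inverted; as `s_k` exchanges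
adjacent points only, every other pair with non-zero first coordinate keeps its status. -/
lemma card_invPairs_simple_mul {d : ℕ} (w : weylB d) (k : Fin d)
    (h : w⁻¹.1 (rootLo k) < w⁻¹.1 (rootHi k)) :
    (invPairs (simpleRefl k * w)).card = (invPairs w).card + 4 := by
  set D : Finset (ℤ × ℤ) := (rootPairs k).image fun p => (w⁻¹.1 p.1, w⁻¹.1 p.2) with hD
  have hcard : D.card = 4 := by
    rw [hD, Finset.card_image_of_injective, card_rootPairs]
    intro p p' hpp
    simp only [Prod.mk.injEq, EmbeddingLike.apply_eq_iff_eq] at hpp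
    exact Prod.ext hpp.1 hpp.2
  have hmemD : ∀ x y, (x, y) ∈ D ↔ (w.1 x, w.1 y) ∈ rootPairs k := fun x y => by
    rw [hD, Finset.mem_image]
    constructor
    · rintro ⟨p, hp, he⟩
      simp only [Prod.mk.injEq, inv_val_eq_iff] at he
      rw [← he.1, ← he.2]; exact hp
    · intro hp
      exact ⟨_, hp, by simp⟩
  have hE : invPairs (simpleRefl k * w) = invPairs w ∪ D := by
    ext ⟨x, y⟩
    simp only [Finset.mem_union, hmemD, invPairs, Finset.mem_filter, Finset.mem_product]
    by_cases hp : (w.1 x, w.1 y) ∈ rootPairs k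
    · have h1 := inverted_simple_mul_of_mem w k h _ hp
      have h2 := mem_rootPairs hp
      simp only [inv_val_apply_val] at h1
      simp only [Finset.mem_erase, weylB_mem_pts] at h2
      have h3 : x ≠ 0 := fun h0 => h2.1.1 (by rw [h0, weylB_zero])
      simp only [Finset.mem_erase]
      tauto
    · by_cases hx : x = 0
      · simp [hx]
        intro h5; exact absurd h5 (by rw [hx] at hp; exact hp)
      · rw [inverted_simple_mul_of_notMem w k x y hx hp]
        tauto
  rw [hE, Finset.card_union_of_disjoint, hcard]
  rw [Finset.disjoint_left]
  rintro ⟨x, y⟩ h1 h2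
  rw [hmemD] at h2
  have h3 := (inverted_simple_mul_of_mem w k h _ h2).1
  simp only [inv_val_apply_val] at h3
  simp only [invPairs, Finset.mem_filter] at h1
  exact h3 h1.2

lemma simple_mul_simple_mul {d : ℕ} (k : Fin d) (w : weylB d) :
    simpleRefl k * (simpleRefl k * w) = w := by
  rw [← mul_assoc, simpleRefl_mul_self, one_mul]

lemma mul_simple_mul_simple {d : ℕ} (k : Fin d) (w : weylB d) :
    w * simpleRefl k * simpleRefl k = w := by
  rw [mul_assoc, simpleRefl_mul_self, mul_one]

lemma inv_simple_mul_apply {d : ℕ} (w : weylB d) (k : Fin d) (i : ℤ) :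
    (simpleRefl k * w)⁻¹.1 i = w⁻¹.1 (reflPerm k i) := by
  rw [mul_inv_rev, simpleRefl_inv]; rfl

lemma card_invPairs_simple_mul' {d : ℕ} (w : weylB d) (k : Fin d)
    (h : w⁻¹.1 (rootHi k) < w⁻¹.1 (rootLo k)) :
    (invPairs (simpleRefl k * w)).card + 4 = (invPairs w).card := by
  have := card_invPairs_simple_mul (simpleRefl k * w) k (by
    rw [inv_simple_mul_apply, inv_simple_mul_apply, reflPerm_rootLo, reflPerm_rootHi]
    exact h)
  rw [simple_mul_simple_mul] at this
  exact this.symm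

lemma apply_root_ne {d : ℕ} (w : weylB d) (k : ℕ) : w.1 (rootLo k) ≠ w.1 (rootHi k) :=
  fun h => (rootLo_lt_rootHi k).ne (w.1.injective h)

/-- The ascent at `s_0` says `w (-1) < w 1`, hence `w 1 > 0`. The others give `0 < w 1 < ⋯ < w d ≤
d`, which leaves only the identity. -/
lemma eq_one_of_ascents {d : ℕ} (w : weylB d)
    (h : ∀ k : Fin d, w.1 (rootLo k) < w.1 (rootHi k)) : w = 1 := by
  have h1 : ∀ j : ℕ, j ≤ d → (j : ℤ) ≤ w.1 j := by
    intro j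
    induction j with
    | zero => intro _; simp [weylB_zero]
    | succ j ih =>
      intro hj
      have h2 := h ⟨j, by omega⟩
      have h3 := ih (by omega)
      unfold rootLo rootHi at h2
      push_cast
      split_ifs at h2 with h0
      · simp only at h0
        subst h0
        have := weylB_neg w 1
        simp at h2 ⊢
        omega
      · simp only at h2 h3
        omega
  have h2 : ∀ t j : ℕ, j + t = d → w.1 j = j := by
    intro t
    induction t with
    | zero =>
      intro j hj
      have h3 := h1 j (by omega)
      have h4 := weylB_mapsTo w (i := j) (by simp; omega)
      rw [abs_le] at h4
      omega
    | succ t ih =>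
      intro j hj
      have h3 := ih (j + 1) (by omega)
      have h4 := h1 j (by omega)
      rcases Nat.eq_zero_or_pos j with h0 | h0
      · simp [h0, weylB_zero]
      · have h5 := h ⟨j, by omega⟩
        unfold rootLo rootHi at h5
        rw [if_neg (by simp; omega)] at h5
        push_cast at h3
        simp only at h5
        omega
  refine Subtype.ext (Equiv.ext fun i => ?_)
  change w.1 i = i
  by_cases hi : (d : ℤ) < |i|
  · exact w.2.2 i hi
  · rcases le_total 0 i with h0 | h0
    · rw [abs_of_nonneg h0] at hi
      have := h2 (d - i.toNat) i.toNat (by omega)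
      rwa [Int.toNat_of_nonneg h0] at this
    · rw [abs_of_nonpos h0] at hi
      have := h2 (d - (-i).toNat) (-i).toNat (by omega)
      rw [Int.toNat_of_nonneg (by omega), weylB_neg] at this
      omega

lemma card_invPairs_one (d : ℕ) : (invPairs (1 : weylB d)).card = 0 := by
  rw [Finset.card_eq_zero, invPairs, Finset.filter_eq_empty_iff]
  intro p _
  simp only [Inverted, OneMemClass.coe_one, Equiv.Perm.one_apply]
  omega

lemma card_invPairs_word {d : ℕ} (l : List (Fin d)) :
    (invPairs (l.map simpleRefl).prod).card ≤ 4 * l.length := by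
  induction l with
  | nil => simp [card_invPairs_one]
  | cons k l ih =>
    simp only [List.map_cons, List.prod_cons, List.length_cons]
    rcases lt_or_gt_of_ne (apply_root_ne (l.map simpleRefl).prod⁻¹ k) with h | h
    · have := card_invPairs_simple_mul _ k h
      omega
    · have := card_invPairs_simple_mul' _ k h
      omega

/-- The length is a quarter of the number of ordered inverted pairs. -/
theorem card_invPairs {d : ℕ} (w : weylB d) : (invPairs w).card = 4 * len w := by
  apply le_antisymm
  · obtain ⟨l, hl, rfl⟩ := exists_reduced w
    rw [← hl]
    exact card_invPairs_word l
  -- An element other than `1` has a left descent. Removing it costs four inverted pairs and changes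
  -- the length by at most one.
  · obtain ⟨N, hN⟩ : ∃ N, (invPairs w).card = N := ⟨_, rfl⟩
    induction N using Nat.strong_induction_on generalizing w with
    | _ N ih =>
      by_cases hw : w = 1
      · simp [hw, len_one]
      · obtain ⟨k, hk⟩ : ∃ k : Fin d, w⁻¹.1 (rootHi k) < w⁻¹.1 (rootLo k) := by
          by_contra! hcon
          exact hw (inv_eq_one.1 (eq_one_of_ascents w⁻¹ fun k =>
            lt_of_le_of_ne (hcon k) (apply_root_ne _ _)))
        have h1 := card_invPairs_simple_mul' w k hk
        have h2 := ih _ (by omega) (simpleRefl k * w) rfl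
        have h3 := len_mul_le (simpleRefl k) (simpleRefl k * w)
        rw [simple_mul_simple_mul] at h3
        have h4 := len_simple_le k
        omega

lemma len_simple_mul {d : ℕ} (w : weylB d) (k : Fin d)
    (h : w⁻¹.1 (rootLo k) < w⁻¹.1 (rootHi k)) : len (simpleRefl k * w) = len w + 1 := by
  have := card_invPairs_simple_mul w k h
  rw [card_invPairs, card_invPairs] at this
  omega

lemma len_simple_mul' {d : ℕ} (w : weylB d) (k : Fin d)
    (h : w⁻¹.1 (rootHi k) < w⁻¹.1 (rootLo k)) : len (simpleRefl k * w) + 1 = len w := by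
  have := card_invPairs_simple_mul' w k h
  rw [card_invPairs, card_invPairs] at this
  omega

lemma lt_len_simple_mul_iff {d : ℕ} (w : weylB d) (k : Fin d) :
    len w < len (simpleRefl k * w) ↔ w⁻¹.1 (rootLo k) < w⁻¹.1 (rootHi k) := by
  rcases lt_or_gt_of_ne (apply_root_ne w⁻¹ k) with h | h
  · have := len_simple_mul w k h
    exact iff_of_true (by omega) h
  · have := len_simple_mul' w k h
    exact iff_of_false (by omega) h.not_gt

lemma mul_simple_eq_inv {d : ℕ} (w : weylB d) (k : Fin d) :
    len (w * simpleRefl k) = len (simpleRefl k * w⁻¹) := by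
  rw [← len_inv, mul_inv_rev, simpleRefl_inv]

lemma len_mul_simple {d : ℕ} (w : weylB d) (k : Fin d)
    (h : w.1 (rootLo k) < w.1 (rootHi k)) : len (w * simpleRefl k) = len w + 1 := by
  rw [mul_simple_eq_inv, len_simple_mul _ _ (by rwa [inv_inv]), len_inv]

lemma len_mul_simple' {d : ℕ} (w : weylB d) (k : Fin d)
    (h : w.1 (rootHi k) < w.1 (rootLo k)) : len (w * simpleRefl k) + 1 = len w := by
  rw [mul_simple_eq_inv, len_simple_mul' _ _ (by rwa [inv_inv]), len_inv]

lemma lt_len_mul_simple_iff {d : ℕ} (w : weylB d) (k : Fin d) :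
    len w < len (w * simpleRefl k) ↔ w.1 (rootLo k) < w.1 (rootHi k) := by
  rw [mul_simple_eq_inv, ← len_inv w, lt_len_simple_mul_iff, inv_inv]

lemma len_simple {d : ℕ} (k : Fin d) : len (simpleRefl k) = 1 := by
  have := len_simple_mul 1 k (by rw [inv_one]; exact rootLo_lt_rootHi k)
  rwa [mul_one, len_one] at this

lemma len_eq_zero {d : ℕ} {w : weylB d} (h : len w = 0) : w = 1 := by
  obtain ⟨l, hl, rfl⟩ := exists_reduced w
  rw [h, List.length_eq_zero_iff] at hl
  simp [hl]

lemma exists_right_descent {d : ℕ} {w : weylB d} (h : w ≠ 1) :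
    ∃ k : Fin d, w.1 (rootHi k) < w.1 (rootLo k) := by
  by_contra! hcon
  exact h (eq_one_of_ascents w fun k => lt_of_le_of_ne (hcon k) (apply_root_ne _ _))

/-- Induction over the elements of the group, multiplying by simple reflections on the right. -/
lemma weylB_induction_right {d : ℕ} {p : weylB d → Prop} (one : p 1)
    (step : ∀ w k, w.1 (rootLo k) < w.1 (rootHi k) → p w → p (w * simpleRefl k))
    (w : weylB d) : p w := by
  obtain ⟨N, hN⟩ : ∃ N, len w = N := ⟨_, rfl⟩
  induction N generalizing w with
  | zero => rw [len_eq_zero hN]; exact one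
  | succ N ih =>
    obtain ⟨k, hk⟩ := exists_right_descent (w := w) (by rintro rfl; simp [len_one] at hN)
    have h1 := len_mul_simple' w k hk
    have h2 := step (w * simpleRefl k) k
      (by
        rw [mul_val_apply, mul_val_apply, simpleRefl_val, reflPerm_rootLo, reflPerm_rootHi]
        exact hk) (ih _ (by omega))
    rwa [mul_simple_mul_simple] at h2

/-- Lengths add in `g y` if no inversion of `y⁻¹` is an inversion of `g`. -/
lemma len_mul_of_inv {d : ℕ} (g y : weylB d)
    (h : ∀ a b, a < b → y⁻¹.1 b < y⁻¹.1 a → g.1 a < g.1 b) : len (g * y) = len g + len y := by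
  induction y using weylB_induction_right with
  | one => simp [len_one]
  | step y k hk ih =>
    have e : ∀ i, (y * simpleRefl k)⁻¹.1 i = reflPerm k (y⁻¹.1 i) := fun i => by
      rw [mul_inv_rev, simpleRefl_inv]; rfl
    simp only [e] at h
    have h1 : (g * y).1 (rootLo k) < (g * y).1 (rootHi k) := by
      apply h _ _ hk
      simp only [inv_val_apply_val, reflPerm_rootLo, reflPerm_rootHi]
      exact rootLo_lt_rootHi k
    have hz : ∀ a, y⁻¹.1 a = 0 → a = 0 := fun a ha => by
      rw [inv_val_eq_iff, weylB_zero] at ha; exact ha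
    have hneg := weylB_neg y
    -- A pair inverted by `y⁻¹` stays inverted after `s_k`, unless it is a root pair, and this is
    -- excluded by the ascent `hk`. Pairs containing `0` escape `reflPerm_lt_iff`; for them the
    -- hypothesis is applied to a point and its negative.
    have h2 := ih fun a b hab hba => by
      by_cases ha : a = 0
      · subst ha
        have hb := weylB_zero g
        have hb' := weylB_zero y⁻¹
        rw [hb'] at hba
        have h3 := h (-b) b (by omega)
        rw [weylB_neg, weylB_neg, hb] at *
        have h4 := weylB_neg ⟨reflPerm k, reflPerm_mem k.2⟩ (y⁻¹.1 b)
        simp only at h4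
        rw [h4] at h3
        have h5 : reflPerm k (y⁻¹.1 b) < 0 ∨ y⁻¹.1 b = -1 := by
          by_cases h6 : y⁻¹.1 b = -1
          · exact Or.inr h6
          · left
            rcases Nat.eq_zero_or_pos (k : ℕ) with h0 | h0
            · rw [h0, reflPerm_zero_apply]; split_ifs <;> omega
            · rw [reflPerm_apply h0.ne']; split_ifs <;> omega
        rcases h5 with h5 | h5
        · have := h3 (by omega); omega
        · by_cases h0 : (k : ℕ) = 0
          · rw [inv_val_eq_iff, hneg] at h5
            rw [h0] at hk
            simp [rootLo, rootHi, hneg] at hk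
            omega
          · have : reflPerm k (y⁻¹.1 b) < 0 := by
              rw [reflPerm_apply h0]; split_ifs <;> omega
            have := h3 (by omega); omega
      by_cases hb : b = 0
      · subst hb
        have hb := weylB_zero g
        have hb' := weylB_zero y⁻¹
        rw [hb'] at hba
        have h3 := h a (-a) (by omega)
        rw [weylB_neg, weylB_neg, hb] at *
        have h4 := weylB_neg ⟨reflPerm k, reflPerm_mem k.2⟩ (y⁻¹.1 a)
        simp only at h4
        rw [h4] at h3
        have h5 : 0 < reflPerm k (y⁻¹.1 a) ∨ (y⁻¹.1 a = 1 ∧ (k : ℕ) = 0) := by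
          rcases Nat.eq_zero_or_pos (k : ℕ) with h0 | h0
          · rw [h0, reflPerm_zero_apply]; split_ifs <;> omega
          · rw [reflPerm_apply h0.ne']; split_ifs <;> omega
        rcases h5 with h5 | ⟨h5, h0⟩
        · have := h3 (by omega); omega
        · rw [inv_val_eq_iff] at h5
          rw [h0] at hk
          simp [rootLo, rootHi, hneg] at hk
          omega
      refine h a b hab ?_
      rw [reflPerm_lt_iff (fun h => hb (hz _ h)) (fun h => ha (hz _ h))]
      · exact hba
      · rintro ⟨h3, h4⟩
        rw [inv_val_eq_iff] at h3 h4
        omega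
      · rintro ⟨h3, h4⟩
        have := rootLo_lt_rootHi k
        omega
      · rintro ⟨h3, h4⟩
        have := rootLo_lt_rootHi k
        omega
      · rintro ⟨h3, h4⟩
        rw [inv_val_eq_iff, hneg] at h3 h4
        omega
    rw [← mul_assoc, len_mul_simple _ _ h1, h2, len_mul_simple _ _ hk, add_assoc]

/-- If multiplication by `t` on the right changes whether `s` is a left descent of `w`, then
`s w = w t`. -/
lemma simple_mul_eq_mul_simple {d : ℕ} (w : weylB d) (k l : Fin d)
    (h : ¬ (len w < len (simpleRefl k * w) ↔
      len (w * simpleRefl l) < len (simpleRefl k * (w * simpleRefl l)))) :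
    simpleRefl k * w = w * simpleRefl l := by
  rw [lt_len_simple_mul_iff, lt_len_simple_mul_iff, mul_inv_rev, simpleRefl_inv, mul_val_apply,
    mul_val_apply, simpleRefl_val] at h
  have hz : ∀ a, w⁻¹.1 a = 0 → a = 0 := fun a ha => by
    rw [inv_val_eq_iff, weylB_zero] at ha; exact ha
  have h1 : w⁻¹.1 (rootLo k) ≠ 0 := fun h => by
    have := hz _ h
    unfold rootLo at this
    split_ifs at this; omega
  have h2 : w⁻¹.1 (rootHi k) ≠ 0 := fun h => by
    have := hz _ h
    unfold rootHi at this
    omega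
  -- The order of the two preimages of the root pair of `k` can change under `s_l` only if they form
  -- a root pair of `l`, up to sign and order. Then `w` carries one root pair to the other and so
  -- conjugates `s_l` into `s_k`.
  have key : (rootLo k = w.1 (rootLo l) ∧ rootHi k = w.1 (rootHi l)) ∨
      (rootLo k = w.1 (rootHi l) ∧ rootHi k = w.1 (rootLo l)) ∨
      (rootLo k = -w.1 (rootLo l) ∧ rootHi k = -w.1 (rootHi l)) ∨
      (rootLo k = -w.1 (rootHi l) ∧ rootHi k = -w.1 (rootLo l)) := by
    by_contra hcon
    simp only [not_or] at hcon
    apply h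
    rw [reflPerm_lt_iff h1 h2] <;> simp only [inv_val_eq_iff, weylB_neg] <;> tauto
  have hneg : ∀ (j : Fin d) i, reflPerm j (-i) = -reflPerm j i := fun j i =>
    (reflPerm_mem j.2).1 i
  have hL : ∀ j : Fin d, reflPerm j (rootLo j) = rootHi j := fun j => reflPerm_rootLo j
  have hH : ∀ j : Fin d, reflPerm j (rootHi j) = rootLo j := fun j => reflPerm_rootHi j
  have hw := weylB_neg w
  refine Subtype.ext (Equiv.ext fun i => ?_)
  rw [mul_val_apply, mul_val_apply, simpleRefl_val, simpleRefl_val]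
  by_cases c1 : i = rootLo l
  · subst c1
    rw [hL]
    rcases key with h | h | h | h
    · rw [← h.1, ← h.2, hL]
    · rw [← h.1, ← h.2, hH]
    · have : w.1 (rootLo l) = -rootLo k := by omega
      rw [this, hneg, hL]; omega
    · have : w.1 (rootLo l) = -rootHi k := by omega
      rw [this, hneg, hH]; omega
  by_cases c2 : i = rootHi l
  · subst c2
    rw [hH]
    rcases key with h | h | h | h
    · rw [← h.1, ← h.2, hH]
    · rw [← h.1, ← h.2, hL]
    · have : w.1 (rootHi l) = -rootHi k := by omega
      rw [this, hneg, hH]; omega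
    · have : w.1 (rootHi l) = -rootLo k := by omega
      rw [this, hneg, hL]; omega
  by_cases c3 : i = -rootLo l
  · subst c3
    rw [hneg, hL, hw, hw, hneg]
    rcases key with h | h | h | h
    · rw [← h.1, ← h.2, hL]
    · rw [← h.1, ← h.2, hH]
    · have : w.1 (rootLo l) = -rootLo k := by omega
      rw [this, hneg, hL]; omega
    · have : w.1 (rootLo l) = -rootHi k := by omega
      rw [this, hneg, hH]; omega
  by_cases c4 : i = -rootHi l
  · subst c4
    rw [hneg, hH, hw, hw, hneg]
    rcases key with h | h | h | h
    · rw [← h.1, ← h.2, hH]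
    · rw [← h.1, ← h.2, hL]
    · have : w.1 (rootHi l) = -rootHi k := by omega
      rw [this, hneg, hH]; omega
    · have : w.1 (rootHi l) = -rootLo k := by omega
      rw [this, hneg, hL]; omega
  rw [reflPerm_eq_self c1 c2 c3 c4]
  have inj : ∀ a b, w.1 a = w.1 b → a = b := fun a b h => w.1.injective h
  have hi1 : ∀ j, w.1 i = w.1 j → i = j := fun j h => inj _ _ h
  have hi2 : ∀ j, w.1 i = -w.1 j → i = -j := fun j h => inj _ _ (by rw [hw]; exact h)
  have g1 := hi1 (rootLo l)
  have g2 := hi1 (rootHi l)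
  have g3 := hi2 (rootLo l)
  have g4 := hi2 (rootHi l)
  apply reflPerm_eq_self <;> omega

end

end IotaSchur

namespace IotaSchur

noncomputable section

/-! ### The standard basis of the Hecke algebra -/

section

variable {d : ℕ}

lemma len_simple_mul_ne (k : Fin d) (w : weylB d) : len (simpleRefl k * w) ≠ len w := by
  rcases lt_or_gt_of_ne (apply_root_ne w⁻¹ k) with h | h
  · have := len_simple_mul w k h; omega
  · have := len_simple_mul' w k h; omega

lemma len_mul_simple_ne (k : Fin d) (w : weylB d) : len (w * simpleRefl k) ≠ len w := by
  rw [mul_simple_eq_inv, ← len_inv w]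
  exact len_simple_mul_ne k w⁻¹

/-- Left multiplication by `T_{s_k}` in terms of coefficient functions. -/
def leftOp (k : Fin d) : Module.End Lau (weylB d → Lau) where
  toFun f w := if len w < len (simpleRefl k * w) then qq * f (simpleRefl k * w)
    else f (simpleRefl k * w) + (qq - 1) * f w
  map_add' f g := by
    funext w
    simp only [Pi.add_apply]
    split_ifs <;> ring
  map_smul' c f := by
    funext w
    simp only [Pi.smul_apply, smul_eq_mul, RingHom.id_apply]
    split_ifs <;> ring

/-- Right multiplication by `T_{s_k}` in terms of coefficient functions. -/
def rightOp (k : Fin d) : Module.End Lau (weylB d → Lau) where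
  toFun f w := if len w < len (w * simpleRefl k) then qq * f (w * simpleRefl k)
    else f (w * simpleRefl k) + (qq - 1) * f w
  map_add' f g := by
    funext w
    simp only [Pi.add_apply]
    split_ifs <;> ring
  map_smul' c f := by
    funext w
    simp only [Pi.smul_apply, smul_eq_mul, RingHom.id_apply]
    split_ifs <;> ring

lemma leftOp_apply (k : Fin d) (f : weylB d → Lau) (w : weylB d) :
    leftOp k f w = if len w < len (simpleRefl k * w) then qq * f (simpleRefl k * w)
      else f (simpleRefl k * w) + (qq - 1) * f w := rfl

lemma rightOp_apply (k : Fin d) (f : weylB d → Lau) (w : weylB d) :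
    rightOp k f w = if len w < len (w * simpleRefl k) then qq * f (w * simpleRefl k)
      else f (w * simpleRefl k) + (qq - 1) * f w := rfl

/-- If `s w ≠ w t`, then by `simple_mul_eq_mul_simple` multiplication by `t` does not affect the
case distinction for `s`, nor conversely, and the formulas commute term by term. If `s w = w t`,
both sides involve only the values at `w` and `s w` and agree. -/
lemma leftOp_rightOp (k l : Fin d) (f : weylB d → Lau) :
    leftOp k (rightOp l f) = rightOp l (leftOp k f) := by
  funext w
  simp only [leftOp_apply, rightOp_apply]
  by_cases h : simpleRefl k * w = w * simpleRefl l
  · have h1 : simpleRefl k * w * simpleRefl l = w := by rw [h, mul_simple_mul_simple]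
    have h2 : simpleRefl k * (w * simpleRefl l) = w := by rw [← h, simple_mul_simple_mul]
    rw [h1, h2, ← h]
  · have h1 : len w < len (simpleRefl k * w) ↔
        len (w * simpleRefl l) < len (simpleRefl k * (w * simpleRefl l)) := by
      by_contra hc
      exact h (simple_mul_eq_mul_simple w k l hc)
    have h2 : len w < len (w * simpleRefl l) ↔
        len (simpleRefl k * w) < len (simpleRefl k * w * simpleRefl l) := by
      by_contra hc
      apply h
      have := simple_mul_eq_mul_simple w⁻¹ l k (by
        rw [mul_simple_eq_inv, mul_simple_eq_inv, mul_inv_rev, simpleRefl_inv, ← len_inv w,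
          ← len_inv (simpleRefl k * w), mul_inv_rev, simpleRefl_inv] at hc
        exact hc)
      have h3 := congrArg (·⁻¹) this
      simp only [mul_inv_rev, simpleRefl_inv, inv_inv] at h3
      exact h3.symm
    simp only [← h1, ← h2]
    simp only [mul_assoc]
    split_ifs <;> ring

open Classical in
/-- The coefficient function of `T_u`. -/
def deltaFun (u : weylB d) : weylB d → Lau := Pi.single u 1

lemma deltaFun_apply (u w : weylB d) [Decidable (w = u)] :
    deltaFun u w = if w = u then 1 else 0 := by
  classical
  rw [deltaFun, Pi.single_apply]
  congr

lemma leftOp_delta (k : Fin d) (u : weylB d) (h : len u < len (simpleRefl k * u)) :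
    leftOp k (deltaFun u) = deltaFun (simpleRefl k * u) := by
  classical
  funext w
  rw [leftOp_apply, deltaFun_apply, deltaFun_apply, deltaFun_apply]
  have h1 : simpleRefl k * w = u ↔ w = simpleRefl k * u :=
    ⟨fun h => by rw [← h, simple_mul_simple_mul], fun h => by rw [h, simple_mul_simple_mul]⟩
  simp only [h1]
  by_cases h2 : w = simpleRefl k * u
  · subst h2
    have h3 : simpleRefl k * u ≠ u := fun h' => by rw [h'] at h; omega
    simp [simple_mul_simple_mul, h3, h.le]
  · by_cases h3 : w = u
    · subst h3; simp [h2, h]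
    · simp [h2, h3]

lemma rightOp_delta (k : Fin d) (u : weylB d) (h : len u < len (u * simpleRefl k)) :
    rightOp k (deltaFun u) = deltaFun (u * simpleRefl k) := by
  classical
  funext w
  rw [rightOp_apply, deltaFun_apply, deltaFun_apply, deltaFun_apply]
  have h1 : w * simpleRefl k = u ↔ w = u * simpleRefl k :=
    ⟨fun h => by rw [← h, mul_simple_mul_simple], fun h => by rw [h, mul_simple_mul_simple]⟩
  simp only [h1]
  by_cases h2 : w = u * simpleRefl k
  · subst h2
    have h3 : u * simpleRefl k ≠ u := fun h' => by rw [h'] at h; omega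
    simp [mul_simple_mul_simple, h3, h.le]
  · by_cases h3 : w = u
    · subst h3; simp [h2, h]
    · simp [h2, h3]

/-- An operator commuting with all right multiplications is determined by its value at `1`. -/
lemma end_ext (X Y : Module.End Lau (weylB d → Lau))
    (hX : ∀ k f, X (rightOp k f) = rightOp k (X f)) (hY : ∀ k f, Y (rightOp k f) = rightOp k (Y f))
    (h : X (deltaFun 1) = Y (deltaFun 1)) : X = Y := by
  classical
  have key : ∀ w, X (deltaFun w) = Y (deltaFun w) := by
    intro w
    induction w using weylB_induction_right with
    | one => exact h
    | step w k hk ih =>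
      rw [← rightOp_delta k w ((lt_len_mul_simple_iff w k).2 hk), hX, hY, ih]
  refine LinearMap.pi_ext' fun w => LinearMap.ext_ring ?_
  exact key w

/-- The product of left multiplications along a word. -/
def wordOp (l : List (Fin d)) : Module.End Lau (weylB d → Lau) := (l.map leftOp).prod

lemma wordOp_rightOp (l : List (Fin d)) (k : Fin d) (f : weylB d → Lau) :
    wordOp l (rightOp k f) = rightOp k (wordOp l f) := by
  induction l with
  | nil => rfl
  | cons j l ih =>
    simp only [wordOp, List.map_cons, List.prod_cons, Module.End.mul_apply] at ih ⊢
    rw [ih, leftOp_rightOp]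

lemma wordOp_delta (l : List (Fin d)) (u : weylB d)
    (h : len ((l.map simpleRefl).prod * u) = l.length + len u) :
    wordOp l (deltaFun u) = deltaFun ((l.map simpleRefl).prod * u) := by
  induction l with
  | nil => simp [wordOp]
  | cons j l ih =>
    simp only [wordOp, List.map_cons, List.prod_cons, Module.End.mul_apply, List.length_cons,
      mul_assoc] at ih h ⊢
    have h1 := len_mul_le (simpleRefl j) ((l.map simpleRefl).prod * u)
    have h2 := len_mul_le (l.map simpleRefl).prod u
    have h3 := len_le l
    rw [len_simple] at h1
    rw [ih (by omega), leftOp_delta _ _ (by omega)]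

/-- A reduced word of `w`. -/
def redWord (w : weylB d) : List (Fin d) := (exists_reduced w).choose

lemma redWord_length (w : weylB d) : (redWord w).length = len w :=
  (exists_reduced w).choose_spec.1

lemma redWord_prod (w : weylB d) : ((redWord w).map simpleRefl).prod = w :=
  (exists_reduced w).choose_spec.2

lemma wordOp_redWord_delta (w u : weylB d) (h : len (w * u) = len w + len u) :
    wordOp (redWord w) (deltaFun u) = deltaFun (w * u) := by
  rw [wordOp_delta _ _ (by rw [redWord_prod, redWord_length, h]), redWord_prod]

lemma wordOp_redWord_simple (k : Fin d) : wordOp (redWord (simpleRefl k)) = leftOp k := by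
  refine end_ext _ _ (fun _ _ => wordOp_rightOp _ _ _) (fun _ _ => leftOp_rightOp _ _ _) ?_
  rw [wordOp_redWord_delta _ _ (by simp [len_one]), leftOp_delta _ _ (by
    rw [mul_one, len_simple, len_one]; omega)]

lemma leftOp_quad (k : Fin d) :
    (leftOp k + 1) * (leftOp k - algebraMap Lau _ qq) = 0 := by
  ext1 f
  ext1 w
  simp only [Module.End.mul_apply, LinearMap.add_apply, LinearMap.sub_apply, Module.End.one_apply,
    Module.algebraMap_end_apply, Pi.add_apply, Pi.sub_apply, Pi.smul_apply, smul_eq_mul,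
    leftOp_apply, simple_mul_simple_mul, LinearMap.zero_apply, Pi.zero_apply]
  have := len_simple_mul_ne k w
  split_ifs <;> try omega
  all_goals ring

/-- Both sides of a length-additive relation commute with all right multiplications, so `end_ext`
reduces them to their values at `T_1`. There only the products in `W` matter, and different reduced
words need not be compared. -/
lemma wordOp_rel ⦃x y : FreeAlgebra Lau (weylB d)⦄ (h : HeckeRel d x y) :
    FreeAlgebra.lift Lau (fun w : weylB d => wordOp (redWord w)) x =
      FreeAlgebra.lift Lau (fun w : weylB d => wordOp (redWord w)) y := by
  have hc : ∀ (w : weylB d) k f, wordOp (redWord w) (rightOp k f) =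
      rightOp k (wordOp (redWord w) f) := fun w _ _ => wordOp_rightOp _ _ _
  cases h with
  | one =>
    rw [FreeAlgebra.lift_ι_apply, map_one]
    refine end_ext _ _ (hc _) (fun _ _ => rfl) ?_
    rw [wordOp_redWord_delta _ _ (by simp [len_one]), mul_one]
    rfl
  | mul w w' h =>
    rw [map_mul]
    simp only [FreeAlgebra.lift_ι_apply]
    refine end_ext _ _ (fun k f => ?_) (hc _) ?_
    · simp only [Module.End.mul_apply, hc]
    · rw [Module.End.mul_apply, wordOp_redWord_delta w' 1 (by simp [len_one]), mul_one,
        wordOp_redWord_delta w w' h, wordOp_redWord_delta _ 1 (by simp [len_one]), mul_one]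
  | quad k =>
    rw [map_mul, map_add, map_sub, map_one, map_zero, AlgHom.commutes, FreeAlgebra.lift_ι_apply,
      wordOp_redWord_simple, leftOp_quad]

/-- The left regular representation of the Hecke algebra on coefficient functions. -/
def regRep (d : ℕ) : Hecke d →ₐ[Lau] Module.End Lau (weylB d → Lau) :=
  RingQuot.liftAlgHom Lau ⟨FreeAlgebra.lift Lau (fun w : weylB d => wordOp (redWord w)),
    wordOp_rel⟩

lemma regRep_TT (w : weylB d) : regRep d (TT w) = wordOp (redWord w) :=
  (RingQuot.liftAlgHom_mkAlgHom_apply Lau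
    (FreeAlgebra.lift Lau (fun w : weylB d => wordOp (redWord w))) wordOp_rel
      (FreeAlgebra.ι Lau w)).trans (FreeAlgebra.lift_ι_apply _ _)

/-- The coefficients of an element of the Hecke algebra in the basis `T_w`. -/
def coef : Hecke d →ₗ[Lau] (weylB d → Lau) :=
  (LinearMap.applyₗ (deltaFun (1 : weylB d))).comp (regRep d).toLinearMap

lemma coef_eq (x : Hecke d) : coef x = regRep d x (deltaFun 1) := rfl

lemma coef_TT (w : weylB d) : coef (TT w) = deltaFun w := by
  rw [coef_eq, regRep_TT, wordOp_redWord_delta _ _ (by simp [len_one]), mul_one]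

lemma coef_TT_apply (w u : weylB d) [Decidable (u = w)] :
    coef (TT w) u = if u = w then 1 else 0 := by
  rw [coef_TT, deltaFun_apply]

lemma coef_simple_mul (k : Fin d) (x : Hecke d) :
    coef (TT (simpleRefl k) * x) = leftOp k (coef x) := by
  rw [coef_eq, map_mul, Module.End.mul_apply, regRep_TT, wordOp_redWord_simple, coef_eq]

lemma TT_mul_simple (k : Fin d) (w : weylB d) (h : len w < len (w * simpleRefl k)) :
    TT w * TT (simpleRefl k) = TT (w * simpleRefl k) := by
  apply TT_mul
  have := len_mul_le w (simpleRefl k)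
  rw [len_simple] at this ⊢
  omega

lemma TT_simple_mul (k : Fin d) (w : weylB d) (h : len w < len (simpleRefl k * w)) :
    TT (simpleRefl k) * TT w = TT (simpleRefl k * w) := by
  apply TT_mul
  have := len_mul_le (simpleRefl k) w
  rw [len_simple] at this ⊢
  omega

lemma TT_simple_sq (k : Fin d) :
    TT (simpleRefl k) * TT (simpleRefl k) = (qq - 1) • TT (simpleRefl k) + qq • 1 := by
  have h := TT_quad k
  rw [add_mul, mul_sub, one_mul, ← Algebra.commutes, ← Algebra.smul_def,
    Algebra.algebraMap_eq_smul_one] at h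
  rw [sub_smul, one_smul, ← sub_eq_zero, ← h]
  abel

lemma TT_simple_mul' (k : Fin d) (w : weylB d) (h : ¬ len w < len (simpleRefl k * w)) :
    TT (simpleRefl k) * TT w = (qq - 1) • TT w + qq • TT (simpleRefl k * w) := by
  have h0 := len_simple_mul_ne k w
  have h1 : TT w = TT (simpleRefl k) * TT (simpleRefl k * w) := by
    rw [TT_simple_mul _ _ (by rw [simple_mul_simple_mul]; omega), simple_mul_simple_mul]
  rw [h1, ← mul_assoc, TT_simple_sq, add_mul, smul_mul_assoc, smul_mul_assoc, one_mul]

/-- The basis elements span the Hecke algebra. -/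
lemma span_TT (d : ℕ) : Submodule.span Lau (Set.range (TT (d := d))) = ⊤ := by
  set M := Submodule.span Lau (Set.range (TT (d := d))) with hM
  have hmem : ∀ w : weylB d, TT w ∈ M := fun w => Submodule.subset_span ⟨w, rfl⟩
  have hs : ∀ (k : Fin d) x, x ∈ M → TT (simpleRefl k) * x ∈ M := fun k x hx => by
    induction hx using Submodule.span_induction with
    | mem x hx =>
      obtain ⟨w, rfl⟩ := hx
      by_cases h : len w < len (simpleRefl k * w)
      · rw [TT_simple_mul k w h]; exact hmem _
      · rw [TT_simple_mul' k w h]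
        exact M.add_mem (M.smul_mem _ (hmem _)) (M.smul_mem _ (hmem _))
    | zero => rw [mul_zero]; exact M.zero_mem
    | add x y _ _ hx hy => rw [mul_add]; exact M.add_mem hx hy
    | smul c x _ hx => rw [mul_smul_comm]; exact M.smul_mem _ hx
  have hT : ∀ (w : weylB d) x, x ∈ M → TT w * x ∈ M := fun w => by
    induction w using weylB_induction_right with
    | one => intro x hx; rwa [TT_one, one_mul]
    | step w k hk ih =>
      intro x hx
      rw [← TT_mul_simple k w ((lt_len_mul_simple_iff w k).2 hk), mul_assoc]
      exact ih _ (hs k x hx)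
  have hmul : ∀ x y, x ∈ M → y ∈ M → x * y ∈ M := fun x y hx hy => by
    induction hx using Submodule.span_induction with
    | mem x hx => obtain ⟨w, rfl⟩ := hx; exact hT w y hy
    | zero => rw [zero_mul]; exact M.zero_mem
    | add x z _ _ hx hz => rw [add_mul]; exact M.add_mem hx hz
    | smul c x _ hx => rw [smul_mul_assoc]; exact M.smul_mem _ hx
  have hone : (1 : Hecke d) ∈ M := by rw [← TT_one]; exact hmem 1
  rw [Submodule.eq_top_iff']
  intro x
  obtain ⟨a, rfl⟩ := RingQuot.mkAlgHom_surjective Lau (HeckeRel d) x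
  induction a using FreeAlgebra.induction with
  | grade0 r =>
    rw [AlgHom.commutes]
    change algebraMap Lau (Hecke d) r ∈ M
    rw [Algebra.algebraMap_eq_smul_one]
    exact M.smul_mem _ hone
  | grade1 w => exact hmem w
  | mul a b ha hb => rw [map_mul]; exact hmul _ _ ha hb
  | add a b ha hb => rw [map_add]; exact M.add_mem ha hb

lemma coef_sum_TT (f : weylB d → Lau) : coef (∑ w, f w • TT w) = f := by
  classical
  funext u
  rw [map_sum, Finset.sum_apply]
  simp [coef_TT_apply]

lemma sum_coef_TT (x : Hecke d) : ∑ w, coef x w • TT w = x := by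
  classical
  have hx : x ∈ Submodule.span Lau (Set.range (TT (d := d))) := by rw [span_TT]; trivial
  induction hx using Submodule.span_induction with
  | mem x hx =>
    obtain ⟨w, rfl⟩ := hx
    simp [coef_TT_apply]
  | zero => simp
  | add x y _ _ hx hy =>
    conv_rhs => rw [← hx, ← hy]
    simp [add_smul, Finset.sum_add_distrib]
  | smul c x _ hx =>
    conv_rhs => rw [← hx]
    simp [Finset.smul_sum, smul_smul]

lemma coef_injective : Function.Injective (coef (d := d)) := fun x y h => by
  rw [← sum_coef_TT x, ← sum_coef_TT y, h]

/-- The coefficients are defined by the left regular representation. It commutes with `rightOp`, and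
`T_s` is obtained from `T_1` by the left as well as by the right operator. -/
lemma coef_mul_simple (k : Fin d) (x : Hecke d) :
    coef (x * TT (simpleRefl k)) = rightOp k (coef x) := by
  have key : ∀ (x : Hecke d) f, regRep d x (rightOp k f) = rightOp k (regRep d x f) := fun x => by
    intro f
    rw [← sum_coef_TT x]
    simp only [map_sum, map_smul, LinearMap.sum_apply, LinearMap.smul_apply, regRep_TT,
      wordOp_rightOp]
  rw [coef_eq, map_mul, Module.End.mul_apply, regRep_TT, wordOp_redWord_simple,
    leftOp_delta _ _ (by rw [mul_one, len_simple, len_one]; omega), mul_one, coef_eq, ← key,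
    rightOp_delta _ _ (by rw [one_mul, len_simple, len_one]; omega), one_mul]

end

end

end IotaSchur

namespace IotaSchur

noncomputable section

/-! ### Blocks of a composition -/

section

variable {m n d : ℕ}

/-- The index `i` of the block `R_i^λ` which contains `v`. -/
def bl (lam : Comp m n) (v : ℤ) : ℤ :=
  ∑ i ∈ Finset.range (m + n),
    ((if (psum lam i : ℤ) < v then 1 else 0) - (if (psum lam i : ℤ) < -v then 1 else 0))

lemma bl_neg (lam : Comp m n) (v : ℤ) : bl lam (-v) = -bl lam v := by
  simp only [bl, neg_neg, ← Finset.sum_neg_distrib, neg_sub]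

lemma bl_zero (lam : Comp m n) : bl lam 0 = 0 := by simp [bl]

lemma bl_mono (lam : Comp m n) : Monotone (bl lam) := by
  intro a b h
  refine Finset.sum_le_sum fun i _ => ?_
  split_ifs <;> omega

lemma psum_mono (lam : Comp m n) : Monotone (psum lam) := by
  intro a b h
  refine Finset.sum_le_sum fun i _ => ?_
  split_ifs <;> omega

lemma psum_of_le {lam : Comp m n} (hl : lam ∈ Lam m n d) {k : ℕ} (h : m + n ≤ k) :
    psum lam k = d := by
  rw [psum, ← show ∑ i, lam i = d from hl]
  refine Finset.sum_congr rfl fun i _ => if_pos ?_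
  have := i.2
  omega

lemma psum_le {lam : Comp m n} (hl : lam ∈ Lam m n d) (k : ℕ) : psum lam k ≤ d := by
  rw [← psum_of_le hl (le_max_left (m + n) k)]
  exact psum_mono lam (le_max_right _ _)

lemma psum_zero (lam : Comp m n) : psum lam 0 = lam 0 := by
  rw [psum, Finset.sum_eq_single 0]
  · simp
  · intro b _ hb
    rw [if_neg]
    simpa using hb
  · simp

lemma psum_succ (lam : Comp m n) (k : Fin (m + n + 1)) (hk : k ≠ 0) :
    psum lam k = psum lam (k - 1) + lam k := by
  have h1 : lam k = ∑ j : Fin (m + n + 1), if j = k then lam j else 0 := by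
    rw [Finset.sum_ite_eq', if_pos (Finset.mem_univ k)]
  rw [h1, psum, psum, ← Finset.sum_add_distrib]
  refine Finset.sum_congr rfl fun i _ => ?_
  have : (k : ℕ) ≠ 0 := fun h => hk (Fin.ext h)
  simp only [Fin.ext_iff]
  split_ifs <;> omega

/-- For `v ≥ 0` the label counts the partial sums below `v`. As partial sums increase, their indices
form an initial segment, which turns the count into a threshold. -/
lemma lt_bl_iff (lam : Comp m n) {v : ℤ} (hv : 0 ≤ v) (i : ℕ) :
    (i : ℤ) < bl lam v ↔ i < m + n ∧ (psum lam i : ℤ) < v := by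
  have h1 : bl lam v = (((Finset.range (m + n)).filter fun i => (psum lam i : ℤ) < v).card : ℤ) := by
    rw [bl, Finset.card_filter]
    push_cast
    refine Finset.sum_congr rfl fun j _ => ?_
    rw [if_neg (c := (psum lam j : ℤ) < -v) (by omega), sub_zero]
  rw [h1, Nat.cast_lt]
  constructor
  · intro h
    by_contra hcon
    have hsub : ((Finset.range (m + n)).filter fun i => (psum lam i : ℤ) < v) ⊆
        Finset.range i := by
      intro j hj
      simp only [Finset.mem_filter, Finset.mem_range] at hj ⊢
      by_contra hij
      have := psum_mono lam (not_lt.1 hij)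
      exact hcon ⟨by omega, by omega⟩
    have := Finset.card_le_card hsub
    rw [Finset.card_range] at this
    omega
  · rintro ⟨h2, h3⟩
    have hsub : Finset.range (i + 1) ⊆
        ((Finset.range (m + n)).filter fun i => (psum lam i : ℤ) < v) := by
      intro j hj
      simp only [Finset.mem_filter, Finset.mem_range] at hj ⊢
      have := psum_mono lam (show j ≤ i by omega)
      omega
    have := Finset.card_le_card hsub
    rw [Finset.card_range] at this
    omega

lemma bl_nonneg (lam : Comp m n) {v : ℤ} (hv : 0 ≤ v) : 0 ≤ bl lam v := by
  rw [← bl_zero lam]; exact bl_mono lam hv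

lemma bl_nonpos (lam : Comp m n) {v : ℤ} (hv : v ≤ 0) : bl lam v ≤ 0 := by
  rw [← bl_zero lam]; exact bl_mono lam hv

lemma abs_bl_le (lam : Comp m n) (v : ℤ) : |bl lam v| ≤ (m + n : ℕ) := by
  have key : ∀ v, 0 ≤ v → bl lam v ≤ (m + n : ℕ) := fun v hv => by
    by_contra h
    have := (lt_bl_iff lam hv (m + n)).1 (by omega)
    omega
  rw [abs_le]
  rcases le_total 0 v with h | h
  · have := bl_nonneg lam h
    have := key v h
    omega
  · have := bl_nonpos lam h
    have := key (-v) (by omega)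
    rw [bl_neg] at this
    omega

lemma bl_mem_II (lam : Comp m n) (v : ℤ) : bl lam v ∈ II m n := by
  rw [II, Finset.mem_Icc, ← abs_le]; exact abs_bl_le lam v

/-- The label jumps between the two adjacent points of `s_k` exactly if `k` is a partial sum. For `k
= 0` the points are `-1` and `1`, whose labels are opposite, so equality means that both lie in the
block `0`. -/
lemma isGen_iff (lam : Comp m n) (k : Fin d) :
    IsGen lam k ↔ bl lam (rootLo k) = bl lam (rootHi k) := by
  by_cases h0 : (k : ℕ) = 0
  · have h1 := bl_neg lam 1
    have h2 := lt_bl_iff lam (v := 1) (by omega) 0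
    have h3 := bl_nonneg lam (v := 1) (by omega)
    simp only [IsGen, rootLo, rootHi, h0, if_true, Nat.cast_zero, zero_add]
    constructor
    · intro h
      rw [h1]
      by_contra hne
      have h4 := h2.1 (by push_cast; omega)
      exact h 0 h4.1 (by omega)
    · intro h i hi hc
      have h4 := psum_mono lam (Nat.zero_le i)
      have := h2.2 ⟨by omega, by omega⟩
      push_cast at this
      omega
  · simp only [IsGen, rootLo, rootHi, h0, if_false]
    have h1 := lt_bl_iff lam (v := ((k : ℕ) : ℤ)) (by omega)
    have h2 := lt_bl_iff lam (v := ((k : ℕ) : ℤ) + 1) (by omega)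
    have h3 := bl_mono lam (show ((k : ℕ) : ℤ) ≤ (k : ℕ) + 1 by omega)
    have h4 := bl_nonneg lam (v := ((k : ℕ) : ℤ)) (by omega)
    constructor
    · intro h
      by_contra hne
      obtain ⟨i, hi⟩ := Int.eq_ofNat_of_zero_le h4
      have h5 := (h2 i).1 (by omega)
      have h6 : ¬ _ := fun hc => absurd ((h1 i).2 hc) (by omega)
      exact h i h5.1 (by omega)
    · intro h i hi hc
      have h5 := (h2 i).2 ⟨hi, by omega⟩
      have h6 := (h1 i).1 (by omega)
      omega

lemma RR_neg (lam : Comp m n) (i v : ℤ) : -v ∈ RR lam (-i) ↔ v ∈ RR lam i := by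
  unfold RR
  simp only [Int.natAbs_neg]
  split_ifs <;> simp only [Finset.mem_Icc, Finset.mem_Ico, Finset.mem_Ioc] <;> omega

/-- The condition `v ∈ pts d` cannot be dropped: `bl` also labels the points outside `[-d..d]`, by
the outermost indices. -/
lemma mem_RR {lam : Comp m n} (hl : lam ∈ Lam m n d) (i v : ℤ) :
    v ∈ RR lam i ↔ v ∈ pts d ∧ bl lam v = i := by
  have key : ∀ i v : ℤ, 0 ≤ v → 0 ≤ i → (v ∈ RR lam i ↔ v ∈ pts d ∧ bl lam v = i) := by
    intro i v hv hi
    have h1 := lt_bl_iff lam hv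
    have h0 := bl_nonneg lam hv
    have h2 := psum_of_le hl (k := m + n) le_rfl
    rw [Finset.mem_Icc]
    unfold RR
    split_ifs with c1 c2
    · rw [Finset.mem_Icc]
      have h3 := h1 0
      have h4 := psum_le hl 0
      have h5 : m + n = 0 → psum lam 0 = d := fun h => by rw [← h2, h]
      push_cast at h3
      omega
    · rw [Finset.mem_Ioc]
      obtain ⟨j, rfl⟩ := Int.eq_ofNat_of_zero_le hi
      have h3 := h1 j
      have h4 := h1 (j - 1)
      have h5 := psum_le hl j
      simp only [Int.natAbs_natCast]
      have h6 : m + n ≤ j - 1 → psum lam (j - 1) = d := fun h => psum_of_le hl h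
      have h7 : m + n ≤ j → psum lam j = d := fun h => psum_of_le hl h
      omega
    · omega
  have key2 : ∀ i v : ℤ, 0 ≤ v → (v ∈ RR lam i ↔ v ∈ pts d ∧ bl lam v = i) := by
    intro i v hv
    rcases le_or_gt 0 i with h | h
    · exact key i v hv h
    · refine iff_of_false ?_ fun hc => ?_
      · unfold RR
        rw [if_neg (by omega), if_neg (by omega), Finset.mem_Ico]
        omega
      · have := bl_nonneg lam hv
        omega
  rcases le_or_gt 0 v with h | h
  · exact key2 i v h
  · rw [← RR_neg, key2 _ _ (by omega), neg_mem_pts, bl_neg]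
    constructor <;> rintro ⟨h1, h2⟩ <;> exact ⟨h1, by omega⟩

lemma RR_eq_filter {lam : Comp m n} (hl : lam ∈ Lam m n d) (i : ℤ) :
    RR lam i = (pts d).filter fun v => bl lam v = i := by
  ext v
  rw [mem_RR hl, Finset.mem_filter]

/-! ### Parabolic subgroups as stabilizers of blocks -/

lemma bl_reflPerm {lam : Comp m n} {k : Fin d} (hk : IsGen lam k) (x : ℤ) :
    bl lam (reflPerm k x) = bl lam x := by
  rw [isGen_iff] at hk
  have hneg : ∀ i, reflPerm k (-i) = -reflPerm k i := (reflPerm_mem k.2).1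
  by_cases h1 : x = rootLo k
  · rw [h1, reflPerm_rootLo, hk]
  by_cases h2 : x = rootHi k
  · rw [h2, reflPerm_rootHi, hk]
  by_cases h3 : x = -rootLo k
  · rw [h3, hneg, reflPerm_rootLo, bl_neg, bl_neg, hk]
  by_cases h4 : x = -rootHi k
  · rw [h4, hneg, reflPerm_rootHi, bl_neg, bl_neg, hk]
  rw [reflPerm_eq_self h1 h2 h3 h4]

/-- A descent of an element which preserves all blocks and fixes the points of some of them lies
inside one of the other blocks. -/
lemma isGen_of_descent {lam : Comp m n} {Q : ℤ → Prop} {w : weylB d}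
    (h1 : ∀ x, bl lam (w.1 x) = bl lam x) (h2 : ∀ x, ¬ Q (bl lam x) → w.1 x = x) {k : Fin d}
    (hk : w.1 (rootHi k) < w.1 (rootLo k)) : IsGen lam k ∧ Q (bl lam (rootHi k)) := by
  have hgen : IsGen lam k := by
    rw [isGen_iff]
    apply le_antisymm (bl_mono lam (rootLo_lt_rootHi k).le)
    rw [← h1, ← h1 (rootLo k)]
    exact bl_mono lam hk.le
  refine ⟨hgen, ?_⟩
  by_contra hq
  have e1 := h2 _ hq
  have e2 := h2 (rootLo k) (by rwa [(isGen_iff lam k).1 hgen])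
  have := rootLo_lt_rootHi k
  omega

/-- A group generated by simple reflections inside selected blocks consists of the elements which
preserve all blocks and fix the points of all other blocks. -/
lemma mem_closure_blocks (lam : Comp m n) (Q : ℤ → Prop) (hQ : ∀ i, Q (-i) ↔ Q i) (w : weylB d) :
    w ∈ Subgroup.closure {s | ∃ k : Fin d, (IsGen lam k ∧ Q (bl lam (rootHi k))) ∧
        s = simpleRefl k} ↔
      (∀ x, bl lam (w.1 x) = bl lam x) ∧ ∀ x, ¬ Q (bl lam x) → w.1 x = x := by
  constructor
  · intro hw
    induction hw using Subgroup.closure_induction with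
    | mem s hs =>
      obtain ⟨k, ⟨hk, hq⟩, rfl⟩ := hs
      refine ⟨fun x => bl_reflPerm hk x, fun x hx => ?_⟩
      have hk' := (isGen_iff lam k).1 hk
      rw [simpleRefl_val]
      apply reflPerm_eq_self <;> rintro rfl <;> apply hx
      · rwa [hk']
      · exact hq
      · rwa [bl_neg, hQ, hk']
      · rwa [bl_neg, hQ]
    | one => exact ⟨fun _ => rfl, fun _ _ => rfl⟩
    | mul a b _ _ ha hb =>
      refine ⟨fun x => by rw [mul_val_apply, ha.1, hb.1], fun x hx => ?_⟩
      rw [mul_val_apply, hb.2 x hx, ha.2 x hx]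
    | inv a _ ha =>
      refine ⟨fun x => by rw [← ha.1, val_apply_inv_val], fun x hx => ?_⟩
      rw [inv_val_eq_iff, ha.2 x hx]
  · induction w using weylB_induction_right with
    | one => intro _; exact one_mem _
    | step w k hk ih =>
      rintro ⟨h1, h2⟩
      simp only [mul_val_apply, simpleRefl_val] at h1 h2
      -- The last letter is a descent, so it lies inside a selected block; removing it preserves
      -- both properties.
      obtain ⟨hgen, hq⟩ := isGen_of_descent (w := w * simpleRefl k) h1 h2 (k := k) (by
        simpa only [mul_val_apply, simpleRefl_val, reflPerm_rootLo, reflPerm_rootHi] using hk)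
      refine mul_mem (ih ⟨fun x => ?_, fun x hx => ?_⟩) (Subgroup.subset_closure ⟨k, ⟨hgen, hq⟩, rfl⟩)
      · have := h1 (reflPerm k x)
        rwa [reflPerm_reflPerm, bl_reflPerm hgen] at this
      · have := h2 (reflPerm k x) (by rwa [bl_reflPerm hgen])
        rw [reflPerm_reflPerm] at this
        rw [this]
        have hk' := (isGen_iff lam k).1 hgen
        apply reflPerm_eq_self <;> rintro rfl <;> apply hx
        · rwa [hk']
        · exact hq
        · rwa [bl_neg, hQ, hk']
        · rwa [bl_neg, hQ]

lemma mem_WW (lam : Comp m n) (w : weylB d) :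
    w ∈ WW d lam ↔ ∀ x, bl lam (w.1 x) = bl lam x := by
  have := mem_closure_blocks lam (fun _ => True) (fun _ => Iff.rfl) w
  simpa [WW] using this

lemma lt_psum_iff {lam : Comp m n} (hl : lam ∈ Lam m n d) {k : Fin d} (hk : IsGen lam k) :
    (k : ℕ) < psum lam m ↔ |bl lam (rootHi k)| ≤ m := by
  have h1 := lt_bl_iff lam (v := rootHi k) (by unfold rootHi; omega) m
  have h2 := bl_nonneg lam (v := rootHi k) (by unfold rootHi; omega)
  rw [abs_of_nonneg h2, ← not_lt (a := (m : ℤ)), h1, rootHi]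
  have h3 := hk m
  have h4 := k.2
  -- For `n = 0` the condition `IsGen` does not cover the index `m`, but then the partial sum is
  -- `d`, which exceeds `k`.
  have h5 : n = 0 → psum lam m = d := fun h => psum_of_le hl (by omega)
  omega

lemma psum_lt_iff {lam : Comp m n} (hl : lam ∈ Lam m n d) {k : Fin d} (hk : IsGen lam k) :
    psum lam m < (k : ℕ) ↔ (m : ℤ) < |bl lam (rootHi k)| := by
  rw [← not_le, ← not_le, ← lt_psum_iff hl hk, not_iff_not]
  have h3 := hk m
  have h4 := k.2
  have h5 : n = 0 → psum lam m = d := fun h => psum_of_le hl (by omega)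
  omega

lemma mem_WEven {lam : Comp m n} (hl : lam ∈ Lam m n d) (w : weylB d) :
    w ∈ WEven d lam ↔ (∀ x, bl lam (w.1 x) = bl lam x) ∧
      ∀ x, (m : ℤ) < |bl lam x| → w.1 x = x := by
  have := mem_closure_blocks lam (fun i => |i| ≤ m) (fun i => by rw [abs_neg]) w
  simp only [not_le] at this
  rw [← this, WEven]
  have hset : {s : weylB d | ∃ k : Fin d, IsGen lam k ∧ (k : ℕ) < psum lam m ∧ s = simpleRefl k} =
      {s | ∃ k : Fin d, (IsGen lam k ∧ |bl lam (rootHi k)| ≤ m) ∧ s = simpleRefl k} := by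
    ext s
    refine exists_congr fun k => ⟨fun ⟨h1, h2, h3⟩ => ⟨⟨h1, (lt_psum_iff hl h1).1 h2⟩, h3⟩,
      fun ⟨⟨h1, h2⟩, h3⟩ => ⟨h1, (lt_psum_iff hl h1).2 h2, h3⟩⟩
  rw [hset]

lemma mem_WOdd {lam : Comp m n} (hl : lam ∈ Lam m n d) (w : weylB d) :
    w ∈ WOdd d lam ↔ (∀ x, bl lam (w.1 x) = bl lam x) ∧
      ∀ x, |bl lam x| ≤ (m : ℤ) → w.1 x = x := by
  have := mem_closure_blocks lam (fun i => (m : ℤ) < |i|) (fun i => by rw [abs_neg]) w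
  simp only [not_lt] at this
  rw [← this, WOdd]
  have hset : {s : weylB d | ∃ k : Fin d, IsGen lam k ∧ psum lam m < (k : ℕ) ∧ s = simpleRefl k} =
      {s | ∃ k : Fin d, (IsGen lam k ∧ (m : ℤ) < |bl lam (rootHi k)|) ∧ s = simpleRefl k} := by
    ext s
    refine exists_congr fun k => ⟨fun ⟨h1, h2, h3⟩ => ⟨⟨h1, (psum_lt_iff hl h1).1 h2⟩, h3⟩,
      fun ⟨⟨h1, h2⟩, h3⟩ => ⟨h1, (psum_lt_iff hl h1).2 h2, h3⟩⟩
  rw [hset]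

/-- An odd function which increases along the simple roots inside the blocks is increasing on
every block. -/
lemma lt_of_ascents (lam : Comp m n) (f : ℤ → ℤ) (hf : ∀ x, f (-x) = -f x)
    (h : ∀ k : Fin d, IsGen lam k → f (rootLo k) < f (rootHi k)) {a b : ℤ} (hab : a < b)
    (ha : a ∈ pts d) (hb : b ∈ pts d) (hbl : bl lam a = bl lam b) : f a < f b := by
  have hf0 : f 0 = 0 := by have := hf 0; simp at this; omega
  have pos : ∀ c : ℤ, 1 ≤ c → c + 1 ≤ d → bl lam c = bl lam (c + 1) → f c < f (c + 1) := by
    intro c h1 h2 h3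
    have h4 := h ⟨c.toNat, by omega⟩
    rw [isGen_iff] at h4
    have e1 : rootLo c.toNat = c := by unfold rootLo; split_ifs <;> omega
    have e2 : rootHi c.toNat = c + 1 := by unfold rootHi; omega
    simp only [e1, e2] at h4
    exact h4 h3
  -- The root of `s_0` compares `-1` with `1` and skips `0`; oddness of `f` converts this into the
  -- step from `0` to `1`.
  have pos0 : (1 : ℤ) ≤ d → bl lam 1 = 0 → 0 < f 1 := by
    intro h2 h3
    have h4 := h ⟨0, by omega⟩
    rw [isGen_iff] at h4
    simp only [rootLo, rootHi, if_true, Nat.cast_zero, zero_add, bl_neg, h3, hf, neg_zero] at h4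
    have := h4 trivial
    omega
  have step : ∀ c : ℤ, c ∈ pts d → c + 1 ∈ pts d → bl lam c = bl lam (c + 1) →
      f c < f (c + 1) := by
    intro c h1 h2 h3
    rw [Finset.mem_Icc] at h1 h2
    rcases lt_trichotomy c 0 with h0 | h0 | h0
    · by_cases h5 : c = -1
      · subst h5
        have := pos0 (by omega) (by
          have := bl_neg lam 1
          rw [this] at h3
          simp [bl_zero] at h3
          omega)
        rw [hf]
        simp only [neg_add_cancel, hf0]
        omega
      · have h6 := pos (-c - 1) (by omega) (by omega) (by
          rw [show -c - 1 = -(c + 1) by ring, bl_neg, ← h3, ← bl_neg]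
          congr 1; ring)
        rw [show -c - 1 + 1 = -c by ring, show -c - 1 = -(c + 1) by ring, hf, hf] at h6
        omega
    · subst h0
      rw [bl_zero, zero_add] at h3
      rw [hf0, zero_add]
      exact pos0 (by omega) h3.symm
    · exact pos c (by omega) (by omega) h3
  rw [Finset.mem_Icc] at ha hb
  have key : ∀ t : ℕ, ∀ c, c = a + 1 + t → c ≤ b → f a < f c := by
    intro t
    induction t with
    | zero =>
      intro c hc hcb
      have h1 := bl_mono lam (show a ≤ c by omega)
      have h2 := bl_mono lam hcb
      have := step a (by rw [Finset.mem_Icc]; omega) (by rw [Finset.mem_Icc]; omega) (by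
        rw [show a + 1 = c by simpa using hc.symm]; omega)
      rwa [show a + 1 = c by simpa using hc.symm] at this
    | succ t ih =>
      intro c hc hcb
      push_cast at hc
      have h1 := bl_mono lam (show a ≤ c - 1 by omega)
      have h2 := bl_mono lam (show c - 1 ≤ c by omega)
      have h3 := bl_mono lam hcb
      have h4 := step (c - 1) (by rw [Finset.mem_Icc]; omega) (by rw [Finset.mem_Icc]; omega) (by
        rw [sub_add_cancel]; omega)
      rw [sub_add_cancel] at h4
      exact (ih (c - 1) (by omega) (by omega)).trans h4
  exact key (b - a - 1).toNat b (by omega) le_rfl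

end

end

end IotaSchur

namespace IotaSchur

noncomputable section

/-! ### Matrices and double cosets -/

section

variable {m n d : ℕ}

/-- Two odd labellings of `[-d..d]` with the same fibre sizes differ by an element of `W`. -/
lemma exists_relabel {T : Type*} [DecidableEq T] [InvolutiveNeg T] (f f' : ℤ → T)
    (hf : ∀ x, f (-x) = -f x) (hf' : ∀ x, f' (-x) = -f' x)
    (h : ∀ t, ((pts d).filter fun x => f x = t).card = ((pts d).filter fun x => f' x = t).card) :
    ∃ w : weylB d, ∀ x ∈ pts d, f' (w.1 x) = f x := by
  set F : T → Finset ℤ := fun t => (pts d).filter fun x => f x = t with hF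
  set F' : T → Finset ℤ := fun t => (pts d).filter fun x => f' x = t with hF'
  have memF : ∀ {t x}, x ∈ F t ↔ x ∈ pts d ∧ f x = t := by simp [hF]
  have memF' : ∀ {t x}, x ∈ F' t ↔ x ∈ pts d ∧ f' x = t := by simp [hF']
  -- The fibres are matched monotonically, since an order isomorphism of finite chains is unique;
  -- this rigidity gives the oddness of the matching for free.
  have e : ∀ t, F t ≃o F' t := fun t =>
    ((F t).orderIsoOfFin rfl).symm.trans ((F' t).orderIsoOfFin (h t).symm)
  set W : ℤ → ℤ := fun x => if hx : x ∈ pts d then e (f x) ⟨x, memF.2 ⟨hx, rfl⟩⟩ else x with hW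
  set V : ℤ → ℤ := fun x => if hx : x ∈ pts d then (e (f' x)).symm ⟨x, memF'.2 ⟨hx, rfl⟩⟩ else x
    with hV
  have hWe : ∀ t (x : F t), W x = e t x := by
    rintro t ⟨x, hx⟩
    obtain ⟨hx1, rfl⟩ := memF.1 hx
    simp only [hW, dif_pos hx1]
  have hVe : ∀ t (x : F' t), V x = (e t).symm x := by
    rintro t ⟨x, hx⟩
    obtain ⟨hx1, rfl⟩ := memF'.1 hx
    simp only [hV, dif_pos hx1]
  have hWout : ∀ x, x ∉ pts d → W x = x := fun x hx => dif_neg hx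
  have hVout : ∀ x, x ∉ pts d → V x = x := fun x hx => dif_neg hx
  have hneg : ∀ x, W (-x) = -W x := by
    intro x
    by_cases hx : x ∈ pts d
    · set t := f x
      have m1 : ∀ y : F t, -(y : ℤ) ∈ F (-t) := fun y => by
        have := memF.1 y.2
        exact memF.2 ⟨neg_mem_pts.2 this.1, by rw [hf, this.2]⟩
      have m2 : ∀ y : F (-t), -(y : ℤ) ∈ F t := fun y => by
        have := memF.1 y.2
        exact memF.2 ⟨neg_mem_pts.2 this.1, by rw [hf, this.2, neg_neg]⟩
      have m3 : ∀ y : F' t, -(y : ℤ) ∈ F' (-t) := fun y => by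
        have := memF'.1 y.2
        exact memF'.2 ⟨neg_mem_pts.2 this.1, by rw [hf', this.2]⟩
      have m4 : ∀ y : F' (-t), -(y : ℤ) ∈ F' t := fun y => by
        have := memF'.1 y.2
        exact memF'.2 ⟨neg_mem_pts.2 this.1, by rw [hf', this.2, neg_neg]⟩
      -- Negation reverses the order twice, so conjugating the matching of the fibres over `-t`
      -- gives an order isomorphism over `t`. By uniqueness it is the chosen one.
      let e' : F t ≃o F' t :=
        { toFun := fun y => ⟨-(e (-t) ⟨-y, m1 y⟩ : ℤ), m4 _⟩
          invFun := fun y => ⟨-((e (-t)).symm ⟨-y, m3 y⟩ : ℤ), m2 _⟩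
          left_inv := fun y => by simp
          right_inv := fun y => by simp
          map_rel_iff' := by
            intro a b
            simp only [Equiv.coe_fn_mk, Subtype.mk_le_mk, neg_le_neg_iff, Subtype.coe_le_coe,
              OrderIso.le_iff_le]
            }
      have h1 := hWe t ⟨x, memF.2 ⟨hx, rfl⟩⟩
      rw [Subsingleton.elim (e t) e'] at h1
      have h2 := hWe (-t) ⟨-x, m1 ⟨x, memF.2 ⟨hx, rfl⟩⟩⟩
      simp only at h1 h2
      rw [h1, h2]
      change _ = - -(_ : ℤ)
      rw [neg_neg]
    · rw [hWout x hx, hWout _ (mt neg_mem_pts.1 hx)]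
  refine ⟨⟨⟨W, V, fun x => ?_, fun x => ?_⟩, hneg, fun i hi => ?_⟩, fun x hx => ?_⟩
  · by_cases hx : x ∈ pts d
    · have h1 := hWe _ ⟨x, memF.2 ⟨hx, rfl⟩⟩
      simp only at h1
      rw [h1, hVe, OrderIso.symm_apply_apply]
    · rw [hWout x hx, hVout x hx]
  · by_cases hx : x ∈ pts d
    · have h1 := hVe _ ⟨x, memF'.2 ⟨hx, rfl⟩⟩
      simp only at h1
      rw [h1, hWe, OrderIso.apply_symm_apply]
    · rw [hVout x hx, hWout x hx]
  · exact hWout i (by rw [mem_pts]; omega)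
  · have h1 := hWe _ ⟨x, memF.2 ⟨hx, rfl⟩⟩
    change f' (W x) = f x
    simp only at h1
    rw [h1]
    exact (memF'.1 (e (f x) _).2).2

/-- Odd labellings of `[-d..d]` with prescribed symmetric fibre sizes exist. -/
lemma exists_labelling {T : Type*} [DecidableEq T] [AddGroup T] (S : Finset T)
    (h2 : ∀ t : T, t = -t → t = 0) (A : T → ℕ)
    (hS : ∀ t, A t ≠ 0 → t ∈ S) (hA : ∀ t, A (-t) = A t) (hsum : ∑ t ∈ S, A t = 2 * d + 1) :
    ∃ f : ℤ → T, (∀ x, f (-x) = -f x) ∧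
      ∀ t, ((pts d).filter fun x => f x = t).card = A t := by
  have hpair : ∀ A : T → ℕ, (∀ t, A t ≠ 0 → t ∈ S) → (∀ t, A (-t) = A t) →
      ∀ t, t ≠ 0 → A t ≠ 0 → A t + A t ≤ ∑ t ∈ S, A t := fun A hS hA t ht hAt => by
    have hne : t ≠ -t := fun h => ht (h2 t h)
    have : ∑ u ∈ {t, -t}, A u ≤ ∑ t ∈ S, A t := by
      refine Finset.sum_le_sum_of_subset fun u hu => ?_
      simp only [Finset.mem_insert, Finset.mem_singleton] at hu
      rcases hu with rfl | rfl
      · exact hS _ hAt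
      · exact hS _ (by rwa [hA])
    rwa [Finset.sum_pair hne, hA] at this
  have hsingle : ∀ A : T → ℕ, (∀ t, A t ≠ 0 → t ∈ S) → (∀ t, t ≠ 0 → A t = 0) →
      ∑ t ∈ S, A t = A 0 := fun A hS h => by
    refine Finset.sum_eq_single 0 (fun b _ hb => h b hb) fun h0 => ?_
    by_contra hne
    exact h0 (hS 0 hne)
  induction d generalizing A with
  | zero =>
    refine ⟨fun _ => 0, fun _ => neg_zero.symm, fun t => ?_⟩
    have h0 : ∀ t, t ≠ 0 → A t = 0 := fun t ht => by
      by_contra hne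
      have := hpair A hS hA t ht hne
      omega
    rw [hsingle A hS h0] at hsum
    by_cases ht : t = 0
    · subst ht; simp [hsum]
    · rw [h0 t ht]; simp [Ne.symm ht]
  | succ d ih =>
    -- The label `t` is for the new point `d + 1`, and `-t` for `-(d + 1)`. If no label other than
    -- `0` remains, then `0` occurs at least three times and can serve for both points.
    obtain ⟨t, ht⟩ : ∃ t, ∀ u, (if u = t then 1 else 0) + (if u = -t then 1 else 0) ≤ A u := by
      by_cases hex : ∃ t, t ≠ 0 ∧ A t ≠ 0
      · obtain ⟨t, ht, hAt⟩ := hex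
        refine ⟨t, fun u => ?_⟩
        have hne : t ≠ -t := fun h => ht (h2 t h)
        have := hA t
        by_cases h1 : u = t
        · subst h1; rw [if_neg hne]; simp; omega
        · by_cases h3 : u = -t
          · subst h3; rw [if_neg h1]; simp; omega
          · simp [h1, h3]
      · push Not at hex
        refine ⟨0, fun u => ?_⟩
        rw [hsingle A hS hex] at hsum
        by_cases h1 : u = 0
        · subst h1; simp; omega
        · simp [h1]
    set A' : T → ℕ := fun u => A u - ((if u = t then 1 else 0) + (if u = -t then 1 else 0)) with hA'
    have hAA : ∀ u, A' u + ((if u = t then 1 else 0) + (if u = -t then 1 else 0)) = A u := fun u =>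
      Nat.sub_add_cancel (ht u)
    have hS' : ∀ t, A' t ≠ 0 → t ∈ S := fun u hu => hS u (by have := hAA u; omega)
    have htS : t ∈ S := hS t (by have := ht t; simp at this; omega)
    have htS' : -t ∈ S := hS (-t) (by have := ht (-t); simp at this; omega)
    have hsum' : ∑ t ∈ S, A' t = 2 * d + 1 := by
      have := Finset.sum_congr (rfl : S = S) fun u _ => hAA u
      rw [Finset.sum_add_distrib, Finset.sum_add_distrib, hsum, Finset.sum_ite_eq',
        Finset.sum_ite_eq', if_pos htS, if_pos htS'] at this
      omega
    have hsym : ∀ t, A' (-t) = A' t := fun u => by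
      simp only [hA', hA, neg_eq_iff_eq_neg, neg_neg]
      rw [add_comm (if u = -t then 1 else 0)]
    obtain ⟨f, hf, hcard⟩ := ih A' hS' hsym hsum'
    refine ⟨fun x => if x = d + 1 then t else if x = -(d + 1 : ℤ) then -t else f x, fun x => ?_,
      fun u => ?_⟩
    · simp only [neg_eq_iff_eq_neg, neg_neg, hf]
      split_ifs with h1 h3 <;> first | rfl | (simp only [neg_neg]) | omega
    · have hpts : pts (d + 1) = insert ((d : ℤ) + 1) (insert (-(d + 1 : ℤ)) (pts d)) := by
        ext x
        simp only [Finset.mem_insert, Finset.mem_Icc]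
        push_cast
        omega
      rw [hpts, Finset.card_filter, Finset.sum_insert, Finset.sum_insert]
      · rw [← hAA u, ← hcard u, Finset.card_filter]
        have h3 : ¬ (-(d + 1 : ℤ) = d + 1) := by omega
        have h4 : ∀ x ∈ pts d, (if (if x = (d : ℤ) + 1 then t else
            if x = -(d + 1 : ℤ) then -t else f x) = u then 1 else 0) =
              if f x = u then 1 else 0 := fun x hx => by
          rw [Finset.mem_Icc] at hx
          rw [if_neg (c := x = (d : ℤ) + 1) (by omega), if_neg (c := x = -(d + 1 : ℤ)) (by omega)]
        beta_reduce
        rw [Finset.sum_congr rfl h4, if_pos (c := (d : ℤ) + 1 = d + 1) rfl, if_neg h3,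
          if_pos (c := -(d + 1 : ℤ) = -(d + 1 : ℤ)) rfl]
        simp only [eq_comm (a := u)]
        omega
      · rw [Finset.mem_Icc]; omega
      · rw [Finset.mem_insert, Finset.mem_Icc]; omega

/-- Counting preimages exhibits the matrix as the joint distribution of two labels on `[-d..d]`: the
`μ`-block of `x` and the `λ`-block of `w x`. -/
lemma kappa_apply {lam mu : Comp m n} (hl : lam ∈ Lam m n d) (hm : mu ∈ Lam m n d)
    (w : weylB d) (i j : ℤ) :
    kappa lam w mu i j =
      ((pts d).filter fun x => bl mu x = j ∧ bl lam (w.1 x) = i).card := by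
  rw [kappa, RR_eq_filter hl, RR_eq_filter hm, ← Finset.card_image_of_injective
    ((pts d).filter fun x => bl mu x = j ∧ bl lam (w.1 x) = i) w.1.injective]
  congr 1
  ext v
  simp only [Finset.mem_inter, Finset.mem_filter, Finset.mem_image]
  constructor
  · rintro ⟨⟨h1, h2⟩, x, ⟨h3, h4⟩, rfl⟩
    exact ⟨x, ⟨h3, h4, h2⟩, rfl⟩
  · rintro ⟨x, ⟨h3, h4, h2⟩, rfl⟩
    exact ⟨⟨(weylB_mem_pts w).2 h3, h2⟩, x, ⟨h3, h4⟩, rfl⟩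

lemma card_filter_weylB (w : weylB d) (p : ℤ → Prop) [DecidablePred p] :
    ((pts d).filter fun x => p (w.1 x)).card = ((pts d).filter p).card := by
  rw [← Finset.card_image_of_injective _ w.1.injective]
  congr 1
  ext v
  simp only [Finset.mem_filter, Finset.mem_image]
  constructor
  · rintro ⟨x, ⟨h1, h2⟩, rfl⟩
    exact ⟨(weylB_mem_pts w).2 h1, h2⟩
  · rintro ⟨h1, h2⟩
    exact ⟨w⁻¹.1 v, ⟨(weylB_mem_pts _).2 h1, by rwa [val_apply_inv_val]⟩, val_apply_inv_val _ _⟩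

lemma card_filter_neg (p : ℤ → Prop) [DecidablePred p] :
    ((pts d).filter fun x => p (-x)).card = ((pts d).filter p).card := by
  rw [← Finset.card_image_of_injective _ neg_injective]
  congr 1
  ext v
  simp only [Finset.mem_filter, Finset.mem_image]
  constructor
  · rintro ⟨x, ⟨h1, h2⟩, rfl⟩
    exact ⟨neg_mem_pts.2 h1, h2⟩
  · rintro ⟨h1, h2⟩
    exact ⟨-v, ⟨neg_mem_pts.2 h1, by rwa [neg_neg]⟩, neg_neg _⟩

lemma kappa_inv {lam mu : Comp m n} (hl : lam ∈ Lam m n d) (hm : mu ∈ Lam m n d)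
    (w : weylB d) (i j : ℤ) : kappa mu w⁻¹ lam i j = kappa lam w mu j i := by
  rw [kappa_apply hm hl, kappa_apply hl hm, ← card_filter_weylB w]
  simp only [inv_val_apply_val]
  congr 1
  ext x
  simp only [Finset.mem_filter]
  tauto

lemma kappa_neg {lam mu : Comp m n} (hl : lam ∈ Lam m n d) (hm : mu ∈ Lam m n d)
    (w : weylB d) (i j : ℤ) : kappa lam w mu (-i) (-j) = kappa lam w mu i j := by
  rw [kappa_apply hl hm, kappa_apply hl hm, ← card_filter_neg]
  simp only [weylB_neg, bl_neg, neg_inj]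

lemma kappa_ne_zero {lam mu : Comp m n} (hl : lam ∈ Lam m n d) (hm : mu ∈ Lam m n d)
    (w : weylB d) (i j : ℤ) (h : kappa lam w mu i j ≠ 0) : i ∈ II m n ∧ j ∈ II m n := by
  rw [kappa_apply hl hm] at h
  obtain ⟨x, hx⟩ := Finset.card_pos.1 (Nat.pos_of_ne_zero h)
  simp only [Finset.mem_filter] at hx
  obtain ⟨-, rfl, rfl⟩ := hx
  exact ⟨bl_mem_II _ _, bl_mem_II _ _⟩

lemma sum_kappa_row {lam mu : Comp m n} (hl : lam ∈ Lam m n d) (hm : mu ∈ Lam m n d)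
    (w : weylB d) (i : ℤ) : ∑ j ∈ II m n, kappa lam w mu i j = (RR lam i).card := by
  rw [RR_eq_filter hl, ← card_filter_weylB w,
    Finset.card_eq_sum_card_fiberwise (f := bl mu) (t := II m n) fun x _ => bl_mem_II _ _]
  refine Finset.sum_congr rfl fun j _ => ?_
  rw [kappa_apply hl hm, Finset.filter_filter]
  simp only [and_comm]

lemma card_RR_zero (lam : Comp m n) : (RR lam 0).card = 2 * lam 0 + 1 := by
  rw [RR, if_pos rfl, Int.card_Icc, psum_zero]
  omega

lemma card_RR_pos (lam : Comp m n) (k : Fin (m + n + 1)) (hk : k ≠ 0) :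
    (RR lam ((k : ℕ) : ℤ)).card = lam k := by
  have h0 : (k : ℕ) ≠ 0 := fun h => hk (Fin.ext h)
  have h1 := psum_succ lam k hk
  rw [RR, if_neg (by omega), if_pos (by omega), Int.card_Ioc, Int.natAbs_natCast]
  omega

lemma sum_RR {lam : Comp m n} (hl : lam ∈ Lam m n d) :
    ∑ i ∈ II m n, (RR lam i).card = 2 * d + 1 := by
  have : (pts d).card = 2 * d + 1 := by rw [Int.card_Icc]; omega
  rw [← this,
    Finset.card_eq_sum_card_fiberwise (f := bl lam) (t := II m n) fun x _ => bl_mem_II _ _]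
  exact Finset.sum_congr rfl fun i _ => by rw [RR_eq_filter hl]

lemma rowW_kappa {lam mu : Comp m n} (hl : lam ∈ Lam m n d) (hm : mu ∈ Lam m n d)
    (w : weylB d) : rowW m n (kappa lam w mu) = lam := by
  funext k
  rw [rowW]
  split_ifs with hk
  · subst hk
    have h1 := sum_kappa_row hl hm w 0
    rw [card_RR_zero] at h1
    have h2 := sum_symm (m + n) (fun j => kappa lam w mu 0 j) fun j => by
      have := kappa_neg hl hm w 0 j
      rwa [neg_zero] at this
    rw [II] at h1
    rw [h1] at h2
    omega
  · rw [sum_kappa_row hl hm, card_RR_pos lam k hk]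

lemma colW_eq (A : ℤ → ℤ → ℕ) : colW m n A = rowW m n (fun i j => A j i) := rfl

lemma colW_kappa {lam mu : Comp m n} (hl : lam ∈ Lam m n d) (hm : mu ∈ Lam m n d)
    (w : weylB d) : colW m n (kappa lam w mu) = mu := by
  rw [colW_eq]
  simp only [← kappa_inv hl hm]
  exact rowW_kappa hm hl w⁻¹

lemma kappa_mem_Xi {lam mu : Comp m n} (hl : lam ∈ Lam m n d) (hm : mu ∈ Lam m n d)
    (w : weylB d) (h : ∀ i j : ℤ, ¬ (|i| ≤ m ↔ |j| ≤ m) → kappa lam w mu i j ≤ 1) :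
    kappa lam w mu ∈ Xi m n d := by
  refine ⟨kappa_ne_zero hl hm w, ?_, fun i j => (kappa_neg hl hm w i j).symm,
    fun i j hij => by have := h i j hij; omega⟩
  rw [← sum_RR hl]
  exact Finset.sum_congr rfl fun i _ => sum_kappa_row hl hm w i

lemma Xi_transpose {A : ℤ → ℤ → ℕ} (hA : A ∈ Xi m n d) : (fun i j => A j i) ∈ Xi m n d := by
  obtain ⟨h1, h2, h3, h4⟩ := hA
  refine ⟨fun i j h => (h1 j i h).symm, ?_, fun i j => h3 j i, fun i j h => h4 j i ?_⟩
  · rw [Finset.sum_comm]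
    exact h2
  · rwa [iff_comm]

lemma neg_mem_II {i : ℤ} : -i ∈ II m n ↔ i ∈ II m n := by
  simp only [II, Finset.mem_Icc]; omega

lemma sum_II_neg (f : ℤ → ℕ) : ∑ j ∈ II m n, f (-j) = ∑ j ∈ II m n, f j :=
  Finset.sum_nbij' (fun j => -j) (fun j => -j) (fun _ h => neg_mem_II.2 h)
    (fun _ h => neg_mem_II.2 h) (fun _ _ => neg_neg _) (fun _ _ => neg_neg _) fun _ _ => rfl

lemma Xi_row_neg {A : ℤ → ℤ → ℕ} (hA : A ∈ Xi m n d) (i : ℤ) :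
    ∑ j ∈ II m n, A (-i) j = ∑ j ∈ II m n, A i j := by
  rw [← sum_II_neg]
  exact Finset.sum_congr rfl fun j _ => (hA.2.2.1 i j).symm

/-- The symmetry pairs off all entries but the central one, and the total `2d + 1` is odd. -/
lemma Xi_zero_odd {A : ℤ → ℤ → ℕ} (hA : A ∈ Xi m n d) : A 0 0 % 2 = 1 := by
  have h4 := sum_symm (m + n) (fun i => ∑ j ∈ II m n, A i j) (Xi_row_neg hA)
  have h5 := sum_symm (m + n) (fun j => A 0 j) (fun j => by rw [hA.2.2.1 0 j, neg_zero])
  have h2 := hA.2.1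
  simp only [II] at h2 h4 h5 ⊢
  omega

lemma Xi_row_sum {A : ℤ → ℤ → ℕ} (hA : A ∈ Xi m n d) (i : ℤ) :
    ∑ j ∈ II m n, A i j = (RR (rowW m n A) i).card := by
  have key : ∀ i : ℤ, 0 ≤ i → ∑ j ∈ II m n, A i j = (RR (rowW m n A) i).card := by
    intro i hi
    by_cases h0 : i = 0
    · subst h0
      have h1 := Xi_zero_odd hA
      have h5 := sum_symm (m + n) (fun j => A 0 j) (fun j => by rw [hA.2.2.1 0 j, neg_zero])
      rw [card_RR_zero, rowW, if_pos rfl, II, h5]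
      omega
    · obtain ⟨k, rfl⟩ := Int.eq_ofNat_of_zero_le hi
      by_cases hk : k < m + n + 1
      · have hk0 : (⟨k, hk⟩ : Fin (m + n + 1)) ≠ 0 := fun h => h0 (by
          have := congrArg Fin.val h
          simp at this
          simp [this])
        have := card_RR_pos (rowW m n A) ⟨k, hk⟩ hk0
        simp only at this
        rw [this, rowW, if_neg hk0]
      · have h1 : RR (rowW m n A) (k : ℤ) = ∅ := by
          rw [Finset.eq_empty_iff_forall_notMem]
          intro v hv
          rw [mem_RR (rowW_mem hA)] at hv
          have := abs_bl_le (rowW m n A) v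
          rw [hv.2, abs_of_nonneg hi] at this
          omega
        rw [h1, Finset.card_empty]
        refine Finset.sum_eq_zero fun j _ => ?_
        by_contra hne
        have := (hA.1 _ _ hne).1
        rw [II, Finset.mem_Icc] at this
        omega
  rcases le_total 0 i with h | h
  · exact key i h
  · have h1 := key (-i) (by omega)
    rw [Xi_row_neg hA] at h1
    rw [h1, ← Finset.card_image_of_injective _ neg_injective]
    congr 1
    ext v
    rw [Finset.mem_image]
    constructor
    · rintro ⟨x, hx, rfl⟩
      rwa [← RR_neg, neg_neg]
    · intro hv
      exact ⟨-v, (RR_neg _ _ _).2 hv, neg_neg v⟩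

lemma Xi_col_sum {A : ℤ → ℤ → ℕ} (hA : A ∈ Xi m n d) (j : ℤ) :
    ∑ i ∈ II m n, A i j = (RR (colW m n A) j).card :=
  Xi_row_sum (Xi_transpose hA) j

/-- Every matrix in `Ξ` comes from an element of `W`. -/
lemma exists_kappa_eq {A : ℤ → ℤ → ℕ} (hA : A ∈ Xi m n d) :
    ∃ w : weylB d, kappa (rowW m n A) w (colW m n A) = A := by
  have hl := rowW_mem hA
  have hm := colW_mem hA
  -- Label the points by matrix positions with multiplicities `A`. If `u` matches the column labels
  -- with the `μ`-blocks and `v` the row labels with the `λ`-blocks, then `v u⁻¹` has matrix `A`.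
  obtain ⟨f, hf, hcard⟩ := exists_labelling (d := d) (T := ℤ × ℤ) (II m n ×ˢ II m n)
    (fun t ht => by
      have h1 := congrArg Prod.fst ht
      have h2 := congrArg Prod.snd ht
      simp only [Prod.fst_neg, Prod.snd_neg] at h1 h2
      exact Prod.ext (by simp; omega) (by simp; omega))
    (fun t => A t.1 t.2)
    (fun t ht => Finset.mem_product.2 (hA.1 _ _ ht)) (fun t => (hA.2.2.1 _ _).symm) (by
      rw [Finset.sum_product]; exact hA.2.1)
  have hmem : ∀ x ∈ pts d, (f x).1 ∈ II m n ∧ (f x).2 ∈ II m n := fun x hx => by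
    have h1 := hcard (f x)
    refine hA.1 _ _ (ne_of_eq_of_ne h1.symm ?_)
    have hx' : x ∈ (pts d).filter fun y => f y = f x := Finset.mem_filter.2 ⟨hx, rfl⟩
    exact (Finset.card_pos.2 ⟨x, hx'⟩).ne'
  obtain ⟨u, hu⟩ := exists_relabel (d := d) (fun x => (f x).2) (bl (colW m n A))
    (fun x => by simp [hf]) (bl_neg _) fun j => by
      rw [← RR_eq_filter hm, ← Xi_col_sum hA,
        Finset.card_eq_sum_card_fiberwise (f := fun x => (f x).1) (t := II m n) fun x hx =>
          (hmem x (Finset.mem_filter.1 hx).1).1]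
      refine Finset.sum_congr rfl fun i _ => ?_
      rw [Finset.filter_filter, ← hcard (i, j)]
      congr 1
      ext x
      simp only [Finset.mem_filter, Prod.ext_iff]
      tauto
  obtain ⟨v, hv⟩ := exists_relabel (d := d) (fun x => (f x).1) (bl (rowW m n A))
    (fun x => by simp [hf]) (bl_neg _) fun i => by
      rw [← RR_eq_filter hl, ← Xi_row_sum hA,
        Finset.card_eq_sum_card_fiberwise (f := fun x => (f x).2) (t := II m n) fun x hx =>
          (hmem x (Finset.mem_filter.1 hx).1).2]
      refine Finset.sum_congr rfl fun j _ => ?_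
      rw [Finset.filter_filter, ← hcard (i, j)]
      congr 1
      ext x
      simp only [Finset.mem_filter, Prod.ext_iff]
  refine ⟨v * u⁻¹, ?_⟩
  funext i j
  rw [kappa_apply hl hm, ← hcard (i, j), ← card_filter_weylB u]
  congr 1
  ext x
  simp only [Finset.mem_filter, mul_val_apply, inv_val_apply_val, Prod.ext_iff]
  constructor
  · rintro ⟨h1, h2, h3⟩
    rw [hu x h1] at h2
    rw [hv x h1] at h3
    exact ⟨h1, h3, h2⟩
  · rintro ⟨h1, h2, h3⟩
    rw [hu x h1, hv x h1]
    exact ⟨h1, h3, h2⟩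

lemma kappa_mul_mul {lam mu : Comp m n} (hl : lam ∈ Lam m n d) (hm : mu ∈ Lam m n d)
    {x y : weylB d} (hx : x ∈ WW d lam) (hy : y ∈ WW d mu) (w : weylB d) :
    kappa lam (x * w * y) mu = kappa lam w mu := by
  funext i j
  rw [mem_WW] at hx hy
  rw [kappa_apply hl hm, kappa_apply hl hm,
    ← card_filter_weylB y fun v => bl mu v = j ∧ bl lam (w.1 v) = i]
  simp only [mul_val_apply, hx, hy]

/-- Elements with the same matrix lie in the same double coset. -/
lemma exists_of_kappa_eq {lam mu : Comp m n} (hl : lam ∈ Lam m n d) (hm : mu ∈ Lam m n d)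
    {w w' : weylB d} (h : kappa lam w mu = kappa lam w' mu) :
    ∃ x ∈ WW d lam, ∃ y ∈ WW d mu, w' = x * w * y := by
  -- Matching both labels at once gives `u ∈ W_μ` such that `w u` and `w'` have the same `λ`-labels;
  -- hence `w' u⁻¹ w⁻¹` preserves the `λ`-blocks.
  obtain ⟨u, hu⟩ := exists_relabel (d := d) (fun x => (bl mu x, bl lam (w'.1 x)))
    (fun x => (bl mu x, bl lam (w.1 x))) (fun x => by simp [bl_neg, weylB_neg])
    (fun x => by simp [bl_neg, weylB_neg]) fun t => by
      have h1 := congrFun (congrFun h t.2) t.1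
      rw [kappa_apply hl hm, kappa_apply hl hm] at h1
      simp only [Prod.ext_iff]
      exact h1.symm
  have hu' : ∀ x, bl mu (u.1 x) = bl mu x ∧ bl lam (w.1 (u.1 x)) = bl lam (w'.1 x) := by
    intro x
    by_cases hx : x ∈ pts d
    · have := hu x hx
      simpa only [Prod.ext_iff] using this
    · rw [mem_pts, not_le] at hx
      rw [u.2.2 x hx, w.2.2 x hx, w'.2.2 x hx]
      exact ⟨rfl, rfl⟩
  refine ⟨w' * u⁻¹ * w⁻¹, (mem_WW _ _).2 fun x => ?_, u, (mem_WW _ _).2 fun x => (hu' x).1, ?_⟩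
  · rw [mul_val_apply, mul_val_apply, ← (hu' _).2, val_apply_inv_val, val_apply_inv_val]
  · group

/-! ### Minimal and maximal elements of double cosets -/

lemma weylB_lt_of_ascents {mu : Comp m n} {g : weylB d}
    (h : ∀ k : Fin d, IsGen mu k → g.1 (rootLo k) < g.1 (rootHi k)) {a b : ℤ} (hab : a < b)
    (hbl : bl mu a = bl mu b) : g.1 a < g.1 b := by
  by_cases hout : a ∈ pts d ∧ b ∈ pts d
  · exact lt_of_ascents mu g.1 (weylB_neg g) h hab hout.1 hout.2 hbl
  · have key : ∀ c, c ∉ pts d → g.1 c = c := fun c hc => g.2.2 c (by rw [mem_pts] at hc; omega)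
    have key2 : ∀ c, c ∈ pts d → g.1 c ∈ pts d := fun c hc => (weylB_mem_pts g).2 hc
    simp only [Finset.mem_Icc] at hout key key2
    by_cases ha : -(d : ℤ) ≤ a ∧ a ≤ d
    · rw [key b (by omega)]
      have := key2 a ha
      omega
    · rw [key a ha]
      by_cases hb : -(d : ℤ) ≤ b ∧ b ≤ d
      · have := key2 b hb
        omega
      · rw [key b hb]; exact hab

/-- Minimality makes every generator of `W_μ` an ascent, and ascents at adjacent points propagate
along a block. -/
lemma DD_right {lam mu : Comp m n} {g : weylB d} (hg : g ∈ DD d lam mu) {a b : ℤ} (hab : a < b)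
    (hbl : bl mu a = bl mu b) : g.1 a < g.1 b := by
  refine weylB_lt_of_ascents (fun k hk => ?_) hab hbl
  rw [← lt_len_mul_simple_iff]
  have h1 := hg 1 (one_mem _) (simpleRefl k) (Subgroup.subset_closure ⟨k, hk, rfl⟩)
  rw [one_mul] at h1
  exact lt_of_le_of_ne h1 (len_mul_simple_ne k g).symm

lemma DD_inv {lam mu : Comp m n} {g : weylB d} (hg : g ∈ DD d lam mu) : g⁻¹ ∈ DD d mu lam := by
  intro x hx y hy
  have := hg y⁻¹ (inv_mem hy) x⁻¹ (inv_mem hx)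
  rw [len_inv, ← len_inv (x * g⁻¹ * y)]
  simpa [mul_assoc] using this

lemma DD_left {lam mu : Comp m n} {g : weylB d} (hg : g ∈ DD d lam mu) {a b : ℤ} (hab : a < b)
    (hbl : bl lam a = bl lam b) : g⁻¹.1 a < g⁻¹.1 b := DD_right (DD_inv hg) hab hbl

lemma exists_DD_kappa_eq {lam mu : Comp m n} (hl : lam ∈ Lam m n d) (hm : mu ∈ Lam m n d)
    (w : weylB d) : ∃ g ∈ DD d lam mu, kappa lam g mu = kappa lam w mu := by
  obtain ⟨g, hg, hmin⟩ := Set.exists_min_image {g : weylB d | kappa lam g mu = kappa lam w mu} len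
    (Set.toFinite _) ⟨w, rfl⟩
  refine ⟨g, fun x hx y hy => hmin _ ?_, hg⟩
  exact (kappa_mul_mul hl hm hx hy g).trans hg

/-- Every double coset contains an element which is decreasing on all blocks. -/
lemma exists_longest {lam mu : Comp m n} (hl : lam ∈ Lam m n d) (hm : mu ∈ Lam m n d)
    (w : weylB d) : ∃ g : weylB d, kappa lam g mu = kappa lam w mu ∧
      (∀ u : weylB d, kappa lam u mu = kappa lam w mu → len u ≤ len g) ∧
      (∀ a ∈ pts d, ∀ b ∈ pts d, a < b → bl mu a = bl mu b → g.1 b < g.1 a) ∧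
      (∀ a ∈ pts d, ∀ b ∈ pts d, a < b → bl lam a = bl lam b → g⁻¹.1 b < g⁻¹.1 a) := by
  obtain ⟨g, hg, hmax⟩ := Set.exists_max_image {g : weylB d | kappa lam g mu = kappa lam w mu} len
    (Set.toFinite _) ⟨w, rfl⟩
  refine ⟨g, hg, hmax, fun a ha b hb hab hbl => ?_, fun a ha b hb hab hbl => ?_⟩
  -- By maximality no generator lengthens `g`, so all of them are descents; these are ascents of
  -- `-g`.
  · have := lt_of_ascents mu (fun x => -g.1 x) (fun x => by rw [weylB_neg]) (fun k hk => ?_)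
      hab ha hb hbl
    · omega
    have h1 := hmax (g * simpleRefl k) (by
      have := kappa_mul_mul hl hm (one_mem _) (Subgroup.subset_closure ⟨k, hk, rfl⟩) g
      rw [one_mul] at this
      exact this.trans hg)
    rw [neg_lt_neg_iff]
    have h2 := mt (lt_len_mul_simple_iff g k).2 h1.not_gt
    have := apply_root_ne g k
    omega
  · have := lt_of_ascents lam (fun x => -g⁻¹.1 x) (fun x => by rw [weylB_neg]) (fun k hk => ?_)
      hab ha hb hbl
    · omega
    have h1 := hmax (simpleRefl k * g) (by
      have := kappa_mul_mul hl hm (Subgroup.subset_closure ⟨k, hk, rfl⟩) (one_mem _) g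
      rw [mul_one] at this
      exact this.trans hg)
    rw [neg_lt_neg_iff]
    have h2 := mt (lt_len_simple_mul_iff g k).2 h1.not_gt
    have := apply_root_ne g⁻¹ k
    omega

/-! ### The even-odd trivial intersection property -/

/-- The reflection which exchanges `a` with `b` and `-a` with `-b`. -/
lemma exists_pairRefl {a b : ℤ} (ha : a ∈ pts d) (hb : b ∈ pts d) (hab' : a ≠ -b)
    (ha0 : a ≠ 0) (hb0 : b ≠ 0) :
    ∃ r : weylB d, r.1 a = b ∧ (∀ x, x ≠ a → x ≠ b → x ≠ -a → x ≠ -b → r.1 x = x) ∧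
      ∀ h : ℤ → ℤ, (∀ x, h (-x) = -h x) → h a = h b → ∀ x, h (r.1 x) = h x := by
  have hr : ∀ x, (Equiv.swap a b * Equiv.swap (-a) (-b)) x = if x = a then b else if x = b then a
      else if x = -a then -b else if x = -b then -a else x := by
    intro x
    simp only [Equiv.Perm.mul_apply, Equiv.swap_apply_def]
    split_ifs <;> omega
  rw [mem_pts, abs_le] at ha hb
  refine ⟨⟨Equiv.swap a b * Equiv.swap (-a) (-b), fun x => ?_, fun x hx => ?_⟩, ?_, ?_, ?_⟩
  · rw [hr, hr]; split_ifs <;> omega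
  · rw [lt_abs] at hx
    rw [hr]; split_ifs <;> omega
  · change (Equiv.swap a b * Equiv.swap (-a) (-b)) a = b
    rw [hr]; simp
  · intro x h1 h2 h3 h4
    change (Equiv.swap a b * Equiv.swap (-a) (-b)) x = x
    rw [hr]; simp [h1, h2, h3, h4]
  · intro h h1 h2 x
    change h ((Equiv.swap a b * Equiv.swap (-a) (-b)) x) = h x
    have h3 := h1 a
    have h4 := h1 b
    rw [hr]
    split_ifs with c1 c2 c3 c4
    · rw [c1, h2]
    · rw [c2, h2]
    · rw [c3, h3, h4, h2]
    · rw [c4, h3, h4, h2]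
    · rfl

/-- An entry larger than `1` at a position of mixed parity gives a reflection which exhibits the
failure of the even-odd trivial intersection property. -/
lemma exists_mixed_refl {lam mu : Comp m n} (hl : lam ∈ Lam m n d) (hm : mu ∈ Lam m n d)
    (w : weylB d) {i j : ℤ} (hij : ¬ (|i| ≤ m ↔ |j| ≤ m)) (h : 1 < kappa lam w mu i j) :
    ∃ r : weylB d, r ≠ 1 ∧
      ((w * r * w⁻¹ ∈ WOdd d lam ∧ r ∈ WEven d mu) ∨
        (w * r * w⁻¹ ∈ WEven d lam ∧ r ∈ WOdd d mu)) := by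
  rw [kappa_apply hl hm, Finset.one_lt_card] at h
  obtain ⟨a, ha, b, hb, hab⟩ := h
  rw [Finset.mem_filter] at ha hb
  obtain ⟨ha, ha1, ha2⟩ := ha
  obtain ⟨hb, hb1, hb2⟩ := hb
  -- The position `(0, 0)` is even on both sides, so a mixed position contains neither `0` nor two
  -- opposite points.
  have hne : ∀ c, bl mu c = j → bl lam (w.1 c) = i → c ≠ 0 := by
    rintro c h1 h2 rfl
    rw [weylB_zero, bl_zero] at h2
    rw [bl_zero] at h1
    subst h1 h2
    exact hij Iff.rfl
  have hab' : a ≠ -b := by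
    rintro rfl
    rw [bl_neg, hb1] at ha1
    rw [weylB_neg, bl_neg, hb2] at ha2
    have e1 : i = 0 := by omega
    have e2 : j = 0 := by omega
    subst e1 e2
    exact hij Iff.rfl
  obtain ⟨r, hr1, hr2, hr3⟩ := exists_pairRefl ha hb hab' (hne a ha1 ha2) (hne b hb1 hb2)
  have p1 : ∀ x, bl mu (r.1 x) = bl mu x := hr3 _ (bl_neg mu) (ha1.trans hb1.symm)
  have p2 : ∀ x, bl lam (w.1 (r.1 x)) = bl lam (w.1 x) :=
    hr3 (fun x => bl lam (w.1 x)) (fun x => by rw [weylB_neg, bl_neg]) (ha2.trans hb2.symm)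
  have p2' : ∀ x, bl lam ((w * r * w⁻¹).1 x) = bl lam x := fun x => by
    rw [mul_val_apply, mul_val_apply, p2, val_apply_inv_val]
  have f1 : ∀ x, |bl mu x| ≠ |j| → r.1 x = x := fun x hx => by
    apply hr2 <;> rintro rfl <;> apply hx <;> simp [bl_neg, ha1, hb1]
  have f2 : ∀ x, |bl lam x| ≠ |i| → (w * r * w⁻¹).1 x = x := fun x hx => by
    rw [mul_val_apply, mul_val_apply, hr2, val_apply_inv_val]
    all_goals
      intro h
      rw [inv_val_eq_iff] at h
      subst h
      apply hx
      simp [bl_neg, weylB_neg, ha2, hb2]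
  refine ⟨r, ?_, ?_⟩
  · rintro rfl
    exact hab hr1
  rw [mem_WOdd hl, mem_WOdd hm, mem_WEven hl, mem_WEven hm]
  by_cases hi : |i| ≤ m
  · have hj : ¬ |j| ≤ m := fun hj => hij (iff_of_true hi hj)
    exact Or.inr ⟨⟨p2', fun x hx => f2 x (by omega)⟩, ⟨p1, fun x hx => f1 x (by omega)⟩⟩
  · have hj : |j| ≤ m := by by_contra hj; exact hij (iff_of_false hi hj)
    exact Or.inl ⟨⟨p2', fun x hx => f2 x (by omega)⟩, ⟨p1, fun x hx => f1 x (by omega)⟩⟩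

lemma kappa_le_one_of_DDo {lam mu : Comp m n} (hl : lam ∈ Lam m n d) (hm : mu ∈ Lam m n d)
    {g : weylB d} (hg : g ∈ DDo d lam mu) {i j : ℤ} (hij : ¬ (|i| ≤ m ↔ |j| ≤ m)) :
    kappa lam g mu i j ≤ 1 := by
  by_contra h
  obtain ⟨r, hr, ⟨h1, h2⟩ | ⟨h1, h2⟩⟩ := exists_mixed_refl hl hm g hij (not_le.1 h)
  · exact hr (hg.2.1 r h1 h2)
  · exact hr (hg.2.2 r h1 h2)

/-- A moved point and its image occupy the same matrix position. This position is mixed, hence holds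
at most one point. -/
lemma eq_one_of_mixed {lam mu : Comp m n} (hl : lam ∈ Lam m n d) (hm : mu ∈ Lam m n d)
    {g w : weylB d}
    (h : ∀ i j : ℤ, ¬ (|i| ≤ m ↔ |j| ≤ m) → kappa lam g mu i j ≤ 1)
    (h1 : ∀ x, bl mu (w.1 x) = bl mu x) (h2 : ∀ x, bl lam (g.1 (w.1 x)) = bl lam (g.1 x))
    (h3 : ∀ x, w.1 x ≠ x → ¬ (|bl lam (g.1 x)| ≤ m ↔ |bl mu x| ≤ m)) : w = 1 := by
  refine Subtype.ext (Equiv.ext fun x => ?_)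
  change w.1 x = x
  by_contra hne
  have h4 := h _ _ (h3 x hne)
  rw [kappa_apply hl hm, Finset.card_le_one] at h4
  have hx : x ∈ pts d := by
    rw [mem_pts]
    by_contra hc
    exact hne (w.2.2 x (not_le.1 hc))
  refine hne (h4 _ ?_ _ ?_)
  · rw [Finset.mem_filter]
    exact ⟨(weylB_mem_pts w).2 hx, h1 x, h2 x⟩
  · rw [Finset.mem_filter]
    exact ⟨hx, rfl, rfl⟩

lemma DDo_of_kappa_le_one {lam mu : Comp m n} (hl : lam ∈ Lam m n d) (hm : mu ∈ Lam m n d)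
    {g : weylB d} (hg : g ∈ DD d lam mu)
    (h : ∀ i j : ℤ, ¬ (|i| ≤ m ↔ |j| ≤ m) → kappa lam g mu i j ≤ 1) : g ∈ DDo d lam mu := by
  refine ⟨hg, fun w h1 h2 => ?_, fun w h1 h2 => ?_⟩
  · rw [mem_WOdd hl] at h1
    rw [mem_WEven hm] at h2
    have e : ∀ x, (g * w * g⁻¹).1 (g.1 x) = g.1 (w.1 x) := fun x => by
      rw [mul_val_apply, mul_val_apply, inv_val_apply_val]
    refine eq_one_of_mixed hl hm h h2.1 (fun x => by rw [← e, h1.1]) fun x hx hc => ?_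
    by_cases h3 : |bl lam (g.1 x)| ≤ m
    · have := h1.2 _ h3
      rw [e] at this
      exact hx (g.1.injective this)
    · exact hx (h2.2 x (not_le.1 fun h => h3 (hc.2 h)))
  · rw [mem_WEven hl] at h1
    rw [mem_WOdd hm] at h2
    have e : ∀ x, (g * w * g⁻¹).1 (g.1 x) = g.1 (w.1 x) := fun x => by
      rw [mul_val_apply, mul_val_apply, inv_val_apply_val]
    refine eq_one_of_mixed hl hm h h2.1 (fun x => by rw [← e, h1.1]) fun x hx hc => ?_
    by_cases h3 : |bl mu x| ≤ m
    · exact hx (h2.2 x h3)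
    · have := h1.2 _ (not_le.1 fun h => h3 (hc.1 h))
      rw [e] at this
      exact hx (g.1.injective this)

end

end

end IotaSchur

namespace IotaSchur

noncomputable section

/-! ### Coefficient functions of eigenvectors -/

section

variable {m n d : ℕ}

/-- `(-q)^{-N}`. -/
def negQ (N : ℕ) : Lau := (-1) ^ N * vpow (-2 * (N : ℤ))

lemma negQ_zero : negQ 0 = 1 := by simp [negQ]

lemma negQ_one : negQ 1 = -vpow (-2) := by simp [negQ]

lemma negQ_add (a b : ℕ) : negQ (a + b) = negQ a * negQ b := by
  have : vpow (-2 * ((a + b : ℕ) : ℤ)) = vpow (-2 * a) * vpow (-2 * b) := by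
    rw [← LaurentPolynomial.T_add]; congr 1; push_cast; ring
  rw [negQ, negQ, negQ, pow_add, this]
  ring

open Classical in
/-- The ratio of the coefficients of `T_{s w}` and `T_w` in an eigenvector. -/
def stepRatio (lam : Comp m n) (k : Fin d) : Lau :=
  if |bl lam (rootHi k)| ≤ m then 1 else negQ 1

open Classical in
/-- The eigenvalue of `T_{s_k}` on `[xy]_λ`. -/
def eigVal (lam : Comp m n) (k : Fin d) : Lau :=
  if |bl lam (rootHi k)| ≤ m then qq else -1

lemma qq_mul_negQ : qq * negQ 1 = -1 := by
  rw [negQ_one, mul_neg, vpow_mul_neg]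

lemma qq_mul_stepRatio (lam : Comp m n) (k : Fin d) : qq * stepRatio lam k = eigVal lam k := by
  unfold stepRatio eigVal
  split_ifs
  · rw [mul_one]
  · exact qq_mul_negQ

/-- Multiplied by `q`, this is the quadratic relation for the eigenvalue, which is `q` times the
ratio. -/
lemma one_add_stepRatio (lam : Comp m n) (k : Fin d) :
    1 + (qq - 1) * stepRatio lam k = eigVal lam k * stepRatio lam k := by
  have h := qq_mul_negQ
  unfold stepRatio eigVal
  split_ifs
  · ring
  · linear_combination h

/-- The left eigenvector condition in terms of coefficients. -/
def LeftStep (lam : Comp m n) (f : weylB d → Lau) : Prop :=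
  ∀ k : Fin d, IsGen lam k → ∀ w, len w < len (simpleRefl k * w) →
    f (simpleRefl k * w) = stepRatio lam k * f w

/-- The right eigenvector condition in terms of coefficients. -/
def RightStep (mu : Comp m n) (f : weylB d → Lau) : Prop :=
  ∀ k : Fin d, IsGen mu k → ∀ w, len w < len (w * simpleRefl k) →
    f (w * simpleRefl k) = stepRatio mu k * f w

lemma qq_cancel {a b : Lau} (h : qq * a = qq * b) : a = b := by
  have := congrArg (vpow (-2) * ·) h
  simp only [← mul_assoc, vpow_neg_mul, one_mul] at this
  exact this

/-- The eigenvector equations at `w` and at `s w` are equivalent by the quadratic relation, so only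
the lower element of each pair `{w, s w}` has to be tested. -/
lemma leftOp_eq_smul_iff (k : Fin d) (lam : Comp m n) (f : weylB d → Lau) :
    leftOp k f = eigVal lam k • f ↔ ∀ w, len w < len (simpleRefl k * w) →
      f (simpleRefl k * w) = stepRatio lam k * f w := by
  constructor
  · intro h w hw
    have h1 := congrFun h w
    rw [leftOp_apply, if_pos hw, Pi.smul_apply, smul_eq_mul, ← qq_mul_stepRatio, mul_assoc] at h1
    exact qq_cancel h1
  · intro h
    funext w
    rw [leftOp_apply, Pi.smul_apply, smul_eq_mul]
    split_ifs with hw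
    · rw [h w hw, ← mul_assoc, qq_mul_stepRatio]
    · have h0 := len_simple_mul_ne k w
      have h1 := h (simpleRefl k * w) (by rw [simple_mul_simple_mul]; omega)
      rw [simple_mul_simple_mul] at h1
      have h2 := one_add_stepRatio lam k
      rw [h1]
      linear_combination f (simpleRefl k * w) * h2

lemma rightOp_eq_smul_iff (k : Fin d) (mu : Comp m n) (f : weylB d → Lau) :
    rightOp k f = eigVal mu k • f ↔ ∀ w, len w < len (w * simpleRefl k) →
      f (w * simpleRefl k) = stepRatio mu k * f w := by
  constructor
  · intro h w hw
    have h1 := congrFun h w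
    rw [rightOp_apply, if_pos hw, Pi.smul_apply, smul_eq_mul, ← qq_mul_stepRatio, mul_assoc] at h1
    exact qq_cancel h1
  · intro h
    funext w
    rw [rightOp_apply, Pi.smul_apply, smul_eq_mul]
    split_ifs with hw
    · rw [h w hw, ← mul_assoc, qq_mul_stepRatio]
    · have h0 := len_mul_simple_ne k w
      have h1 := h (w * simpleRefl k) (by rw [mul_simple_mul_simple]; omega)
      rw [mul_simple_mul_simple] at h1
      have h2 := one_add_stepRatio mu k
      rw [h1]
      linear_combination f (w * simpleRefl k) * h2

/-- `z` is an eigenvector for the left action of the generators of `W_λ`. -/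
def IsLeftEig (lam : Comp m n) (z : Hecke d) : Prop :=
  ∀ k : Fin d, IsGen lam k → TT (simpleRefl k) * z = eigVal lam k • z

/-- `z` is an eigenvector for the right action of the generators of `W_μ`. -/
def IsRightEig (mu : Comp m n) (z : Hecke d) : Prop :=
  ∀ k : Fin d, IsGen mu k → z * TT (simpleRefl k) = eigVal mu k • z

lemma isLeftEig_iff (lam : Comp m n) (z : Hecke d) : IsLeftEig lam z ↔ LeftStep lam (coef z) := by
  refine forall₂_congr fun k _ => ?_
  rw [← leftOp_eq_smul_iff, ← coef_simple_mul, ← map_smul, coef_injective.eq_iff]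

lemma isRightEig_iff (mu : Comp m n) (z : Hecke d) : IsRightEig mu z ↔ RightStep mu (coef z) := by
  refine forall₂_congr fun k _ => ?_
  rw [← rightOp_eq_smul_iff, ← coef_mul_simple, ← map_smul, coef_injective.eq_iff]

lemma RightStep.inv {mu : Comp m n} {f : weylB d → Lau} (h : RightStep mu f) :
    LeftStep mu fun w => f w⁻¹ := fun k hk w hw => by
  simp only [mul_inv_rev, simpleRefl_inv]
  refine h k hk _ ?_
  rwa [mul_simple_eq_inv, len_inv, inv_inv]

/-! ### Odd lengths -/

/-- The points `a`, `b` lie in a common odd block for `μ`, or their images in one for `λ`; the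
condition selects one from each pair of opposite pairs. -/
def OddCond (lam mu : Comp m n) (w : weylB d) (a b : ℤ) : Prop :=
  (bl lam (w.1 a) = bl lam (w.1 b) ∧ (m : ℤ) < bl lam (w.1 a)) ∨
    (bl mu a = bl mu b ∧ (m : ℤ) < bl mu a ∧ bl lam (w.1 a) ≠ bl lam (w.1 b))

lemma OddCond.ne_zero {lam mu : Comp m n} {w : weylB d} {a b : ℤ} (h : OddCond lam mu w a b) :
    a ≠ 0 ∧ b ≠ 0 := by
  have e1 : ∀ c, c = 0 → bl mu c = 0 := fun c hc => by rw [hc, bl_zero]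
  have e2 : ∀ c, c = 0 → bl lam (w.1 c) = 0 := fun c hc => by rw [hc, weylB_zero, bl_zero]
  have := e1 a
  have := e1 b
  have := e2 a
  have := e2 b
  unfold OddCond at h
  omega

instance (lam mu : Comp m n) (w : weylB d) (a b : ℤ) : Decidable (OddCond lam mu w a b) := by
  unfold OddCond; infer_instance

/-- The pairs inverted by `w` in a common odd block for `λ` or for `μ`, one from each pair of
opposite pairs. -/
def oddPairs (lam mu : Comp m n) (w : weylB d) : Finset (ℤ × ℤ) :=
  (pts d ×ˢ pts d).filter fun p => p.1 < p.2 ∧ w.1 p.2 < w.1 p.1 ∧ OddCond lam mu w p.1 p.2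

lemma mem_oddPairs (lam mu : Comp m n) (w : weylB d) (a b : ℤ) :
    (a, b) ∈ oddPairs lam mu w ↔
      (a ∈ pts d ∧ b ∈ pts d) ∧ a < b ∧ w.1 b < w.1 a ∧ OddCond lam mu w a b := by
  rw [oddPairs, Finset.mem_filter, Finset.mem_product]

/-- The odd part of the length of an element of a double coset. -/
def oddLen (lam mu : Comp m n) (w : weylB d) : ℕ := (oddPairs lam mu w).card

lemma rootHi_pos (k : ℕ) : 0 < rootHi k := by unfold rootHi; omega

lemma bl_rootHi_nonneg (lam : Comp m n) (k : ℕ) : 0 ≤ bl lam (rootHi k) :=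
  bl_nonneg lam (rootHi_pos k).le

lemma oddCond_simple_mul (lam mu : Comp m n) (w : weylB d) (k : Fin d) (hk : IsGen lam k)
    (a b : ℤ) : OddCond lam mu (simpleRefl k * w) a b ↔ OddCond lam mu w a b := by
  simp only [OddCond, mul_val_apply, simpleRefl_val, bl_reflPerm hk]

/-- Only the preimage of the root pair and its opposite change status. Their images share a block
with index `≥ 0`, respectively `≤ 0`; thus the first is counted exactly if the block is odd, and the
opposite pair never. -/
lemma oddPairs_simple_mul (lam mu : Comp m n) (w : weylB d) (k : Fin d) (hk : IsGen lam k)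
    (h : w⁻¹.1 (rootLo k) < w⁻¹.1 (rootHi k)) :
    oddPairs lam mu (simpleRefl k * w) = if |bl lam (rootHi k)| ≤ m then oddPairs lam mu w
      else insert (w⁻¹.1 (rootLo k), w⁻¹.1 (rootHi k)) (oddPairs lam mu w) := by
  have hnn := bl_rootHi_nonneg lam k
  have hg := (isGen_iff lam k).1 hk
  have hlt := rootLo_lt_rootHi k
  have hmain : ∀ a b, (a, b) ∈ oddPairs lam mu (simpleRefl k * w) ↔ (a, b) ∈ oddPairs lam mu w ∨
      (¬ |bl lam (rootHi k)| ≤ m ∧ a = w⁻¹.1 (rootLo k) ∧ b = w⁻¹.1 (rootHi k)) := by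
    intro a b
    rw [mem_oddPairs, mem_oddPairs, oddCond_simple_mul _ _ _ _ hk]
    simp only [mul_val_apply, simpleRefl_val]
    by_cases c1 : a = w⁻¹.1 (rootLo k) ∧ b = w⁻¹.1 (rootHi k)
    · obtain ⟨rfl, rfl⟩ := c1
      simp only [OddCond, val_apply_inv_val, reflPerm_rootLo, reflPerm_rootHi, hg, weylB_mem_pts,
        rootLo_mem_pts, rootHi_mem_pts, abs_of_nonneg hnn, true_and, and_true, ne_eq,
        not_true_eq_false, and_false, or_false]
      omega
    have c1' : ¬ (¬ |bl lam (rootHi k)| ≤ m ∧ a = w⁻¹.1 (rootLo k) ∧ b = w⁻¹.1 (rootHi k)) :=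
      fun h => c1 h.2
    rw [or_iff_left c1']
    by_cases c2 : a = -w⁻¹.1 (rootHi k) ∧ b = -w⁻¹.1 (rootLo k)
    · obtain ⟨rfl, rfl⟩ := c2
      have : ¬ ((m : ℤ) < -bl lam (rootHi k)) := by omega
      simp only [OddCond, weylB_neg, val_apply_inv_val, bl_neg, hg, this, and_false, ne_eq,
        not_true_eq_false, or_self]
    refine and_congr_right fun _ => and_congr_right fun hab => and_congr_left fun hC => ?_
    have hz0 : ∀ c, w.1 c = 0 → c = 0 := fun c hc => w.1.injective (hc.trans (weylB_zero w).symm)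
    have hz := hC.ne_zero
    have e : ∀ {x y}, w.1 x = y → x = w⁻¹.1 y := fun h => ((inv_val_eq_iff w _ _).2 h.symm).symm
    have e' : ∀ {x y}, w.1 x = -y → x = -w⁻¹.1 y := fun h => by rw [← weylB_neg]; exact e h
    apply reflPerm_lt_iff (fun h => hz.2 (hz0 _ h)) (fun h => hz.1 (hz0 _ h))
    · rintro ⟨h1, h2⟩
      have := e h1
      have := e h2
      omega
    · rintro ⟨h1, h2⟩
      exact c1 ⟨e h2, e h1⟩
    · rintro ⟨h1, h2⟩
      exact c2 ⟨e' h2, e' h1⟩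
    · rintro ⟨h1, h2⟩
      have := e' h1
      have := e' h2
      omega
  ext ⟨a, b⟩
  rw [hmain]
  split_ifs with hc
  · exact or_iff_left fun h => h.1 hc
  · rw [Finset.mem_insert, Prod.mk.injEq, or_comm]
    exact or_congr_left (and_iff_right hc)

/-- No restriction on mixed entries is needed on the left: the first alternative of `OddCond` looks
at the `λ`-block alone, and it takes precedence over the second. -/
lemma negQ_oddLen_simple_mul (lam mu : Comp m n) :
    LeftStep lam fun w : weylB d => negQ (oddLen lam mu w) := by
  intro k hk w hw
  rw [lt_len_simple_mul_iff] at hw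
  simp only [oddLen, oddPairs_simple_mul lam mu w k hk hw, stepRatio]
  split_ifs with hc
  · rw [one_mul]
  · rw [Finset.card_insert_of_notMem, add_comm, negQ_add]
    rw [mem_oddPairs]
    simp only [val_apply_inv_val]
    have := rootLo_lt_rootHi k
    omega

/-- Two distinct points in a common block for `μ` with images in a common block for `λ` lie in
blocks of the same parity. -/
def NoMixed (lam : Comp m n) (w : weylB d) (mu : Comp m n) : Prop :=
  ∀ x ∈ pts d, ∀ y ∈ pts d, x ≠ y → bl mu x = bl mu y → bl lam (w.1 x) = bl lam (w.1 y) →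
    (|bl lam (w.1 x)| ≤ m ↔ |bl mu x| ≤ m)

lemma noMixed_iff {lam mu : Comp m n} (hl : lam ∈ Lam m n d) (hm : mu ∈ Lam m n d) (w : weylB d) :
    NoMixed lam w mu ↔ ∀ i j : ℤ, ¬ (|i| ≤ m ↔ |j| ≤ m) → kappa lam w mu i j ≤ 1 := by
  constructor
  · intro h i j hij
    rw [kappa_apply hl hm, Finset.card_le_one]
    intro x hx y hy
    rw [Finset.mem_filter] at hx hy
    obtain ⟨hx, rfl, rfl⟩ := hx
    by_contra hne
    exact hij (h x hx y hy.1 hne hy.2.1.symm hy.2.2.symm)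
  · intro h x hx y hy hxy h1 h2
    by_contra hc
    have h3 := h _ _ hc
    rw [kappa_apply hl hm, Finset.card_le_one] at h3
    refine hxy (h3 x ?_ y ?_) <;> rw [Finset.mem_filter]
    · exact ⟨hx, rfl, rfl⟩
    · exact ⟨hy, h1.symm, h2.symm⟩

/-- On the right the parity of the `μ`-block must decide, although `OddCond` looks at the `λ`-block
first if the two images share one. `NoMixed` makes the two parities agree in this case. After
transport by `s_k` the inverted pairs are those of `w`, except possibly for the root pair and its
opposite. -/
lemma oddLen_mul_simple (lam mu : Comp m n) (w : weylB d) (k : Fin d) (hk : IsGen mu k)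
    (h : w.1 (rootLo k) < w.1 (rootHi k)) (hw : NoMixed lam w mu) :
    oddLen lam mu (w * simpleRefl k) = if |bl mu (rootHi k)| ≤ m then oddLen lam mu w
      else oddLen lam mu w + 1 := by
  classical
  have hnn := bl_rootHi_nonneg mu k
  have hg := (isGen_iff mu k).1 hk
  have hlt := rootLo_lt_rootHi k
  set s : ℤ → ℤ := fun x => reflPerm k x with hs
  set E : Finset (ℤ × ℤ) := (pts d ×ˢ pts d).filter fun p => s p.1 < s p.2 ∧ w.1 p.2 < w.1 p.1 ∧
    OddCond lam mu w p.1 p.2 with hE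
  have memE : ∀ a b, (a, b) ∈ E ↔ (a ∈ pts d ∧ b ∈ pts d) ∧ s a < s b ∧ w.1 b < w.1 a ∧
      OddCond lam mu w a b := fun a b => by
    rw [hE, Finset.mem_filter, Finset.mem_product]
  have hmem : ∀ x, s x ∈ pts d ↔ x ∈ pts d := fun x => weylB_mem_pts (simpleRefl k)
  have hss : ∀ x, s (s x) = x := reflPerm_reflPerm k
  have hcond : ∀ a b, OddCond lam mu (w * simpleRefl k) a b ↔ OddCond lam mu w (s a) (s b) := by
    intro a b
    have e : ∀ x, bl mu (s x) = bl mu x := bl_reflPerm hk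
    simp only [OddCond, e]
    rfl
  have himg : E = (oddPairs lam mu (w * simpleRefl k)).image fun p => (s p.1, s p.2) := by
    ext ⟨a, b⟩
    rw [Finset.mem_image, memE]
    constructor
    · rintro ⟨⟨h1, h2⟩, h3, h4, h5⟩
      refine ⟨(s a, s b), ?_, by simp only [hss]⟩
      rw [mem_oddPairs, hcond, hss, hss, hmem, hmem]
      refine ⟨⟨h1, h2⟩, h3, ?_, h5⟩
      change w.1 (s (s b)) < w.1 (s (s a))
      rwa [hss, hss]
    · rintro ⟨⟨a', b'⟩, hab, he⟩
      simp only [Prod.mk.injEq] at he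
      obtain ⟨rfl, rfl⟩ := he
      rw [mem_oddPairs, hcond] at hab
      obtain ⟨⟨h1, h2⟩, h3, h4, h5⟩ := hab
      rw [hss, hss, hmem, hmem]
      exact ⟨⟨h1, h2⟩, h3, h4, h5⟩
  have hcard : oddLen lam mu (w * simpleRefl k) = E.card := by
    rw [oddLen, himg, Finset.card_image_of_injective]
    intro p p' hpp
    simp only [Prod.mk.injEq] at hpp
    have e1 := congrArg s hpp.1
    have e2 := congrArg s hpp.2
    rw [hss, hss] at e1 e2
    exact Prod.ext e1 e2
  have hpp : rootLo k ∈ pts d := rootLo_mem_pts k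
  have hqp : rootHi k ∈ pts d := rootHi_mem_pts k
  have hx := hw _ hpp _ hqp hlt.ne hg
  have hsp : s (rootLo k) = rootHi k := reflPerm_rootLo k
  have hsq : s (rootHi k) = rootLo k := reflPerm_rootHi k
  rw [hg, abs_of_nonneg hnn, abs_le] at hx
  rw [abs_of_nonneg hnn]
  have hrefl : ∀ a b, a ≠ 0 → b ≠ 0 → ¬ (a = rootLo k ∧ b = rootHi k) →
      ¬ (a = rootHi k ∧ b = rootLo k) → ¬ (a = -rootLo k ∧ b = -rootHi k) →
      ¬ (a = -rootHi k ∧ b = -rootLo k) → (s a < s b ↔ a < b) := fun _ _ => reflPerm_lt_iff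
  generalize rootLo (k : ℕ) = p at *
  generalize rootHi (k : ℕ) = q at *
  have hneg : ∀ x, s (-x) = -s x := (reflPerm_mem k.2).1
  -- If the images share an odd `λ`-block of negative index, the sign condition selects `(-p, -q)`
  -- in place of `(q, p)`; the failure of `X` is this case. Either way exactly one pair is added if
  -- the `μ`-block is odd.
  set X : Prop := bl lam (w.1 p) = bl lam (w.1 q) → (m : ℤ) < bl lam (w.1 q) with hX
  have hmain : ∀ a b, (a, b) ∈ E ↔ (a, b) ∈ oddPairs lam mu w ∨ (¬ bl mu q ≤ m ∧
      ((a = q ∧ b = p ∧ X) ∨ (a = -p ∧ b = -q ∧ ¬ X))) := by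
    intro a b
    rw [memE, mem_oddPairs]
    by_cases c1 : a = q ∧ b = p
    · obtain ⟨rfl, rfl⟩ := c1
      simp only [OddCond, hsp, hsq, hg, hpp, hqp, true_and]
      have h1 : ¬ bl mu a ≤ m → ¬ (a = -b ∧ b = -a ∧ ¬ X) := by
        rintro h0 ⟨h1, -, -⟩
        have h5 : bl mu b = -bl mu a := by rw [← bl_neg, h1, neg_neg]
        omega
      rw [and_congr_right fun h0 => or_iff_left (h1 h0), hX]
      omega
    by_cases c2 : a = -p ∧ b = -q
    · obtain ⟨rfl, rfl⟩ := c2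
      simp only [OddCond, hsp, hsq, hg, hpp, hqp, hneg, neg_mem_pts, weylB_neg, bl_neg, true_and]
      have h1 : ¬ (-p = q ∧ -q = p ∧ X) := fun h => c1 ⟨h.1, h.2.1⟩
      rw [or_iff_right h1, hX]
      omega
    have c3 : ¬ (¬ bl mu q ≤ m ∧ ((a = q ∧ b = p ∧ X) ∨ (a = -p ∧ b = -q ∧ ¬ X))) := by
      rintro ⟨-, h | h⟩
      · exact c1 ⟨h.1, h.2.1⟩
      · exact c2 ⟨h.1, h.2.1⟩
    rw [or_iff_left c3]
    refine and_congr_right fun _ => and_congr_left fun hC => ?_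
    have hz := hC.2.ne_zero
    apply hrefl a b hz.1 hz.2
    · rintro ⟨rfl, rfl⟩
      exact absurd hC.1 h.not_gt
    · exact c1
    · exact c2
    · rintro ⟨rfl, rfl⟩
      have := hC.1
      rw [weylB_neg, weylB_neg] at this
      omega
  have hnot : ∀ a b, (a, b) ∈ oddPairs lam mu w → a < b ∧ w.1 b < w.1 a := fun a b hab => by
    rw [mem_oddPairs] at hab
    exact ⟨hab.2.1, hab.2.2.1⟩
  rw [hcard, oddLen]
  split_ifs with hc
  · congr 1
    ext ⟨a, b⟩
    rw [hmain]
    exact or_iff_left fun h => h.1 hc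
  · by_cases hd : X
    · rw [← Finset.card_insert_of_notMem (a := (q, p)) (s := oddPairs lam mu w)]
      · congr 1
        ext ⟨a, b⟩
        rw [hmain, Finset.mem_insert, Prod.mk.injEq, or_comm]
        simp only [hc, hd, not_false_eq_true, true_and, and_true, not_true_eq_false, and_false,
          or_false]
      · intro hqp
        have := hnot _ _ hqp
        omega
    · rw [← Finset.card_insert_of_notMem (a := (-p, -q)) (s := oddPairs lam mu w)]
      · congr 1
        ext ⟨a, b⟩
        rw [hmain, Finset.mem_insert, Prod.mk.injEq, or_comm]
        simp only [hc, hd, not_false_eq_true, true_and, and_true, and_false, false_or]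
      · intro hqp
        have := hnot _ _ hqp
        rw [weylB_neg, weylB_neg] at this
        omega

/-! ### The eigenvectors attached to double cosets -/

open Classical in
/-- The coefficient of `T_w` in the eigenvector attached to the matrix `A`. -/
def cosetFun (d : ℕ) (lam mu : Comp m n) (A : ℤ → ℤ → ℕ) (w : weylB d) : Lau :=
  if kappa lam w mu = A then negQ (oddLen lam mu w) else 0

/-- The eigenvector attached to the matrix `A`. -/
def cosetElt (d : ℕ) (lam mu : Comp m n) (A : ℤ → ℤ → ℕ) : Hecke d :=
  ∑ w, cosetFun d lam mu A w • TT w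

lemma coef_cosetElt (lam mu : Comp m n) (A : ℤ → ℤ → ℕ) :
    coef (cosetElt d lam mu A) = cosetFun d lam mu A := coef_sum_TT _

lemma kappa_simple_mul {lam mu : Comp m n} (hl : lam ∈ Lam m n d) (hm : mu ∈ Lam m n d)
    {k : Fin d} (hk : IsGen lam k) (w : weylB d) :
    kappa lam (simpleRefl k * w) mu = kappa lam w mu := by
  have := kappa_mul_mul hl hm (Subgroup.subset_closure ⟨k, hk, rfl⟩) (one_mem _) w
  rwa [mul_one] at this

lemma kappa_mul_simple {lam mu : Comp m n} (hl : lam ∈ Lam m n d) (hm : mu ∈ Lam m n d)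
    {k : Fin d} (hk : IsGen mu k) (w : weylB d) :
    kappa lam (w * simpleRefl k) mu = kappa lam w mu := by
  have := kappa_mul_mul hl hm (one_mem _) (Subgroup.subset_closure ⟨k, hk, rfl⟩) w
  rwa [one_mul] at this

lemma leftStep_cosetFun {lam mu : Comp m n} (hl : lam ∈ Lam m n d) (hm : mu ∈ Lam m n d)
    (A : ℤ → ℤ → ℕ) : LeftStep lam (cosetFun d lam mu A) := by
  intro k hk w hw
  rw [cosetFun, cosetFun, kappa_simple_mul hl hm hk]
  split_ifs
  · exact negQ_oddLen_simple_mul lam mu k hk w hw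
  · rw [mul_zero]

lemma rightStep_cosetFun {lam mu : Comp m n} (hl : lam ∈ Lam m n d) (hm : mu ∈ Lam m n d)
    {A : ℤ → ℤ → ℕ} (hA : ∀ i j : ℤ, ¬ (|i| ≤ m ↔ |j| ≤ m) → A i j ≤ 1) :
    RightStep mu (cosetFun d lam mu A) := by
  intro k hk w hw
  rw [cosetFun, cosetFun, kappa_mul_simple hl hm hk]
  split_ifs with h
  · rw [oddLen_mul_simple lam mu w k hk ((lt_len_mul_simple_iff w k).1 hw)
      ((noMixed_iff hl hm w).2 (by rwa [h])), stepRatio]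
    split_ifs
    · rw [one_mul]
    · rw [add_comm, negQ_add]
  · rw [mul_zero]

lemma oddLen_eq_zero_of_DD {lam mu : Comp m n} {g : weylB d} (hg : g ∈ DD d lam mu) :
    oddLen lam mu g = 0 := by
  rw [oddLen, Finset.card_eq_zero, Finset.eq_empty_iff_forall_notMem]
  rintro ⟨a, b⟩ h
  rw [mem_oddPairs] at h
  obtain ⟨-, h1, h2, ⟨h3, -⟩ | ⟨h3, -⟩⟩ := h
  · have := DD_left hg h2 h3.symm
    rw [inv_val_apply_val, inv_val_apply_val] at this
    omega
  · have := DD_right hg h1 h3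
    omega

end

end

end IotaSchur

namespace IotaSchur

noncomputable section

/-! ### Double cosets and their generators -/

section

variable {m n d : ℕ}

/-- Induction over the elements which preserve all blocks and fix the points of some of them. -/
lemma block_induction {lam : Comp m n} {Q : ℤ → Prop} {p : weylB d → Prop} (one : p 1)
    (step : ∀ k w, IsGen lam k → Q (bl lam (rootHi k)) → (∀ x, bl lam (w.1 x) = bl lam x) →
      w⁻¹.1 (rootLo k) < w⁻¹.1 (rootHi k) → p w → p (simpleRefl k * w))
    (hQ : ∀ i, Q (-i) ↔ Q i) {w : weylB d}
    (h1 : ∀ x, bl lam (w.1 x) = bl lam x) (h2 : ∀ x, ¬ Q (bl lam x) → w.1 x = x) : p w := by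
  obtain ⟨N, hN⟩ : ∃ N, len w = N := ⟨_, rfl⟩
  induction N generalizing w with
  | zero => rw [len_eq_zero hN]; exact one
  | succ N ih =>
    have h1' : ∀ x, bl lam (w⁻¹.1 x) = bl lam x := fun x => by rw [← h1, val_apply_inv_val]
    have h2' : ∀ x, ¬ Q (bl lam x) → w⁻¹.1 x = x := fun x hx => by
      rw [inv_val_eq_iff, h2 x hx]
    obtain ⟨k, hk⟩ := exists_right_descent (w := w⁻¹) (by
      rw [ne_eq, inv_eq_one]; rintro rfl; simp [len_one] at hN)
    obtain ⟨hg, hq⟩ := isGen_of_descent h1' h2' hk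
    have h3 := len_simple_mul' w k hk
    have hs := (mem_closure_blocks lam Q hQ (simpleRefl k)).1
      (Subgroup.subset_closure ⟨k, ⟨hg, hq⟩, rfl⟩)
    have p1 : ∀ x, bl lam ((simpleRefl k * w).1 x) = bl lam x := fun x => by
      rw [mul_val_apply, hs.1, h1]
    have h4 := step k (simpleRefl k * w) hg hq p1 (by
        rw [inv_simple_mul_apply, inv_simple_mul_apply, reflPerm_rootLo, reflPerm_rootHi]
        exact hk)
      (ih p1 (fun x hx => by rw [mul_val_apply, h2 x hx, hs.2 x hx]) (by omega))
    rwa [simple_mul_simple_mul] at h4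

/-- The inverse of `u` increases on all blocks, i.e. `u` is shortest in `W_λ u`. -/
def LeftMin (lam : Comp m n) (u : weylB d) : Prop :=
  ∀ a b, a < b → bl lam a = bl lam b → u⁻¹.1 a < u⁻¹.1 b

/-- An inversion of `u⁻¹` joins two different `λ`-blocks, and `x` preserves each block, hence the
order between different blocks; so `len_mul_of_inv` applies. -/
lemma len_mul_of_leftMin {lam : Comp m n} {x u : weylB d} (hx : x ∈ WW d lam)
    (hu : LeftMin lam u) : len (x * u) = len x + len u := by
  rw [mem_WW] at hx
  refine len_mul_of_inv x u fun a b hab hba => ?_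
  have h1 : bl lam a < bl lam b := lt_of_le_of_ne (bl_mono lam hab.le) fun h =>
    absurd (hu a b hab h) hba.not_gt
  by_contra h2
  have h3 := bl_mono lam (not_lt.1 h2)
  rw [hx, hx] at h3
  omega

lemma len_mul_of_leftMin_inv {mu : Comp m n} {u y : weylB d} (hy : y ∈ WW d mu)
    (hu : LeftMin mu u⁻¹) : len (u * y) = len u + len y := by
  rw [← len_inv, mul_inv_rev, len_mul_of_leftMin (inv_mem hy) hu, len_inv, len_inv, add_comm]

lemma DD.leftMin {lam mu : Comp m n} {g : weylB d} (hg : g ∈ DD d lam mu) : LeftMin lam g :=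
  fun _ _ h1 h2 => DD_left hg h1 h2

lemma DD.leftMin_inv {lam mu : Comp m n} {g : weylB d} (hg : g ∈ DD d lam mu) :
    LeftMin mu g⁻¹ := fun a b h1 h2 => by rw [inv_inv]; exact DD_right hg h1 h2

/-- Each letter of `w` is an ascent on the way up from `u`, and its ratio is 1. Monotonicity of
`u⁻¹` is required on even blocks only, so that the statement also applies to `w₁ u` with `w₁` odd.
-/
lemma LeftStep.mul_even {lam : Comp m n} (hl : lam ∈ Lam m n d) {f : weylB d → Lau}
    (hf : LeftStep lam f) {w u : weylB d} (hw : w ∈ WEven d lam)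
    (hu : ∀ a b, a < b → bl lam a = bl lam b → |bl lam a| ≤ m → u⁻¹.1 a < u⁻¹.1 b) :
    f (w * u) = f u := by
  rw [mem_WEven hl] at hw
  refine block_induction (lam := lam) (Q := fun i => |i| ≤ m) (p := fun w => f (w * u) = f u)
    (by rw [one_mul]) (fun k w hk hq hw' hlt ih => ?_) (fun i => by rw [abs_neg]) hw.1
    (fun x hx => hw.2 x (not_le.1 hx))
  have hw'' : ∀ x, bl lam (w⁻¹.1 x) = bl lam x := fun x => by rw [← hw', val_apply_inv_val]
  rw [mul_assoc, hf k hk, stepRatio, if_pos hq, one_mul, ih]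
  rw [lt_len_simple_mul_iff, mul_inv_rev, mul_val_apply, mul_val_apply]
  refine hu _ _ hlt ?_ ?_
  · rw [hw'', hw'', (isGen_iff lam k).1 hk]
  · rwa [hw'', (isGen_iff lam k).1 hk]

lemma LeftStep.mul_odd {lam : Comp m n} (hl : lam ∈ Lam m n d) {f : weylB d → Lau}
    (hf : LeftStep lam f) {w u : weylB d} (hw : w ∈ WOdd d lam)
    (hu : ∀ a b, a < b → bl lam a = bl lam b → m < |bl lam a| → u⁻¹.1 a < u⁻¹.1 b) :
    f (w * u) = negQ (len w) * f u := by
  rw [mem_WOdd hl] at hw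
  refine block_induction (lam := lam) (Q := fun i => (m : ℤ) < |i|)
    (p := fun w => f (w * u) = negQ (len w) * f u)
    (by rw [one_mul, len_one, negQ_zero, one_mul]) (fun k w hk hq hw' hlt ih => ?_)
    (fun i => by rw [abs_neg]) hw.1 (fun x hx => hw.2 x (not_lt.1 hx))
  have hw'' : ∀ x, bl lam (w⁻¹.1 x) = bl lam x := fun x => by rw [← hw', val_apply_inv_val]
  rw [mul_assoc, hf k hk, stepRatio, if_neg (not_le.2 hq), ih, len_simple_mul w k hlt, add_comm,
    negQ_add, mul_assoc]
  rw [lt_len_simple_mul_iff, mul_inv_rev, mul_val_apply, mul_val_apply]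
  refine hu _ _ hlt ?_ ?_
  · rw [hw'', hw'', (isGen_iff lam k).1 hk]
  · rwa [hw'', (isGen_iff lam k).1 hk]

lemma LeftStep.mul_mul {lam : Comp m n} (hl : lam ∈ Lam m n d) {f : weylB d → Lau}
    (hf : LeftStep lam f) {w₀ w₁ u : weylB d} (h0 : w₀ ∈ WEven d lam) (h1 : w₁ ∈ WOdd d lam)
    (hu : LeftMin lam u) : f (w₀ * w₁ * u) = negQ (len w₁) * f u := by
  rw [mul_assoc, hf.mul_even hl h0, hf.mul_odd hl h1 fun a b hab h _ => hu a b hab h]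
  intro a b hab h he
  have h2 := ((mem_WOdd hl _).1 (inv_mem h1)).2
  rw [mul_inv_rev, mul_val_apply, mul_val_apply, h2 a he, h2 b (by rwa [← h])]
  exact hu a b hab h

lemma WEven_le (d : ℕ) (lam : Comp m n) : WEven d lam ≤ WW d lam :=
  Subgroup.closure_mono fun _ ⟨k, h1, _, h2⟩ => ⟨k, h1, h2⟩

lemma WOdd_le (d : ℕ) (lam : Comp m n) : WOdd d lam ≤ WW d lam :=
  Subgroup.closure_mono fun _ ⟨k, h1, _, h2⟩ => ⟨k, h1, h2⟩

lemma WEven_mul_comm {lam : Comp m n} (hl : lam ∈ Lam m n d) {w₀ w₁ : weylB d}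
    (h0 : w₀ ∈ WEven d lam) (h1 : w₁ ∈ WOdd d lam) : w₀ * w₁ = w₁ * w₀ := by
  rw [mem_WEven hl] at h0
  rw [mem_WOdd hl] at h1
  refine Subtype.ext (Equiv.ext fun x => ?_)
  rw [mul_val_apply, mul_val_apply]
  by_cases hx : |bl lam x| ≤ m
  · rw [h1.2 x hx, h1.2 _ (by rwa [h0.1])]
  · rw [h0.2 x (not_le.1 hx), h0.2 _ (by rw [h1.1]; exact not_le.1 hx)]

lemma WEven_inf_WOdd {lam : Comp m n} (hl : lam ∈ Lam m n d) {w : weylB d}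
    (h0 : w ∈ WEven d lam) (h1 : w ∈ WOdd d lam) : w = 1 := by
  rw [mem_WEven hl] at h0
  rw [mem_WOdd hl] at h1
  refine Subtype.ext (Equiv.ext fun x => ?_)
  by_cases hx : |bl lam x| ≤ m
  · exact h1.2 x hx
  · exact h0.2 x (not_le.1 hx)

lemma WEven_WOdd_unique {lam : Comp m n} (hl : lam ∈ Lam m n d) {a b a' b' : weylB d}
    (ha : a ∈ WEven d lam) (hb : b ∈ WOdd d lam) (ha' : a' ∈ WEven d lam) (hb' : b' ∈ WOdd d lam)
    (h : a * b = a' * b') : a = a' ∧ b = b' := by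
  have h1 : a'⁻¹ * a = b' * b⁻¹ := by
    rw [eq_mul_inv_iff_mul_eq, mul_assoc, h, inv_mul_cancel_left]
  have h2 := WEven_inf_WOdd hl (mul_mem (inv_mem ha') ha) (h1 ▸ mul_mem hb' (inv_mem hb))
  rw [inv_mul_eq_one] at h2
  subst h2
  exact ⟨rfl, mul_left_cancel h⟩

lemma exists_even_odd {lam : Comp m n} (hl : lam ∈ Lam m n d) {w : weylB d} (hw : w ∈ WW d lam) :
    ∃ w₀ ∈ WEven d lam, ∃ w₁ ∈ WOdd d lam, w = w₀ * w₁ := by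
  rw [mem_WW] at hw
  refine block_induction (lam := lam) (Q := fun _ => True)
    (p := fun w => ∃ w₀ ∈ WEven d lam, ∃ w₁ ∈ WOdd d lam, w = w₀ * w₁)
    ⟨1, one_mem _, 1, one_mem _, (mul_one 1).symm⟩ (fun k w hk _ _ _ ih => ?_) (fun _ => Iff.rfl)
    hw (fun x hx => absurd trivial hx)
  obtain ⟨w₀, h0, w₁, h1, rfl⟩ := ih
  by_cases hq : |bl lam (rootHi k)| ≤ m
  · exact ⟨simpleRefl k * w₀,
      mul_mem (Subgroup.subset_closure ⟨k, hk, (lt_psum_iff hl hk).2 hq, rfl⟩) h0, w₁, h1,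
      (mul_assoc _ _ _).symm⟩
  · have hs : simpleRefl k ∈ WOdd d lam :=
      Subgroup.subset_closure ⟨k, hk, (psum_lt_iff hl hk).2 (not_le.1 hq), rfl⟩
    refine ⟨w₀, h0, simpleRefl k * w₁, mul_mem hs h1, ?_⟩
    rw [← mul_assoc, ← mul_assoc, WEven_mul_comm hl h0 hs]

/-- For a shortest double coset representative `g`, the elements `y ∈ W_μ` which are shortest
representatives for `W_δ` are those for which `g y` is shortest in `W_λ g y`. -/
lemma mem_DDelta_iff {lam mu : Comp m n} {g y : weylB d}
    (hg : g ∈ DD d lam mu) (hy : y ∈ WW d mu) :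
    y ∈ DDelta d lam g mu ↔ LeftMin lam (g * y) := by
  constructor
  · intro h a b hab hbl
    refine weylB_lt_of_ascents (fun k hk => ?_) hab hbl
    by_contra hcon
    have hlt : (g * y)⁻¹.1 (rootHi k) < (g * y)⁻¹.1 (rootLo k) :=
      lt_of_le_of_ne (not_lt.1 hcon) (apply_root_ne _ k).symm
    have hlen := len_simple_mul' (g * y) k hlt
    rw [mul_inv_rev, mul_val_apply, mul_val_apply] at hlt
    have hg1 := DD_left hg (rootLo_lt_rootHi k) ((isGen_iff lam k).1 hk)
    have hyW := (mem_WW _ _).1 (inv_mem hy)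
    -- `g⁻¹` keeps the order of the root pair, while `y⁻¹`, which respects the `μ`-blocks, reverses
    -- the order of the two preimages; they must share a block.
    have hmu : bl mu (g⁻¹.1 (rootLo k)) = bl mu (g⁻¹.1 (rootHi k)) := by
      apply le_antisymm (bl_mono mu hg1.le)
      rw [← hyW, ← hyW (g⁻¹.1 (rootLo k))]
      exact bl_mono mu hlt.le
    have hr : g⁻¹ * simpleRefl k * g ∈ WW d mu := by
      rw [mem_WW]
      intro x
      rw [mul_val_apply, mul_val_apply, simpleRefl_val]
      have hneg : ∀ i, reflPerm k (-i) = -reflPerm k i := (reflPerm_mem k.2).1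
      have e : ∀ {z}, g.1 x = z → x = g⁻¹.1 z := fun h => ((inv_val_eq_iff g _ _).2 h.symm).symm
      by_cases h1 : g.1 x = rootLo k
      · rw [h1, reflPerm_rootLo, ← hmu, e h1]
      by_cases h2 : g.1 x = rootHi k
      · rw [h2, reflPerm_rootHi, hmu, e h2]
      by_cases h3 : g.1 x = -rootLo k
      · rw [h3, hneg, reflPerm_rootLo, weylB_neg, bl_neg, ← hmu, e h3, weylB_neg, bl_neg]
      by_cases h4 : g.1 x = -rootHi k
      · rw [h4, hneg, reflPerm_rootHi, weylB_neg, bl_neg, hmu, e h4, weylB_neg, bl_neg]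
      rw [reflPerm_eq_self h1 h2 h3 h4, inv_val_apply_val]
    -- The conjugated reflection lies in `W_δ`. Lengths add in `g` times an element of `W_μ`, so
    -- shortening `g y` by `s_k` would shorten `y` in its coset `W_δ y`.
    have h5 := h (g⁻¹ * simpleRefl k * g) (by
      rw [show g * (g⁻¹ * simpleRefl k * g) * g⁻¹ = simpleRefl k by group]
      exact Subgroup.subset_closure ⟨k, hk, rfl⟩) hr
    have h6 := len_mul_of_leftMin_inv (mul_mem hr hy) (DD.leftMin_inv hg)
    have h7 := len_mul_of_leftMin_inv hy (DD.leftMin_inv hg)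
    rw [show g * (g⁻¹ * simpleRefl k * g * y) = simpleRefl k * (g * y) by group] at h6
    omega
  · intro h x hx1 hx2
    have h6 := len_mul_of_leftMin_inv (mul_mem hx2 hy) (DD.leftMin_inv hg)
    have h7 := len_mul_of_leftMin_inv hy (DD.leftMin_inv hg)
    have h8 := len_mul_of_leftMin hx1 h
    rw [show g * x * g⁻¹ * (g * y) = g * (x * y) by group] at h8
    omega

/-- Among the factorizations `w = x g y` one takes `y` shortest: a factor of `y` in `W_δ` can be
moved across `g` into `W_λ`. -/
lemma exists_DDelta_decomp {lam mu : Comp m n} (hl : lam ∈ Lam m n d) (hm : mu ∈ Lam m n d)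
    {g w : weylB d} (h : kappa lam w mu = kappa lam g mu) :
    ∃ x ∈ WW d lam, ∃ y ∈ WW d mu, y ∈ DDelta d lam g mu ∧ w = x * (g * y) := by
  obtain ⟨y, ⟨hy, x, hx, hw⟩, hmin⟩ := Set.exists_min_image
    {y : weylB d | y ∈ WW d mu ∧ ∃ x ∈ WW d lam, w = x * (g * y)} len (Set.toFinite _) (by
      obtain ⟨x, hx, y, hy, hw⟩ := exists_of_kappa_eq hl hm h.symm
      exact ⟨y, hy, x, hx, by rw [hw, mul_assoc]⟩)
  refine ⟨x, hx, y, hy, fun z hz1 hz2 => hmin _ ⟨mul_mem hz2 hy, x * (g * z * g⁻¹)⁻¹,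
    mul_mem hx (inv_mem hz1), ?_⟩, hw⟩
  rw [hw]; group

/-- With `z = x'⁻¹ x` additivity of lengths gives `ℓ(u') = ℓ(z) + ℓ(u)` and, for `z⁻¹`, `ℓ(u) = ℓ(z)
+ ℓ(u')`; so `ℓ(z) = 0`. -/
lemma leftMin_unique {lam : Comp m n} {x x' u u' : weylB d} (hx : x ∈ WW d lam)
    (hx' : x' ∈ WW d lam) (hu : LeftMin lam u) (hu' : LeftMin lam u') (h : x * u = x' * u') :
    x = x' ∧ u = u' := by
  have h1 : x'⁻¹ * x * u = u' := by rw [mul_assoc, h, inv_mul_cancel_left]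
  have h2 : (x'⁻¹ * x)⁻¹ * u' = u := by rw [← h1, inv_mul_cancel_left]
  have h3 := len_mul_of_leftMin (mul_mem (inv_mem hx') hx) hu
  have h4 := len_mul_of_leftMin (inv_mem (mul_mem (inv_mem hx') hx)) hu'
  rw [h1] at h3
  rw [h2] at h4
  have h5 := len_eq_zero (show len (x'⁻¹ * x) = 0 by omega)
  rw [inv_mul_eq_one] at h5
  subst h5
  exact ⟨rfl, mul_left_cancel h⟩

/-- An eigenvector coefficient function on a double coset is determined by its value at the
shortest element. -/
lemma step_eq {lam mu : Comp m n} (hl : lam ∈ Lam m n d) (hm : mu ∈ Lam m n d)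
    {f : weylB d → Lau} (hf : LeftStep lam f) (hf' : RightStep mu f) {g : weylB d}
    (hg : g ∈ DD d lam mu) {x₀ x₁ y₀ y₁ : weylB d} (hx0 : x₀ ∈ WEven d lam)
    (hx1 : x₁ ∈ WOdd d lam) (hy0 : y₀ ∈ WEven d mu) (hy1 : y₁ ∈ WOdd d mu)
    (hy : y₀ * y₁ ∈ DDelta d lam g mu) :
    f (x₀ * x₁ * (g * (y₀ * y₁))) = negQ (len x₁) * negQ (len y₁) * f g := by
  have hyW : y₀ * y₁ ∈ WW d mu := mul_mem (WEven_le d mu hy0) (WOdd_le d mu hy1)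
  rw [hf.mul_mul hl hx0 hx1 ((mem_DDelta_iff hg hyW).1 hy), mul_assoc]
  congr 1
  have h1 := hf'.inv.mul_mul hm (inv_mem hy0) (inv_mem hy1) (DD.leftMin_inv hg)
  simp only [inv_inv, len_inv] at h1
  rw [← h1]
  congr 1
  rw [mul_inv_rev, inv_inv, mul_inv_rev, inv_inv, inv_inv, WEven_mul_comm hm hy0 hy1]

lemma cosetFun_DD {lam mu : Comp m n} {g : weylB d} (hg : g ∈ DD d lam mu) :
    cosetFun d lam mu (kappa lam g mu) g = 1 := by
  rw [cosetFun, if_pos rfl, oddLen_eq_zero_of_DD hg, negQ_zero]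

-- Lengths add in `w₀ w₁`: the inversions of `w₁⁻¹` lie inside odd blocks, where `w₀` is the
-- identity.
open Classical in
lemma xy_eq_sum {lam : Comp m n} (hl : lam ∈ Lam m n d) :
    xy d lam = ∑ x : WEven d lam × WOdd d lam, negQ (len x.2.1) • TT (x.1.1 * x.2.1) := by
  rw [xy, Finset.sum_mul_sum, ← Finset.sum_product', Finset.univ_product_univ]
  refine Finset.sum_congr rfl fun x _ => ?_
  rw [mul_smul_comm, TT_mul]
  · rfl
  · refine len_mul_of_inv _ _ fun a b hab hba => ?_
    have h0 := (mem_WEven hl _).1 x.1.2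
    have h1 := (mem_WOdd hl _).1 (inv_mem x.2.2)
    by_contra hcon
    rcases (bl_mono lam hab.le).lt_or_eq with h2 | h2
    · have := bl_mono lam hba.le
      rw [h1.1, h1.1] at this
      omega
    · by_cases h3 : |bl lam a| ≤ m
      · rw [h1.2 a h3, h1.2 b (by rwa [← h2])] at hba
        omega
      · rw [not_le] at h3
        rw [h0.2 a h3, h0.2 b (by rwa [← h2])] at hcon
        omega

/-- The element `T_{W_λ g W_μ}` in the basis `T_w`. -/
theorem TDouble_eq {lam mu : Comp m n} (hl : lam ∈ Lam m n d) (hm : mu ∈ Lam m n d)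
    {g : weylB d} (hg : g ∈ DDo d lam mu) :
    TDouble lam g mu = cosetElt d lam mu (kappa lam g mu) := by
  classical
  have hg' := hg.1
  have hA : ∀ i j : ℤ, ¬ (|i| ≤ m ↔ |j| ≤ m) → kappa lam g mu i j ≤ 1 := fun i j =>
    kappa_le_one_of_DDo hl hm hg
  have hf := leftStep_cosetFun hl hm (d := d) (kappa lam g mu)
  have hf' := rightStep_cosetFun hl hm (d := d) hA
  set S : Finset ((WEven d lam × WOdd d lam) × (WEven d mu × WOdd d mu)) :=
    Finset.univ.filter fun p => p.2.1.1 * p.2.2.1 ∈ DDelta d lam g mu with hS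
  -- Lengths add in all products that occur, so each term is a multiple of one `T_w`, and by
  -- `step_eq` the scalar is the value of the coset function.
  have h1 : TDouble lam g mu = ∑ p ∈ S,
      cosetFun d lam mu (kappa lam g mu) (p.1.1.1 * p.1.2.1 * (g * (p.2.1.1 * p.2.2.1))) •
        TT (p.1.1.1 * p.1.2.1 * (g * (p.2.1.1 * p.2.2.1))) := by
    have h2 : TDelta lam g mu = ∑ y : WEven d mu × WOdd d mu,
        if y.1.1 * y.2.1 ∈ DDelta d lam g mu then negQ (len y.2.1) • TT (y.1.1 * y.2.1)
          else 0 := by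
      rw [TDelta, ← Finset.sum_product', Finset.univ_product_univ]
      rfl
    rw [TDouble, h2, xy_eq_sum hl, Finset.sum_mul, Finset.sum_mul_sum, ← Finset.sum_product',
      Finset.univ_product_univ, hS, Finset.sum_filter]
    refine Finset.sum_congr rfl fun p _ => ?_
    split_ifs with hp
    · have hyW : p.2.1.1 * p.2.2.1 ∈ WW d mu :=
        mul_mem (WEven_le d mu p.2.1.2) (WOdd_le d mu p.2.2.2)
      have hxW : p.1.1.1 * p.1.2.1 ∈ WW d lam :=
        mul_mem (WEven_le d lam p.1.1.2) (WOdd_le d lam p.1.2.2)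
      rw [step_eq hl hm hf hf' hg' p.1.1.2 p.1.2.2 p.2.1.2 p.2.2.2 hp, cosetFun_DD hg', mul_one,
        smul_mul_assoc, smul_mul_assoc, mul_smul_comm, smul_smul, mul_assoc (TT _) (TT g),
        TT_mul _ _ (len_mul_of_leftMin_inv hyW (DD.leftMin_inv hg')),
        TT_mul _ _ (len_mul_of_leftMin hxW ((mem_DDelta_iff hg' hyW).1 hp))]
    · rw [mul_zero]
  have h3 : cosetElt d lam mu (kappa lam g mu) =
      ∑ w ∈ Finset.univ.filter fun w : weylB d => kappa lam w mu = kappa lam g mu,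
        cosetFun d lam mu (kappa lam g mu) w • TT w := by
    rw [Finset.sum_filter, cosetElt]
    refine Finset.sum_congr rfl fun w _ => ?_
    rw [cosetFun]
    split_ifs
    · rfl
    · rw [zero_smul]
  rw [h1, h3]
  -- Every element of the double coset is uniquely `x g y` with `x ∈ W_λ` and `y ∈ D_δ ∩ W_μ`, and
  -- `x`, `y` split uniquely into even and odd parts.
  refine Finset.sum_bij (fun p _ => p.1.1.1 * p.1.2.1 * (g * (p.2.1.1 * p.2.2.1))) ?_ ?_ ?_ ?_
  · intro p _
    rw [Finset.mem_filter]
    refine ⟨Finset.mem_univ _, ?_⟩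
    rw [← mul_assoc]
    exact kappa_mul_mul hl hm (mul_mem (WEven_le d lam p.1.1.2) (WOdd_le d lam p.1.2.2))
      (mul_mem (WEven_le d mu p.2.1.2) (WOdd_le d mu p.2.2.2)) g
  · rintro ⟨⟨x0, x1⟩, ⟨y0, y1⟩⟩ hp ⟨⟨x0', x1'⟩, ⟨y0', y1'⟩⟩ hp' he
    rw [hS, Finset.mem_filter] at hp hp'
    have hyW : y0.1 * y1.1 ∈ WW d mu := mul_mem (WEven_le d mu y0.2) (WOdd_le d mu y1.2)
    have hyW' : y0'.1 * y1'.1 ∈ WW d mu := mul_mem (WEven_le d mu y0'.2) (WOdd_le d mu y1'.2)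
    obtain ⟨e1, e2⟩ := leftMin_unique (mul_mem (WEven_le d lam x0.2) (WOdd_le d lam x1.2))
      (mul_mem (WEven_le d lam x0'.2) (WOdd_le d lam x1'.2))
      ((mem_DDelta_iff hg' hyW).1 hp.2) ((mem_DDelta_iff hg' hyW').1 hp'.2) he
    obtain ⟨e3, e4⟩ := WEven_WOdd_unique hl x0.2 x1.2 x0'.2 x1'.2 e1
    obtain ⟨e5, e6⟩ := WEven_WOdd_unique hm y0.2 y1.2 y0'.2 y1'.2 (mul_left_cancel e2)
    simp only [Prod.mk.injEq]
    exact ⟨⟨Subtype.ext e3, Subtype.ext e4⟩, Subtype.ext e5, Subtype.ext e6⟩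
  · intro w hw
    rw [Finset.mem_filter] at hw
    obtain ⟨x, hx, y, hy, hyD, rfl⟩ := exists_DDelta_decomp hl hm hw.2
    obtain ⟨x0, hx0, x1, hx1, rfl⟩ := exists_even_odd hl hx
    obtain ⟨y0, hy0, y1, hy1, rfl⟩ := exists_even_odd hm hy
    exact ⟨⟨⟨⟨x0, hx0⟩, ⟨x1, hx1⟩⟩, ⟨⟨y0, hy0⟩, ⟨y1, hy1⟩⟩⟩, by
      rw [hS, Finset.mem_filter]; exact ⟨Finset.mem_univ _, hyD⟩, rfl⟩
  · intro p _
    rfl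

lemma kappa_one {lam : Comp m n} (hl : lam ∈ Lam m n d) {i j : ℤ} (h : i ≠ j) :
    kappa lam (1 : weylB d) lam i j = 0 := by
  rw [kappa_apply hl hl, Finset.card_eq_zero, Finset.filter_eq_empty_iff]
  rintro x - ⟨h1, h2⟩
  exact h (h2.symm.trans h1)

lemma one_mem_DDo {lam : Comp m n} (hl : lam ∈ Lam m n d) : (1 : weylB d) ∈ DDo d lam lam := by
  refine DDo_of_kappa_le_one hl hl (fun x _ y _ => by rw [len_one]; exact Nat.zero_le _)
    fun i j hij => ?_
  rw [kappa_one hl]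
  · exact Nat.zero_le _
  · rintro rfl; exact hij Iff.rfl

/-- For `g = 1` and `μ = λ` the group `W_δ` is all of `W_λ`, so the only term is that of `1`. -/
lemma TDelta_one {lam : Comp m n} (hl : lam ∈ Lam m n d) :
    TDelta lam (1 : weylB d) lam = 1 := by
  classical
  rw [TDelta, Finset.sum_eq_single 1, Finset.sum_eq_single 1, if_pos]
  · simp [len_one, TT_one]
  · intro x _ _
    simp [len_one]
  · intro b _ hb
    refine if_neg fun h => hb ?_
    have hbW := WOdd_le d lam b.2
    rw [OneMemClass.coe_one, one_mul] at h
    have h1 := h b.1⁻¹ (by simpa using hbW) (inv_mem hbW)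
    rw [inv_mul_cancel, len_one, Nat.le_zero] at h1
    exact Subtype.ext (len_eq_zero h1)
  · simp
  · intro a _ ha
    refine Finset.sum_eq_zero fun b _ => if_neg fun h => ha ?_
    have hbW := mul_mem (WEven_le d lam a.2) (WOdd_le d lam b.2)
    have h1 := h (a.1 * b.1)⁻¹ (by simpa using inv_mem hbW) (inv_mem hbW)
    rw [inv_mul_cancel, len_one, Nat.le_zero] at h1
    have h2 := len_eq_zero h1
    rw [← one_mul (1 : weylB d)] at h2
    exact Subtype.ext (WEven_WOdd_unique hl a.2 b.2 (one_mem _) (one_mem _) h2).1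
  · simp

lemma xy_eq_cosetElt {lam : Comp m n} (hl : lam ∈ Lam m n d) :
    xy d lam = cosetElt d lam lam (kappa lam (1 : weylB d) lam) := by
  rw [← TDouble_eq hl hl (one_mem_DDo hl), TDouble, TT_one, TDelta_one hl, mul_one, mul_one]

/-! ### Spaces of eigenvectors -/

lemma isLeftEig_cosetElt {lam mu : Comp m n} (hl : lam ∈ Lam m n d) (hm : mu ∈ Lam m n d)
    (A : ℤ → ℤ → ℕ) : IsLeftEig lam (cosetElt d lam mu A) := by
  rw [isLeftEig_iff, coef_cosetElt]; exact leftStep_cosetFun hl hm A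

lemma isRightEig_cosetElt {lam mu : Comp m n} (hl : lam ∈ Lam m n d) (hm : mu ∈ Lam m n d)
    {A : ℤ → ℤ → ℕ} (hA : ∀ i j : ℤ, ¬ (|i| ≤ m ↔ |j| ≤ m) → A i j ≤ 1) :
    IsRightEig mu (cosetElt d lam mu A) := by
  rw [isRightEig_iff, coef_cosetElt]; exact rightStep_cosetFun hl hm hA

lemma isLeftEig_xy {lam : Comp m n} (hl : lam ∈ Lam m n d) : IsLeftEig lam (xy d lam) := by
  rw [xy_eq_cosetElt hl]; exact isLeftEig_cosetElt hl hl _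

lemma isRightEig_xy {lam : Comp m n} (hl : lam ∈ Lam m n d) : IsRightEig lam (xy d lam) := by
  rw [xy_eq_cosetElt hl]
  exact isRightEig_cosetElt hl hl fun i j => kappa_le_one_of_DDo hl hl (one_mem_DDo hl)

lemma negQ_ne_one {N : ℕ} (hN : N ≠ 0) : negQ N ≠ 1 := by
  intro h
  -- At `v = 2` the absolute value is `2^(-2N)`, which differs from 1.
  have h1 := congrArg (LaurentPolynomial.eval₂ (Int.castRingHom ℚ) (Units.mk0 2 two_ne_zero)) h
  rw [negQ, map_mul, map_pow, map_neg, map_one, LaurentPolynomial.eval₂_T] at h1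
  have h2 := congrArg (fun x : ℚ => |x|) h1
  simp only [abs_mul, abs_pow, abs_neg, abs_one, one_pow, one_mul, Units.val_zpow_eq_zpow_val,
    Units.val_mk0, abs_zpow, abs_two] at h2
  rw [zpow_eq_one_iff_right₀ (by norm_num) (by norm_num)] at h2
  omega

/-- A coefficient function with both eigenvector properties vanishes on the double cosets which
violate the even-odd trivial intersection property. -/
lemma step_eq_zero {lam mu : Comp m n} (hl : lam ∈ Lam m n d) (hm : mu ∈ Lam m n d)
    {f : weylB d → Lau} (hf : LeftStep lam f) (hf' : RightStep mu f) {g : weylB d}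
    (hg : g ∈ DD d lam mu) (hno : g ∉ DDo d lam mu) : f g = 0 := by
  have key : ∀ N : ℕ, N ≠ 0 → f g = negQ N * f g → f g = 0 := by
    intro N hN h
    have h1 : (1 - negQ N) * f g = 0 := by linear_combination h
    rcases mul_eq_zero.1 h1 with h2 | h2
    · exact absurd (sub_eq_zero.1 h2).symm (negQ_ne_one hN)
    · exact h2
  have hex : ∃ i j : ℤ, ¬ (|i| ≤ m ↔ |j| ≤ m) ∧ 1 < kappa lam g mu i j := by
    by_contra hcon
    exact hno (DDo_of_kappa_le_one hl hm hg fun i j hij => not_lt.1 fun h => hcon ⟨i, j, hij, h⟩)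
  obtain ⟨i, j, hij, h1⟩ := hex
  obtain ⟨r, hr, h2⟩ := exists_mixed_refl hl hm g hij h1
  -- The value at `(g r g⁻¹) g = g r` is computed from the left and from the right. The even side
  -- gives `f g`, the odd side a factor `(-q)^(-N)` with `N ≠ 0`.
  have e : g * r * g⁻¹ * g = g * r := by group
  have hgL : LeftMin lam g := DD.leftMin hg
  have hgR := DD.leftMin_inv hg
  have hr' : len r ≠ 0 := fun h => hr (len_eq_zero h)
  have hrc : len (g * r * g⁻¹) ≠ 0 := fun h => hr (by
    have := len_eq_zero h
    rwa [conj_eq_one_iff] at this)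
  rcases h2 with ⟨h2, h3⟩ | ⟨h2, h3⟩
  · have h4 := hf.mul_odd hl h2 fun a b hab h _ => hgL a b hab h
    have h5 := hf'.inv.mul_even hm (inv_mem h3) fun a b hab h _ => hgR a b hab h
    rw [e] at h4
    rw [← mul_inv_rev, inv_inv, inv_inv] at h5
    rw [h5] at h4
    exact key _ hrc h4
  · have h4 := hf.mul_even hl h2 fun a b hab h _ => hgL a b hab h
    have h5 := hf'.inv.mul_odd hm (inv_mem h3) fun a b hab h _ => hgR a b hab h
    rw [e] at h4
    rw [← mul_inv_rev, inv_inv, inv_inv, len_inv, h4] at h5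
    exact key _ hr' h5

/-- The coefficients of an element with both eigenvector properties. -/
lemma step_eq_cosetFun {lam mu : Comp m n} (hl : lam ∈ Lam m n d) (hm : mu ∈ Lam m n d)
    {f : weylB d → Lau} (hf : LeftStep lam f) (hf' : RightStep mu f) {g : weylB d}
    (hg : g ∈ DD d lam mu) (w : weylB d) (hw : kappa lam w mu = kappa lam g mu) :
    f w = f g * cosetFun d lam mu (kappa lam g mu) w := by
  obtain ⟨x, hx, y, hy, hyD, rfl⟩ := exists_DDelta_decomp hl hm hw
  obtain ⟨x0, hx0, x1, hx1, rfl⟩ := exists_even_odd hl hx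
  obtain ⟨y0, hy0, y1, hy1, rfl⟩ := exists_even_odd hm hy
  rw [step_eq hl hm hf hf' hg hx0 hx1 hy0 hy1 hyD]
  by_cases hgo : g ∈ DDo d lam mu
  · rw [step_eq hl hm (leftStep_cosetFun hl hm _) (rightStep_cosetFun hl hm fun i j =>
      kappa_le_one_of_DDo hl hm hgo) hg hx0 hx1 hy0 hy1 hyD, cosetFun_DD hg, mul_one, mul_comm]
  · rw [step_eq_zero hl hm hf hf' hg hgo, mul_zero, zero_mul]

/-- A right eigenvector is a left multiple of `[xy]_μ`. -/
lemma exists_mul_xy {mu : Comp m n} (hm : mu ∈ Lam m n d) {z : Hecke d} (hz : IsRightEig mu z) :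
    ∃ h : Hecke d, z = h * xy d mu := by
  classical
  -- A right eigenvector is determined by its coefficients at the shortest representatives of the
  -- cosets `w W_μ`: any other element is reached by descending along generators.
  have huniq : ∀ f : weylB d → Lau, RightStep mu f → (∀ w, LeftMin mu w⁻¹ → f w = 0) → f = 0 := by
    intro f hf h0
    funext w
    obtain ⟨N, hN⟩ : ∃ N, len w = N := ⟨_, rfl⟩
    induction N using Nat.strong_induction_on generalizing w with
    | _ N ih =>
      by_cases hw : ∀ k : Fin d, IsGen mu k → w.1 (rootLo k) < w.1 (rootHi k)
      · refine h0 w fun a b hab hbl => ?_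
        rw [inv_inv]
        exact weylB_lt_of_ascents hw hab hbl
      · push Not at hw
        obtain ⟨k, hk, hlt⟩ := hw
        have h1 := len_mul_simple' w k (lt_of_le_of_ne hlt (apply_root_ne w k).symm)
        have h2 := hf k hk (w * simpleRefl k) (by rw [mul_simple_mul_simple]; omega)
        have h3 : f (w * simpleRefl k) = 0 := ih _ (by omega) _ rfl
        rw [mul_simple_mul_simple, h3, mul_zero] at h2
        exact h2
  -- The truncation of `z` to the shortest representatives. As `[xy]_μ` has coefficient 1 at `T_1`
  -- and is supported on `W_μ`, the product `h [xy]_μ` agrees with `z` at these representatives.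
  set h : Hecke d := ∑ w ∈ Finset.univ.filter fun w : weylB d => LeftMin mu w⁻¹,
    coef z w • TT w with hh
  have hxy : xy d mu = ∑ x ∈ Finset.univ.filter fun x : weylB d => x ∈ WW d mu,
      cosetFun d mu mu (kappa mu (1 : weylB d) mu) x • TT x := by
    rw [xy_eq_cosetElt hm, cosetElt, Finset.sum_filter]
    refine Finset.sum_congr rfl fun x _ => ?_
    split_ifs with hx
    · rfl
    · rw [cosetFun, if_neg, zero_smul]
      intro hk
      obtain ⟨a, ha, b, hb, he⟩ := exists_of_kappa_eq hm hm hk.symm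
      apply hx
      rw [he, mul_one]
      exact mul_mem ha hb
  refine ⟨h, coef_injective ?_⟩
  rw [← sub_eq_zero, ← map_sub]
  refine huniq _ ((isRightEig_iff mu _).1 fun k hk => ?_) fun u hu => ?_
  · rw [sub_mul, hz k hk, mul_assoc, isRightEig_xy hm k hk, mul_smul_comm, smul_sub]
  · have h1 : coef (h * xy d mu) u = ∑ w ∈ Finset.univ.filter fun w : weylB d => LeftMin mu w⁻¹,
        ∑ x ∈ Finset.univ.filter fun x : weylB d => x ∈ WW d mu,
          coef z w * cosetFun d mu mu (kappa mu (1 : weylB d) mu) x *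
            if u = w * x then 1 else 0 := by
      rw [hh, hxy, Finset.sum_mul_sum, map_sum, Finset.sum_apply]
      refine Finset.sum_congr rfl fun w hw => ?_
      rw [map_sum, Finset.sum_apply]
      refine Finset.sum_congr rfl fun x hx => ?_
      rw [Finset.mem_filter] at hw hx
      rw [smul_mul_assoc, mul_smul_comm, smul_smul, map_smul, Pi.smul_apply, smul_eq_mul,
        TT_mul _ _ (len_mul_of_leftMin_inv hx.2 hw.2), coef_TT_apply]
    have h2 : ∀ w, LeftMin mu w⁻¹ → ∀ x ∈ WW d mu, u = w * x → w = u ∧ x = 1 := by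
      intro w hw x hx he
      have h3 : x⁻¹ * w⁻¹ = 1 * u⁻¹ := by rw [one_mul, he, mul_inv_rev]
      have h4 := leftMin_unique (inv_mem hx) (one_mem _) hw hu h3
      exact ⟨inv_injective h4.2, inv_eq_one.1 h4.1⟩
    rw [map_sub, Pi.sub_apply, h1, Finset.sum_eq_single u, Finset.sum_eq_single 1]
    · rw [mul_one, if_pos rfl, cosetFun_DD (one_mem_DDo hm).1]
      ring
    · intro x hx hx1
      rw [Finset.mem_filter] at hx
      rw [if_neg, mul_zero]
      intro he
      exact hx1 (h2 u hu x hx.2 he).2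
    · intro hc
      exact absurd (Finset.mem_filter.2 ⟨Finset.mem_univ _, one_mem _⟩) hc
    · intro w hw hwu
      rw [Finset.mem_filter] at hw
      refine Finset.sum_eq_zero fun x hx => ?_
      rw [Finset.mem_filter] at hx
      rw [if_neg, mul_zero]
      intro he
      exact hwu (h2 w hw.2 x hx.2 he).1
    · intro hc
      exact absurd (Finset.mem_filter.2 ⟨Finset.mem_univ u, hu⟩) hc

end

end

end IotaSchur

namespace IotaSchur

noncomputable section

/-! ### Homomorphisms between permutation modules -/

section

variable {m n d : ℕ}

lemma finite_Lam (m n d : ℕ) : (Lam m n d).Finite := by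
  refine (Set.finite_Iic (fun _ : Fin (m + n + 1) => d)).subset fun lam hl i => ?_
  have h : ∑ i, lam i = d := hl
  rw [← h]
  exact Finset.single_le_sum (fun _ _ => Nat.zero_le _) (Finset.mem_univ i)

lemma finite_Xi (m n d : ℕ) : (Xi m n d).Finite := by
  have h : ((Lam m n d ×ˢ (Set.univ : Set (weylB d)) ×ˢ Lam m n d).image
      fun p => kappa p.1 p.2.1 p.2.2).Finite :=
    ((finite_Lam m n d).prod (Set.finite_univ.prod (finite_Lam m n d))).image _
  refine h.subset fun A hA => ?_
  obtain ⟨w, hw⟩ := exists_kappa_eq hA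
  exact ⟨(rowW m n A, w, colW m n A), ⟨rowW_mem hA, trivial, colW_mem hA⟩, hw⟩

instance (m n d : ℕ) (P : Set (Comp m n)) : Fintype (XiOf m n d P) :=
  ((finite_Xi m n d).subset fun _ h => h.1).fintype

lemma Xi_le_one {A : ℤ → ℤ → ℕ} (hA : A ∈ Xi m n d) (i j : ℤ) (hij : ¬ (|i| ≤ m ↔ |j| ≤ m)) :
    A i j ≤ 1 := by
  have := hA.2.2.2 i j hij
  omega

lemma exists_DDo {A : ℤ → ℤ → ℕ} (hA : A ∈ Xi m n d) :
    ∃ g ∈ DDo d (rowW m n A) (colW m n A), kappa (rowW m n A) g (colW m n A) = A := by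
  obtain ⟨w, hw⟩ := exists_kappa_eq hA
  obtain ⟨g, hg, hgw⟩ := exists_DD_kappa_eq (rowW_mem hA) (colW_mem hA) w
  rw [hw] at hgw
  refine ⟨g, DDo_of_kappa_le_one (rowW_mem hA) (colW_mem hA) hg ?_, hgw⟩
  rw [hgw]
  exact Xi_le_one hA

open Classical in
/-- The shortest element of the double coset which belongs to `A`. -/
def minRep (m n d : ℕ) (A : ℤ → ℤ → ℕ) : weylB d :=
  if h : A ∈ Xi m n d then (exists_DDo h).choose else 1

lemma minRep_mem {A : ℤ → ℤ → ℕ} (hA : A ∈ Xi m n d) :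
    minRep m n d A ∈ DDo d (rowW m n A) (colW m n A) := by
  rw [minRep, dif_pos hA]; exact (exists_DDo hA).choose_spec.1

lemma kappa_minRep {A : ℤ → ℤ → ℕ} (hA : A ∈ Xi m n d) :
    kappa (rowW m n A) (minRep m n d A) (colW m n A) = A := by
  rw [minRep, dif_pos hA]; exact (exists_DDo hA).choose_spec.2

lemma cosetFun_minRep {A B : ℤ → ℤ → ℕ} (hA : A ∈ Xi m n d) [Decidable (B = A)] :
    cosetFun d (rowW m n A) (colW m n A) B (minRep m n d A) = if B = A then 1 else 0 := by
  split_ifs with h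
  · subst h
    have := cosetFun_DD (minRep_mem hA).1
    rwa [kappa_minRep hA] at this
  · rw [cosetFun, if_neg]
    rw [kappa_minRep hA]
    exact fun h' => h h'.symm

open Classical in
/-- An element is determined by its coefficients at the shortest elements of double cosets, if it
is an eigenvector on both sides. -/
theorem coef_eq_of_eig {lam mu : Comp m n} (hl : lam ∈ Lam m n d) (hm : mu ∈ Lam m n d)
    {z : Hecke d} (hz : IsLeftEig lam z) (hz' : IsRightEig mu z) (w : weylB d) :
    coef z w = if kappa lam w mu ∈ Xi m n d then
      coef z (minRep m n d (kappa lam w mu)) * cosetFun d lam mu (kappa lam w mu) w else 0 := by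
  rw [isLeftEig_iff] at hz
  rw [isRightEig_iff] at hz'
  split_ifs with hA
  · have h1 := minRep_mem hA
    have h2 := kappa_minRep hA
    rw [rowW_kappa hl hm, colW_kappa hl hm] at h1 h2
    rw [step_eq_cosetFun hl hm hz hz' h1.1 w h2.symm, h2]
  · obtain ⟨g, hg, hgw⟩ := exists_DD_kappa_eq hl hm w
    rw [step_eq_cosetFun hl hm hz hz' hg w hgw.symm, step_eq_zero hl hm hz hz' hg, zero_mul]
    intro hgo
    exact hA (kappa_mem_Xi hl hm w fun i j hij => hgw ▸ kappa_le_one_of_DDo hl hm hgo hij)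

-- Each `w` belongs to a single matrix, so only one summand contributes to its coefficient; the
-- expansion coefficients are therefore those of `z` at the shortest elements.
open Classical in
theorem eig_expansion {lam mu : Comp m n} (hl : lam ∈ Lam m n d) (hm : mu ∈ Lam m n d)
    {z : Hecke d} (hz : IsLeftEig lam z) (hz' : IsRightEig mu z) :
    z = ∑ A ∈ (finite_Xi m n d).toFinset, if rowW m n A = lam ∧ colW m n A = mu then
      coef z (minRep m n d A) • cosetElt d lam mu A else 0 := by
  refine coef_injective (funext fun w => ?_)
  rw [coef_eq_of_eig hl hm hz hz', map_sum, Finset.sum_apply]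
  have hterm : ∀ A, coef (if rowW m n A = lam ∧ colW m n A = mu then
      coef z (minRep m n d A) • cosetElt d lam mu A else 0) w =
      if kappa lam w mu = A then coef z (minRep m n d A) * cosetFun d lam mu A w else 0 := by
    intro A
    by_cases h : kappa lam w mu = A
    · subst h
      rw [if_pos ⟨rowW_kappa hl hm w, colW_kappa hl hm w⟩, if_pos rfl, map_smul, coef_cosetElt,
        Pi.smul_apply, smul_eq_mul]
    · rw [if_neg h]
      split_ifs
      · rw [map_smul, coef_cosetElt, Pi.smul_apply, cosetFun, if_neg h, smul_zero]
      · rw [map_zero, Pi.zero_apply]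
  simp only [hterm]
  classical
  rw [Finset.sum_ite_eq]
  simp only [Set.Finite.mem_toFinset]

lemma mem_xyMod {mu : Comp m n} {x : Hecke d} : x ∈ xyMod d mu ↔ ∃ h, x = xy d mu * h := by
  rw [Submodule.mem_span_singleton]
  constructor
  · rintro ⟨a, rfl⟩
    exact ⟨a.unop, rfl⟩
  · rintro ⟨h, rfl⟩
    exact ⟨MulOpposite.op h, rfl⟩

lemma smul_mem_xyMod {mu : Comp m n} {x : Hecke d} (hx : x ∈ xyMod d mu) (c : Lau) :
    c • x ∈ xyMod d mu := by
  obtain ⟨h, rfl⟩ := mem_xyMod.1 hx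
  exact mem_xyMod.2 ⟨c • h, (mul_smul_comm _ _ _).symm⟩

/-- By `TDouble_eq` each basis eigenvector is a product that starts with `[xy]_λ`. -/
lemma mem_xyMod_of_eig {lam mu : Comp m n} (hl : lam ∈ Lam m n d) (hm : mu ∈ Lam m n d)
    {z : Hecke d} (hz : IsLeftEig lam z) (hz' : IsRightEig mu z) : z ∈ xyMod d lam := by
  rw [eig_expansion hl hm hz hz']
  refine Submodule.sum_mem _ fun A hA => ?_
  rw [Set.Finite.mem_toFinset] at hA
  split_ifs with h
  · obtain ⟨rfl, rfl⟩ := h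
    refine smul_mem_xyMod ?_ _
    have := TDouble_eq hl hm (minRep_mem hA)
    rw [kappa_minRep hA] at this
    rw [← this, TDouble, mul_assoc]
    exact mem_xyMod.2 ⟨_, rfl⟩
  · exact zero_mem _

lemma isLeftEig_of_mem {mu : Comp m n} (hm : mu ∈ Lam m n d) {x : Hecke d}
    (hx : x ∈ xyMod d mu) : IsLeftEig mu x := by
  obtain ⟨h, rfl⟩ := mem_xyMod.1 hx
  intro k hk
  rw [← mul_assoc, isLeftEig_xy hm k hk, smul_mul_assoc]

variable {P : Set (Comp m n)}

/-- The component `[xy]_λ 𝓗 → [xy]_μ 𝓗` of `f`, evaluated at `[xy]_λ`. -/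
def genEntry (lam mu : P) : Schur d P →ₗ[Lau] Hecke d where
  toFun f := entry f lam mu (xyGen d lam.1)
  map_add' _ _ := rfl
  map_smul' _ _ := rfl

lemma entry_smul (f : Schur d P) (lam mu : P) (x : xyMod d lam.1) (h : Hecke d) :
    entry f lam mu (MulOpposite.op h • x) = entry f lam mu x * h := by
  classical
  have : (Pi.single lam (MulOpposite.op h • x) : PermMod d P) =
      MulOpposite.op h • (Pi.single lam x : PermMod d P) := Pi.single_smul lam _ _
  rw [entry, entry]
  convert congrArg (fun y => ((f y mu : xyMod d mu.1) : Hecke d)) this using 1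
  rw [map_smul]
  rfl

lemma op_algebraMap_smul (lam : Comp m n) (x : xyMod d lam) (c : Lau) :
    MulOpposite.op (algebraMap Lau (Hecke d) c) • x = c • x :=
  Subtype.ext (by
    change (x : Hecke d) * algebraMap Lau (Hecke d) c = c • (x : Hecke d)
    rw [Algebra.smul_def, Algebra.commutes])

lemma entry_scalar_smul (f : Schur d P) (lam mu : P) (x : xyMod d lam.1) (c : Lau) :
    entry f lam mu (c • x) = c • entry f lam mu x := by
  rw [← op_algebraMap_smul, entry_smul, ← Algebra.commutes, Algebra.smul_def]

lemma isLeftEig_genEntry (hP : P ⊆ Lam m n d) (f : Schur d P) (lam mu : P) :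
    IsLeftEig mu.1 (genEntry lam mu f) :=
  isLeftEig_of_mem (hP mu.2) (Subtype.prop _)

lemma isRightEig_genEntry (hP : P ⊆ Lam m n d) (f : Schur d P) (lam mu : P) :
    IsRightEig lam.1 (genEntry lam mu f) := by
  intro k hk
  change entry f lam mu _ * _ = _ • entry f lam mu _
  rw [← entry_smul, ← entry_scalar_smul]
  congr 1
  exact Subtype.ext (isRightEig_xy (hP lam.2) k hk)

lemma finite_of_subset (hP : P ⊆ Lam m n d) : Finite P := ((finite_Lam m n d).subset hP).to_subtype

lemma genEntry_ext (hP : P ⊆ Lam m n d) {f f' : Schur d P}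
    (h : ∀ lam mu, genEntry lam mu f = genEntry lam mu f') : f = f' := by
  classical
  have := finite_of_subset hP
  refine LinearMap.pi_ext fun lam x => funext fun mu => Subtype.ext ?_
  have h1 : ∀ g : Schur d P, ((g (Pi.single lam x) mu : xyMod d mu.1) : Hecke d) =
      entry g lam mu x := fun g => by rw [entry]
  rw [h1, h1]
  obtain ⟨a, ha⟩ := mem_xyMod.1 x.2
  have hx : x = MulOpposite.op a • xyGen d lam.1 := Subtype.ext ha
  rw [hx, entry_smul, entry_smul]
  exact congrArg (· * a) (h lam mu)

/-- Left multiplication by `h` as a map between permutation modules. -/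
def mulHom (lam mu : Comp m n) (h : Hecke d) (hh : h * xy d lam ∈ xyMod d mu) :
    xyMod d lam →ₗ[(Hecke d)ᵐᵒᵖ] xyMod d mu where
  toFun x := ⟨h * x.1, by
    obtain ⟨a, ha⟩ := mem_xyMod.1 x.2
    rw [ha, ← mul_assoc]
    exact Submodule.smul_mem _ (MulOpposite.op a) hh⟩
  map_add' x y := Subtype.ext (mul_add _ _ _)
  map_smul' a x := Subtype.ext (mul_assoc h x.1 a.unop).symm

/-- The right eigenvector condition gives `z = h [xy]_λ`, so left multiplication by `h` sends the
generator to `z`; together with the left condition this lands in `[xy]_μ 𝓗`. Hence the matrix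
entries of an endomorphism can be prescribed freely among two-sided eigenvectors. -/
theorem exists_genEntry (hP : P ⊆ Lam m n d) (z : P → P → Hecke d)
    (h1 : ∀ lam mu, IsLeftEig mu.1 (z lam mu)) (h2 : ∀ lam mu, IsRightEig lam.1 (z lam mu)) :
    ∃ f : Schur d P, ∀ lam mu, genEntry lam mu f = z lam mu := by
  classical
  have := finite_of_subset hP
  have := Fintype.ofFinite P
  choose h hh using fun lam mu => exists_mul_xy (hP (Subtype.prop lam)) (h2 lam mu)
  have hmem : ∀ lam mu, h lam mu * xy d lam.1 ∈ xyMod d mu.1 := fun lam mu => by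
    rw [← hh]; exact mem_xyMod_of_eig (hP mu.2) (hP lam.2) (h1 lam mu) (h2 lam mu)
  let φ : ∀ lam mu : P, xyMod d lam.1 →ₗ[(Hecke d)ᵐᵒᵖ] xyMod d mu.1 := fun lam mu =>
    mulHom lam.1 mu.1 (h lam mu) (hmem lam mu)
  have hφ : ∀ lam mu, ((φ lam mu (xyGen d lam.1) : xyMod d mu.1) : Hecke d) = z lam mu :=
    fun lam mu => (hh lam mu).symm
  clear_value φ
  let f : Schur d P :=
    { toFun := fun x mu => ∑ lam : P, φ lam mu (x lam)
      map_add' := fun x y => funext fun mu => by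
        simp only [Pi.add_apply, map_add, Finset.sum_add_distrib]
      map_smul' := fun a x => funext fun mu => by
        simp only [Pi.smul_apply, map_smul, Finset.smul_sum, RingHom.id_apply] }
  refine ⟨f, fun lam mu => ?_⟩
  have h3 : genEntry lam mu f = ((∑ nu : P, φ nu mu ((Pi.single lam (xyGen d lam.1) :
      PermMod d P) nu) : xyMod d mu.1) : Hecke d) := by
    change entry f lam mu (xyGen d lam.1) = _
    rw [entry]
    congr!
  rw [h3, Finset.sum_eq_single lam, Pi.single_eq_same, hφ]
  · intro nu _ hne
    rw [Pi.single_eq_of_ne hne, map_zero]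
  · intro hc
    exact absurd (Finset.mem_univ _) hc

end

end

end IotaSchur

namespace IotaSchur

noncomputable section

/-! ### The standard basis -/

section

lemma isBasisFamily_of_coord {ι S : Type*} [Fintype ι] [DecidableEq ι] [AddCommGroup S]
    [Module Lau S] {b : ι → S} {c : ι → S →ₗ[Lau] Lau}
    (h1 : ∀ i j, c i (b j) = if i = j then 1 else 0) (h2 : ∀ x, (∀ i, c i x = 0) → x = 0) :
    IsBasisFamily b := by
  have h3 : ∀ (a : ι → Lau) i, c i (∑ j, a j • b j) = a i := fun a i => by
    simp only [map_sum, map_smul, h1, smul_eq_mul, mul_ite, mul_one, mul_zero, Finset.sum_ite_eq,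
      Finset.mem_univ, if_true]
  constructor
  · rw [Fintype.linearIndependent_iff]
    intro g hg i
    rw [← h3 g i, hg, map_zero]
  · rw [Submodule.eq_top_iff']
    intro x
    have : x = ∑ j, c j x • b j := by
      rw [← sub_eq_zero]
      refine h2 _ fun i => ?_
      rw [map_sub, h3, sub_self]
    rw [this]
    exact Submodule.sum_mem _ fun j _ => Submodule.smul_mem _ _ (Submodule.subset_span ⟨j, rfl⟩)

variable {m n d : ℕ} {P : Set (Comp m n)}

/-- By `TDouble_eq` the element `T_{W_λ g W_μ}` depends on the matrix only, so the representative
`g` disappears from the condition. All entries of `f` are then prescribed. -/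
lemma isStd_iff {A : ℤ → ℤ → ℕ} (hA : A ∈ Xi m n d) (f : Schur d P) :
    IsStd f A ↔ ∀ nu rho : P, genEntry nu rho f =
      if nu.1 = colW m n A ∧ rho.1 = rowW m n A then
        cosetElt d (rowW m n A) (colW m n A) A else 0 := by
  constructor
  · rintro ⟨g, hg, hgA, h⟩ nu rho
    have := TDouble_eq (rowW_mem hA) (colW_mem hA) hg
    rw [hgA] at this
    rw [← this]
    exact h nu rho
  · intro h
    refine ⟨minRep m n d A, minRep_mem hA, kappa_minRep hA, fun nu rho => ?_⟩
    rw [TDouble_eq (rowW_mem hA) (colW_mem hA) (minRep_mem hA), kappa_minRep hA]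
    exact h nu rho

lemma isLeftEig_zero (lam : Comp m n) : IsLeftEig lam (0 : Hecke d) := fun k _ => by
  rw [mul_zero, smul_zero]

lemma isRightEig_zero (lam : Comp m n) : IsRightEig lam (0 : Hecke d) := fun k _ => by
  rw [zero_mul, smul_zero]

lemma genEntry_eStd (hP : P ⊆ Lam m n d) {A : ℤ → ℤ → ℕ} (hA : A ∈ Xi m n d) (nu rho : P) :
    genEntry nu rho (eStd d P A) =
      if nu.1 = colW m n A ∧ rho.1 = rowW m n A then
        cosetElt d (rowW m n A) (colW m n A) A else 0 := by
  have hex : ∃ f : Schur d P, IsStd f A := by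
    obtain ⟨f, hf⟩ := exists_genEntry hP (fun nu rho =>
      if nu.1 = colW m n A ∧ rho.1 = rowW m n A then
        cosetElt d (rowW m n A) (colW m n A) A else 0) (fun nu rho => by
          split_ifs with h
          · rw [h.2]; exact isLeftEig_cosetElt (rowW_mem hA) (colW_mem hA) _
          · exact isLeftEig_zero _) (fun nu rho => by
          split_ifs with h
          · rw [h.1]; exact isRightEig_cosetElt (rowW_mem hA) (colW_mem hA) (Xi_le_one hA)
          · exact isRightEig_zero _)
    exact ⟨f, (isStd_iff hA f).2 hf⟩
  exact (isStd_iff hA _).1 (Classical.epsilon_spec hex) nu rho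

/-- The coordinates with respect to the elements `e_A`. -/
def eCoord (A : XiOf m n d P) : Schur d P →ₗ[Lau] Lau :=
  LinearMap.proj (minRep m n d A.1) ∘ₗ coef ∘ₗ
    genEntry (⟨colW m n A.1, A.2.2.2⟩ : P) (⟨rowW m n A.1, A.2.2.1⟩ : P)

lemma eCoord_apply (A : XiOf m n d P) (f : Schur d P) : eCoord A f =
    coef (genEntry (⟨colW m n A.1, A.2.2.2⟩ : P) (⟨rowW m n A.1, A.2.2.1⟩ : P) f)
      (minRep m n d A.1) := rfl

lemma eCoord_eStd (hP : P ⊆ Lam m n d) (A B : XiOf m n d P) [Decidable (A = B)] :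
    eCoord A (eStd d P B.1) = if A = B then 1 else 0 := by
  classical
  rw [eCoord_apply, genEntry_eStd hP B.2.1]
  by_cases h : A = B
  · subst h
    rw [if_pos ⟨rfl, rfl⟩, coef_cosetElt, cosetFun_minRep A.2.1, if_pos rfl, if_pos rfl]
  · rw [if_neg h]
    split_ifs with h1
    · have h2 := cosetFun_minRep (B := B.1) A.2.1
      dsimp only at h1
      rw [coef_cosetElt, ← h1.1, ← h1.2, h2, if_neg]
      exact fun h3 => h (Subtype.ext h3.symm)
    · rw [map_zero, Pi.zero_apply]

/-- The entries of `f` are two-sided eigenvectors, and the coefficients in `eig_expansion` are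
precisely the coordinates of `f`. -/
lemma eq_zero_of_eCoord (hP : P ⊆ Lam m n d) {f : Schur d P} (h : ∀ A, eCoord A f = 0) :
    f = 0 := by
  refine genEntry_ext hP fun lam mu => ?_
  rw [map_zero, eig_expansion (hP mu.2) (hP lam.2) (isLeftEig_genEntry hP f lam mu)
    (isRightEig_genEntry hP f lam mu)]
  refine Finset.sum_eq_zero fun A hA => ?_
  rw [Set.Finite.mem_toFinset] at hA
  split_ifs with h1
  · have h2 := h ⟨A, hA, h1.1 ▸ mu.2, h1.2 ▸ lam.2⟩
    rw [eCoord_apply] at h2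
    have e1 : (⟨colW m n A, h1.2 ▸ lam.2⟩ : P) = lam := Subtype.ext h1.2
    have e2 : (⟨rowW m n A, h1.1 ▸ mu.2⟩ : P) = mu := Subtype.ext h1.1
    rw [e1, e2] at h2
    rw [h2, zero_smul]
  · rfl

/-- The coordinates with respect to the standard basis. -/
def stdCoord (A : XiOf m n d P) : Schur d P →ₗ[Lau] Lau :=
  ((-1 : Lau) ^ ell m n (oddRows m A.1) * vpow (ellHat m n A.1)) • eCoord A

lemma sign_mul_self (N : ℕ) : (-1 : Lau) ^ N * (-1) ^ N = 1 := by
  rw [← mul_pow, neg_one_mul, neg_neg, one_pow]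

lemma stdCoord_std (hP : P ⊆ Lam m n d) (A B : XiOf m n d P) [Decidable (A = B)] :
    stdCoord A (std d P B.1) = if A = B then 1 else 0 := by
  rw [stdCoord, std, LinearMap.smul_apply, map_smul, eCoord_eStd hP, smul_smul, smul_eq_mul]
  split_ifs with h
  · subst h
    linear_combination (vpow (ellHat m n A.1) * vpow (-ellHat m n A.1)) *
      sign_mul_self (ell m n (oddRows m A.1)) + vpow_mul_neg (ellHat m n A.1)
  · rw [mul_zero]

lemma eq_zero_of_stdCoord (hP : P ⊆ Lam m n d) {f : Schur d P} (h : ∀ A, stdCoord A f = 0) :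
    f = 0 := by
  refine eq_zero_of_eCoord hP fun A => ?_
  have h1 := h A
  rw [stdCoord, LinearMap.smul_apply, smul_eq_mul] at h1
  linear_combination (-1 : Lau) ^ ell m n (oddRows m A.1) * vpow (-ellHat m n A.1) * h1 -
    vpow (-ellHat m n A.1) * vpow (ellHat m n A.1) * eCoord A f *
      sign_mul_self (ell m n (oddRows m A.1)) - eCoord A f * vpow_neg_mul (ellHat m n A.1)

theorem isBasisFamily_std (hP : P ⊆ Lam m n d) :
    IsBasisFamily fun A : XiOf m n d P => std d P A.1 := by
  classical
  exact isBasisFamily_of_coord (fun A B => stdCoord_std hP A B) fun f h =>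
    eq_zero_of_stdCoord hP h

/-! ### Extension by zero -/

variable {Q : Set (Comp m n)}

open Classical in
lemma permProj_single (h : P ⊆ Q) (lam : Q) (x : xyMod d lam.1) :
    permProj d h (Pi.single lam x) = if hl : lam.1 ∈ P then
      (Pi.single (⟨lam.1, hl⟩ : P) x : PermMod d P) else 0 := by
  funext mu
  have h0 : permProj d h (Pi.single lam x) mu =
    (Pi.single lam x : PermMod d Q) ⟨mu.1, h mu.2⟩ := rfl
  rw [h0]
  split_ifs with hl
  · by_cases he : mu = ⟨lam.1, hl⟩
    · subst he
      rw [Pi.single_eq_same, Pi.single_eq_same]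
    · rw [Pi.single_eq_of_ne he, Pi.single_eq_of_ne]
      intro h1
      exact he (Subtype.ext (congrArg Subtype.val h1 : mu.1 = lam.1))
  · rw [Pi.single_eq_of_ne]
    · rfl
    · intro h1
      have h2 : mu.1 = lam.1 := congrArg Subtype.val h1
      exact hl (h2 ▸ mu.2)

open Classical in
lemma genEntry_schurIncl (h : P ⊆ Q) (f : Schur d P) (lam mu : Q) :
    genEntry lam mu (schurIncl d h f) = if hlm : lam.1 ∈ P ∧ mu.1 ∈ P then
      genEntry (⟨lam.1, hlm.1⟩ : P) (⟨mu.1, hlm.2⟩ : P) f else 0 := by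
  change ((permIncl d P Q (f (permProj d h (Pi.single lam (xyGen d lam.1)))) mu :
    xyMod d mu.1) : Hecke d) = _
  rw [permProj_single]
  rw [permIncl, LinearMap.pi_apply]
  by_cases hl : lam.1 ∈ P
  · by_cases hm : mu.1 ∈ P
    · rw [dif_pos hl, dif_pos hm, dif_pos ⟨hl, hm⟩]
      rfl
    · have hn : ¬ (lam.1 ∈ P ∧ mu.1 ∈ P) := fun h' => hm h'.2
      rw [dif_neg hm, dif_neg hn]
      rfl
  · have hn : ¬ (lam.1 ∈ P ∧ mu.1 ∈ P) := fun h' => hl h'.1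
    rw [dif_neg hl, map_zero, map_zero, dif_neg hn]
    rfl

lemma schurIncl_smul (hQ : Q ⊆ Lam m n d) (h : P ⊆ Q) (c : Lau) (f : Schur d P) :
    schurIncl d h (c • f) = c • schurIncl d h f := by
  refine genEntry_ext hQ fun lam mu => ?_
  rw [map_smul, genEntry_schurIncl, genEntry_schurIncl]
  split_ifs
  · rw [map_smul]
  · rw [smul_zero]

lemma schurIncl_add (h : P ⊆ Q) (f f' : Schur d P) :
    schurIncl d h (f + f') = schurIncl d h f + schurIncl d h f' := by
  rw [schurIncl, LinearMap.add_comp, LinearMap.comp_add]; rfl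

lemma schurIncl_sub (h : P ⊆ Q) (f f' : Schur d P) :
    schurIncl d h (f - f') = schurIncl d h f - schurIncl d h f' := by
  rw [schurIncl, LinearMap.sub_comp, LinearMap.comp_sub]; rfl

lemma schurIncl_eStd (hQ : Q ⊆ Lam m n d) (h : P ⊆ Q) {A : ℤ → ℤ → ℕ}
    (hA : A ∈ XiOf m n d P) : schurIncl d h (eStd d P A) = eStd d Q A := by
  refine genEntry_ext hQ fun lam mu => ?_
  rw [genEntry_schurIncl, genEntry_eStd hQ hA.1]
  split_ifs with h1 h2 h2
  · rw [genEntry_eStd (h.trans hQ) hA.1, if_pos h2]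
  · rw [genEntry_eStd (h.trans hQ) hA.1, if_neg h2]
  · exact absurd ⟨h2.1 ▸ hA.2.2, h2.2 ▸ hA.2.1⟩ h1
  · rfl

lemma schurIncl_std (hQ : Q ⊆ Lam m n d) (h : P ⊆ Q) {A : ℤ → ℤ → ℕ}
    (hA : A ∈ XiOf m n d P) : schurIncl d h (std d P A) = std d Q A := by
  rw [std, schurIncl_smul hQ, schurIncl_eStd hQ h hA, std]

end

end

end IotaSchur

namespace IotaSchur

noncomputable section

/-! ### The bar involution and the Bruhat order -/

section

variable {d : ℕ}

lemma heckeBar_smul (c : Lau) (x : Hecke d) :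
    heckeBar d (c • x) = LaurentPolynomial.invert c • heckeBar d x := by
  rw [Algebra.smul_def, map_mul, heckeBar_algebraMap, ← Algebra.smul_def]

lemma heckeBar_simple (k : Fin d) : heckeBar d (TT (simpleRefl k)) = simpleInv k := by
  rw [heckeBar_TT]
  exact barTT_eq _ _ (by rw [simpleRefl_inv, simple_mul_simpleInv])

lemma heckeBar_simpleInv (k : Fin d) : heckeBar d (simpleInv k) = TT (simpleRefl k) := by
  have h := congrArg (heckeBar d) (simpleInv_mul_simple k)
  rw [map_mul, map_one, heckeBar_simple] at h
  have h2 := congrArg (· * TT (simpleRefl k)) h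
  simpa only [mul_assoc, simpleInv_mul_simple, mul_one, one_mul] using h2

lemma weylB_induction_left {p : weylB d → Prop} (one : p 1)
    (step : ∀ w k, len w < len (simpleRefl k * w) → p w → p (simpleRefl k * w)) (w : weylB d) :
    p w := by
  have h : p w⁻¹⁻¹ := weylB_induction_right (p := fun w => p w⁻¹) (by rwa [inv_one])
    (fun w k hk ih => by
      rw [mul_inv_rev, simpleRefl_inv]
      refine step _ _ ?_ ih
      rw [lt_len_simple_mul_iff, inv_inv]
      exact hk) w⁻¹
  rwa [inv_inv] at h

lemma heckeBar_heckeBar (x : Hecke d) : heckeBar d (heckeBar d x) = x := by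
  have hx : x ∈ Submodule.span Lau (Set.range (TT (d := d))) := by rw [span_TT]; trivial
  induction hx using Submodule.span_induction with
  | mem x hx =>
    obtain ⟨w, rfl⟩ := hx
    induction w using weylB_induction_left with
    | one => rw [TT_one, map_one, map_one]
    | step w k hk ih =>
      rw [← TT_simple_mul k w hk, map_mul, map_mul, ih, heckeBar_simple, heckeBar_simpleInv]
  | zero => rw [map_zero, map_zero]
  | add x y _ _ hx hy => rw [map_add, map_add, hx, hy]
  | smul a x _ hx => rw [heckeBar_smul, heckeBar_smul, hx, LaurentPolynomial.involutive_invert]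

/-- The points `v ≤ a`, `v ≠ 0` whose preimages under `w` are at least `b`. -/
def rankInd (w : weylB d) (b v : ℤ) : ℕ := if v ∈ pts d ∧ v ≠ 0 ∧ b ≤ w⁻¹.1 v then 1 else 0

/-- The number of `v ≤ a`, `v ≠ 0` with `b ≤ w⁻¹ v`. -/
def rankFun (w : weylB d) (b a : ℤ) : ℕ := ∑ v ∈ Finset.Icc (-(d : ℤ)) a, rankInd w b v

lemma rankFun_succ (w : weylB d) (b a : ℤ) :
    rankFun w b a = rankFun w b (a - 1) + rankInd w b a := by
  unfold rankFun
  by_cases h : -(d : ℤ) ≤ a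
  · have : Finset.Icc (-(d : ℤ)) a = insert a (Finset.Icc (-(d : ℤ)) (a - 1)) := by
      ext x; simp only [Finset.mem_insert, Finset.mem_Icc]; omega
    rw [this, Finset.sum_insert (by simp), add_comm]
  · rw [Finset.Icc_eq_empty (by omega), Finset.Icc_eq_empty (by omega), rankInd, if_neg]
    · rfl
    · rw [Finset.mem_Icc]; omega

lemma rankInd_zero (w : weylB d) (b : ℤ) : rankInd w b 0 = 0 := if_neg fun h => h.2.1 rfl

lemma reflPerm_mem_pts (k : Fin d) (v : ℤ) : reflPerm k v ∈ pts d ↔ v ∈ pts d :=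
  weylB_mem_pts (simpleRefl k)

lemma reflPerm_ne_zero {k : Fin d} {v : ℤ} : reflPerm k v ≠ 0 ↔ v ≠ 0 := by
  have h := weylB_zero (simpleRefl k)
  rw [simpleRefl_val] at h
  rw [ne_eq, ne_eq, ← (reflPerm (k : ℕ)).injective.eq_iff (a := v), h]

lemma rankInd_simple_mul (w : weylB d) (k : Fin d) (b v : ℤ) :
    rankInd (simpleRefl k * w) b v = rankInd w b (reflPerm k v) := by
  unfold rankInd
  rw [inv_simple_mul_apply]
  simp only [reflPerm_mem_pts, reflPerm_ne_zero]

/-- The effect of a simple reflection on the rank function. -/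
lemma rankFun_simple_mul (w : weylB d) (k : Fin d) (b a : ℤ) :
    (rankFun (simpleRefl k * w) b a : ℤ) = rankFun w b a +
      (if rootLo k ≤ a ∧ a < rootHi k then
        (rankInd w b (rootHi k) : ℤ) - rankInd w b (rootLo k) else 0) +
      if (k : ℕ) ≠ 0 ∧ -rootHi k ≤ a ∧ a < -rootLo k then
        (rankInd w b (-rootLo k) : ℤ) - rankInd w b (-rootHi k) else 0 := by
  have hk := k.2
  have hroot : rootHi k = (k : ℕ) + 1 := rfl
  have hroot' : rootLo k = if (k : ℕ) = 0 then -1 else ((k : ℕ) : ℤ) := rfl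
  -- Induction on `a`: the partial sums for `s_k w` and `w` differ only while `a` lies between two
  -- exchanged points. For `k = 0` the root pair is its own opposite, hence the condition on `k` in
  -- the second correction.
  by_cases ha : -(d : ℤ) - 1 ≤ a
  · induction a, ha using Int.leInduction with
    | base =>
      have h0 : ∀ u : weylB d, rankFun u b (-(d : ℤ) - 1) = 0 := fun u => by
        rw [rankFun, Finset.Icc_eq_empty (by omega), Finset.sum_empty]
      rw [h0, h0, if_neg, if_neg] <;> split_ifs at hroot' <;> omega
    | succ a ha ih =>
      rw [rankFun_succ _ b (a + 1), rankFun_succ _ b (a + 1), add_sub_cancel_right,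
        rankInd_simple_mul]
      push_cast
      rw [ih]
      have hneg : ∀ i, reflPerm k (-i) = -reflPerm k i := (reflPerm_mem k.2).1
      by_cases h1 : a + 1 = rootLo k
      · rw [h1, reflPerm_rootLo]
        split_ifs at hroot' ⊢ <;> omega
      by_cases h2 : a + 1 = rootHi k
      · rw [h2, reflPerm_rootHi]
        split_ifs at hroot' ⊢ <;> omega
      by_cases h3 : a + 1 = -rootLo k
      · rw [h3, hneg, reflPerm_rootLo]
        split_ifs at hroot' ⊢ <;> omega
      by_cases h4 : a + 1 = -rootHi k
      · rw [h4, hneg, reflPerm_rootHi]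
        split_ifs at hroot' ⊢ <;> omega
      rw [reflPerm_eq_self h1 h2 h3 h4]
      split_ifs at hroot' ⊢ <;> omega
  · have h0 : ∀ u : weylB d, rankFun u b a = 0 := fun u => by
      rw [rankFun, Finset.Icc_eq_empty (by omega), Finset.sum_empty]
    rw [h0, h0, if_neg, if_neg] <;> split_ifs at hroot' <;> omega

/-- The comparison of rank functions (the Bruhat order, for type `A`). -/
def RankLe (y w : weylB d) : Prop := ∀ b a, rankFun y b a ≤ rankFun w b a

lemma rankInd_mono {w : weylB d} {b v v' : ℤ} (hv : v' ∈ pts d) (hv' : v' ≠ 0)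
    (h : w⁻¹.1 v ≤ w⁻¹.1 v') : rankInd w b v ≤ rankInd w b v' := by
  unfold rankInd
  split_ifs with h1 h2
  · exact le_rfl
  · exact absurd ⟨hv, hv', h1.2.2.trans h⟩ h2
  · exact Nat.zero_le _
  · exact le_rfl

lemma root_facts (k : Fin d) : rootHi k ∈ pts d ∧ -rootLo k ∈ pts d ∧ rootHi k ≠ 0 ∧
    -rootLo k ≠ 0 := by
  have hk := k.2
  simp only [rootHi, rootLo, Finset.mem_Icc]
  split_ifs <;> omega

lemma rankInd_root {w : weylB d} {k : Fin d} (h : len w < len (simpleRefl k * w)) (b : ℤ) :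
    rankInd w b (rootLo k) ≤ rankInd w b (rootHi k) ∧
      rankInd w b (-rootHi k) ≤ rankInd w b (-rootLo k) := by
  rw [lt_len_simple_mul_iff] at h
  obtain ⟨h1, h2, h3, h4⟩ := root_facts k
  refine ⟨rankInd_mono h1 h3 h.le, rankInd_mono h2 h4 ?_⟩
  rw [weylB_neg, weylB_neg]
  omega

lemma RankLe.refl (w : weylB d) : RankLe w w := fun _ _ => le_rfl

lemma RankLe.trans {x y z : weylB d} (h : RankLe x y) (h' : RankLe y z) : RankLe x z :=
  fun b a => (h b a).trans (h' b a)

lemma rankLe_simple_mul {w : weylB d} {k : Fin d} (h : len w < len (simpleRefl k * w)) :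
    RankLe w (simpleRefl k * w) := fun b a => by
  have h1 := rankFun_simple_mul w k b a
  have h2 := rankInd_root h b
  split_ifs at h1 <;> omega

/-- As `0` is not counted, the points `-1` and `1` behave like neighbours, and the values `a = -1`
and `a = 0` describe the same cut between them. -/
lemma rankFun_cut (u : weylB d) (b : ℤ) {p q a : ℤ} (h : a = p ∧ q = a + 1 ∨
    a = -1 ∧ p = -1 ∧ q = 1 ∨ a = 0 ∧ p = -1 ∧ q = 1) :
    rankFun u b a = rankFun u b (p - 1) + rankInd u b p ∧
      rankFun u b q = rankFun u b a + rankInd u b q := by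
  have h0 : rankFun u b 0 = rankFun u b (-1) := by
    rw [rankFun_succ, rankInd_zero]; rfl
  have h1 : rankFun u b 1 = rankFun u b 0 + rankInd u b 1 := rankFun_succ u b 1
  have h2 := rankFun_succ u b (-1)
  rcases h with ⟨rfl, rfl⟩ | ⟨rfl, rfl, rfl⟩ | ⟨rfl, rfl, rfl⟩
  · refine ⟨rankFun_succ u b a, ?_⟩
    rw [rankFun_succ, add_sub_cancel_right]
  · exact ⟨h2, by omega⟩
  · exact ⟨by omega, h1⟩

/-- The lifting property. -/
lemma RankLe.lift {y w : weylB d} {k : Fin d} (hyw : RankLe y w)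
    (hy : len y < len (simpleRefl k * y)) (hw : len w < len (simpleRefl k * w)) :
    RankLe (simpleRefl k * y) (simpleRefl k * w) := fun b a => by
  have h1 := rankFun_simple_mul w k b a
  have h2 := rankInd_root hw b
  have h3 := rankFun_simple_mul y k b a
  have h4 := rankInd_root hy b
  have e : ∀ u : weylB d, rankInd u b (rootLo k) ≤ 1 ∧ rankInd u b (rootHi k) ≤ 1 ∧
      rankInd u b (-rootLo k) ≤ 1 ∧ rankInd u b (-rootHi k) ≤ 1 := fun u => by
    unfold rankInd
    refine ⟨?_, ?_, ?_, ?_⟩ <;> split_ifs <;> omega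
  have h5 := e y
  have h6 := e w
  have h7 := hyw b a
  by_cases c1 : rootLo k ≤ a ∧ a < rootHi k
  · have c2 : ¬ ((k : ℕ) ≠ 0 ∧ -rootHi k ≤ a ∧ a < -rootLo k) := by
      simp only [rootLo, rootHi] at c1 ⊢
      split_ifs at c1 ⊢ <;> omega
    rw [if_pos c1, if_neg c2] at h1 h3
    -- After `s_k` the value at the cut is the rank below the root pair plus the indicator of its
    -- upper point. If that indicator is 1 for `w`, the comparison below the pair suffices. If it is
    -- 0, then so is that of the lower point, and the comparison above the pair applies.
    have h8 := hyw b (rootLo k - 1)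
    have h9 := hyw b (rootHi k)
    have e1 := fun u : weylB d => rankFun_cut u b (a := a) (p := rootLo k) (q := rootHi k) (by
      simp only [rootLo, rootHi] at c1 ⊢
      split_ifs at c1 ⊢ <;> omega)
    have := e1 y
    have := e1 w
    omega
  by_cases c2 : (k : ℕ) ≠ 0 ∧ -rootHi k ≤ a ∧ a < -rootLo k
  · rw [if_neg c1, if_pos c2] at h1 h3
    have h8 := hyw b (-rootHi k - 1)
    have h9 := hyw b (-rootLo k)
    have e1 := fun u : weylB d => rankFun_cut u b (a := a) (p := -rootHi k) (q := -rootLo k) (by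
      simp only [rootLo, rootHi] at c2 ⊢
      split_ifs at c2 ⊢ <;> omega)
    have := e1 y
    have := e1 w
    omega
  · rw [if_neg c1, if_neg c2] at h1 h3
    omega

lemma coef_simpleInv_mul (k : Fin d) (x : Hecke d) (y : weylB d) :
    coef (simpleInv k * x) y = if len y < len (simpleRefl k * y) then
      coef x (simpleRefl k * y) - (1 - vpow (-2)) * coef x y
      else vpow (-2) * coef x (simpleRefl k * y) := by
  have h0 : simpleInv k * x = vpow (-2) • (TT (simpleRefl k) * x - (qq - 1) • x) := by
    rw [simpleInv, smul_mul_assoc, add_mul, sub_mul, one_mul, ← Algebra.smul_def, sub_smul,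
      one_smul]
    congr 1
    abel
  have h1 := vpow_neg_mul 2
  rw [h0, map_smul, map_sub, map_smul, coef_simple_mul, Pi.smul_apply, Pi.sub_apply,
    Pi.smul_apply, leftOp_apply]
  simp only [smul_eq_mul]
  split_ifs
  · linear_combination (coef x (simpleRefl k * y) - coef x y) * h1
  · ring

/-- The bar involution is unitriangular up to a power of `v`. -/
theorem coef_heckeBar_TT (w : weylB d) : coef (heckeBar d (TT w)) w = vpow (-2 * (len w : ℤ)) ∧
    ∀ y, coef (heckeBar d (TT w)) y ≠ 0 → RankLe y w ∧ (y = w ∨ len y < len w) := by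
  classical
  induction w using weylB_induction_left with
  | one =>
    rw [TT_one, map_one, ← TT_one]
    refine ⟨by rw [coef_TT_apply, if_pos rfl, len_one]; simp, fun y hy => ?_⟩
    rw [coef_TT_apply] at hy
    by_cases h : y = 1
    · subst h; exact ⟨RankLe.refl _, Or.inl rfl⟩
    · rw [if_neg h] at hy; exact absurd rfl hy
  | step w k hk ih =>
    have hlen : len (simpleRefl k * w) = len w + 1 := len_simple_mul w k (by
      rwa [lt_len_simple_mul_iff] at hk)
    rw [← TT_simple_mul k w hk, map_mul, heckeBar_simple]
    constructor
    · rw [coef_simpleInv_mul, simple_mul_simple_mul, if_neg (by omega), ih.1, hlen,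
        ← LaurentPolynomial.T_add]
      congr 1
      push_cast
      ring
    · intro y hy
      rw [coef_simpleInv_mul] at hy
      -- Here `s y ≤ w`. If `y < s y`, then `y ≤ s y ≤ w ≤ s w`; otherwise the lifting property
      -- raises `s y ≤ w` to `y ≤ s w`.
      have key : coef (heckeBar d (TT w)) (simpleRefl k * y) ≠ 0 →
          RankLe y (simpleRefl k * w) ∧
            (y = simpleRefl k * w ∨ len y < len (simpleRefl k * w)) := by
        intro h
        obtain ⟨h1, h2⟩ := ih.2 _ h
        constructor
        · by_cases h3 : len y < len (simpleRefl k * y)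
          · exact ((rankLe_simple_mul h3).trans h1).trans (rankLe_simple_mul hk)
          · have h4 := h1.lift (k := k) (by
              rw [simple_mul_simple_mul]
              have := len_simple_mul_ne k y
              omega) hk
            rwa [simple_mul_simple_mul] at h4
        · rcases h2 with h2 | h2
          · exact Or.inl (by rw [← h2, simple_mul_simple_mul])
          · right
            have h5 := len_mul_le (simpleRefl k) (simpleRefl k * y)
            rw [simple_mul_simple_mul, len_simple] at h5
            omega
      split_ifs at hy with h3
      · by_cases h4 : coef (heckeBar d (TT w)) (simpleRefl k * y) = 0
        · have h5 : coef (heckeBar d (TT w)) y ≠ 0 := fun h => hy (by rw [h4, h]; ring)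
          obtain ⟨h1, h2⟩ := ih.2 _ h5
          refine ⟨h1.trans (rankLe_simple_mul hk), Or.inr ?_⟩
          rcases h2 with rfl | h2 <;> omega
        · exact key h4
      · exact key (right_ne_zero_of_mul hy)

end

end

end IotaSchur

namespace IotaSchur

noncomputable section

/-! ### The algebraic order on matrices -/

section

variable {m n d : ℕ}

lemma exists_threshold_le {f : ℤ → ℤ} (hf : Monotone f) (d : ℕ) (i : ℤ) :
    ∃ a, ∀ v ∈ pts d, f v ≤ i ↔ v ≤ a := by
  by_cases h : ((pts d).filter fun v => f v ≤ i).Nonempty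
  · refine ⟨((pts d).filter fun v => f v ≤ i).max' h, fun v hv => ⟨fun h1 => ?_, fun h1 => ?_⟩⟩
    · exact Finset.le_max' _ _ (Finset.mem_filter.2 ⟨hv, h1⟩)
    · exact (hf h1).trans (Finset.mem_filter.1 (Finset.max'_mem _ h)).2
  · refine ⟨-(d : ℤ) - 1, fun v hv => ⟨fun h1 => ?_, fun h1 => ?_⟩⟩
    · exact absurd ⟨v, Finset.mem_filter.2 ⟨hv, h1⟩⟩ h
    · rw [Finset.mem_Icc] at hv; omega

lemma exists_threshold_ge {f : ℤ → ℤ} (hf : Monotone f) (d : ℕ) (j : ℤ) :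
    ∃ b, ∀ v ∈ pts d, j ≤ f v ↔ b ≤ v := by
  obtain ⟨a, ha⟩ := exists_threshold_le hf d (j - 1)
  refine ⟨a + 1, fun v hv => ?_⟩
  have := ha v hv
  omega

lemma sig_kappa {lam mu : Comp m n} (hl : lam ∈ Lam m n d) (hm : mu ∈ Lam m n d) (w : weylB d)
    (i j : ℤ) : sig m n (kappa lam w mu) i j =
      ((pts d).filter fun x => j ≤ bl mu x ∧ bl lam (w.1 x) ≤ i).card := by
  rw [sig, Finset.card_eq_sum_card_fiberwise (f := fun x => bl lam (w.1 x))
    (t := (II m n).filter fun x => x ≤ i) fun x hx => by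
      rw [Finset.mem_coe, Finset.mem_filter] at hx ⊢
      exact ⟨bl_mem_II _ _, hx.2.2⟩]
  refine Finset.sum_congr rfl fun a ha => ?_
  rw [Finset.card_eq_sum_card_fiberwise (f := bl mu)
    (t := (II m n).filter fun x => j ≤ x) fun x hx => by
      rw [Finset.mem_coe, Finset.mem_filter, Finset.mem_filter] at hx
      rw [Finset.mem_coe, Finset.mem_filter]
      exact ⟨bl_mem_II _ _, hx.1.2.1⟩]
  refine Finset.sum_congr rfl fun b hb => ?_
  rw [Finset.mem_filter] at ha hb
  rw [kappa_apply hl hm, Finset.filter_filter, Finset.filter_filter]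
  congr 1
  ext x
  rw [Finset.mem_filter, Finset.mem_filter]
  refine and_congr_right fun _ => ?_
  omega

/-- The point `0`, omitted from `rankFun`, is fixed by every `w`, so the correction does not depend
on `w`. -/
lemma card_eq_rankFun (w : weylB d) (a b : ℤ) :
    ((pts d).filter fun x => b ≤ x ∧ w.1 x ≤ a).card =
      rankFun w b a + if b ≤ 0 ∧ 0 ≤ a then 1 else 0 := by
  have h1 := card_filter_weylB w fun v => b ≤ w⁻¹.1 v ∧ v ≤ a
  simp only [inv_val_apply_val] at h1
  have h2 : rankFun w b a = ((pts d).filter fun v => v ≠ 0 ∧ b ≤ w⁻¹.1 v ∧ v ≤ a).card := by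
    unfold rankFun rankInd
    rw [← Finset.card_filter]
    congr 1
    ext v
    simp only [Finset.mem_filter, Finset.mem_Icc]
    constructor
    · rintro ⟨⟨h1, h2⟩, h3, h4, h5⟩
      exact ⟨h3, h4, h5, h2⟩
    · rintro ⟨⟨h1, h2⟩, h3, h4, h5⟩
      exact ⟨⟨h1, h5⟩, ⟨h1, h2⟩, h3, h4⟩
  have h0 : w⁻¹.1 0 = 0 := weylB_zero _
  rw [h1, h2]
  split_ifs with hc
  · rw [← Finset.card_insert_of_notMem (a := 0) (by simp)]
    congr 1
    ext v
    rw [Finset.mem_insert, Finset.mem_filter, Finset.mem_filter]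
    by_cases hv : v = 0
    · subst hv
      rw [h0]
      simp only [hc, and_self, and_true, true_or, iff_true]
      exact zero_mem_pts d
    · simp only [hv, ne_eq, not_false_eq_true, true_and, false_or]
  · rw [add_zero]
    congr 1
    ext v
    rw [Finset.mem_filter, Finset.mem_filter]
    by_cases hv : v = 0
    · subst hv
      rw [h0]
      simp only [hc, and_false, ne_eq, not_true_eq_false]
    · simp only [hv, ne_eq, not_false_eq_true, true_and]

/-- Labels are monotone, so conditions on blocks are thresholds on points. Thus `σ_{ij}` is a value
of the rank function up to a constant that is the same for `y` and `w`. -/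
theorem RankLe.sig_le {lam mu : Comp m n} (hl : lam ∈ Lam m n d) (hm : mu ∈ Lam m n d)
    {y w : weylB d} (h : RankLe y w) (i j : ℤ) :
    sig m n (kappa lam y mu) i j ≤ sig m n (kappa lam w mu) i j := by
  obtain ⟨a, ha⟩ := exists_threshold_le (bl_mono lam) d i
  obtain ⟨b, hb⟩ := exists_threshold_ge (bl_mono mu) d j
  have key : ∀ u : weylB d, sig m n (kappa lam u mu) i j =
      rankFun u b a + if b ≤ 0 ∧ 0 ≤ a then 1 else 0 := fun u => by
    rw [sig_kappa hl hm, ← card_eq_rankFun]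
    congr 1
    ext x
    rw [Finset.mem_filter, Finset.mem_filter]
    refine and_congr_right fun hx => ?_
    rw [hb x hx, ha _ ((weylB_mem_pts u).2 hx)]
  rw [key, key]
  exact Nat.add_le_add_right (h b a) _

lemma RankLe.algLe {lam mu : Comp m n} (hl : lam ∈ Lam m n d) (hm : mu ∈ Lam m n d)
    {y w : weylB d} (h : RankLe y w) : algLe m n (kappa lam y mu) (kappa lam w mu) :=
  ⟨by rw [rowW_kappa hl hm, rowW_kappa hl hm], by rw [colW_kappa hl hm, colW_kappa hl hm],
    fun i _ j _ _ => h.sig_le hl hm i j⟩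

lemma sig_succ (A : ℤ → ℤ → ℕ) {i j : ℤ} (hi : i ∈ II m n) (hj : j ∈ II m n) :
    A i j + sig m n A (i - 1) j + sig m n A i (j + 1) =
      sig m n A i j + sig m n A (i - 1) (j + 1) := by
  have h1 : ∀ j, sig m n A i j = sig m n A (i - 1) j + ∑ y ∈ II m n with j ≤ y, A i y := fun j => by
    have : ((II m n).filter fun x => x ≤ i) = insert i ((II m n).filter fun x => x ≤ i - 1) := by
      ext x
      simp only [Finset.mem_insert, Finset.mem_filter]
      constructor
      · rintro ⟨h1, h2⟩
        by_cases h : x = i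
        · exact Or.inl h
        · exact Or.inr ⟨h1, by omega⟩
      · rintro (rfl | ⟨h1, h2⟩)
        · exact ⟨hi, le_rfl⟩
        · exact ⟨h1, by omega⟩
    rw [sig, sig, this, Finset.sum_insert (by simp), add_comm]
  have h2 : (∑ y ∈ II m n with j ≤ y, A i y) = A i j + ∑ y ∈ II m n with j + 1 ≤ y, A i y := by
    have : ((II m n).filter fun x => j ≤ x) = insert j ((II m n).filter fun x => j + 1 ≤ x) := by
      ext x
      simp only [Finset.mem_insert, Finset.mem_filter]
      constructor
      · rintro ⟨h1, h2⟩
        by_cases h : x = j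
        · exact Or.inl h
        · exact Or.inr ⟨h1, by omega⟩
      · rintro (rfl | ⟨h1, h2⟩)
        · exact ⟨hj, le_rfl⟩
        · exact ⟨h1, by omega⟩
    rw [this, Finset.sum_insert (by simp)]
  rw [h1 j, h1 (j + 1), h2]
  ring

lemma sig_eq_zero (A : ℤ → ℤ → ℕ) {i j : ℤ} (hij : i < j) (h : ¬ (i ∈ II m n ∧ j ∈ II m n)) :
    sig m n A i j = 0 := by
  simp only [II, Finset.mem_Icc] at h
  refine Finset.sum_eq_zero fun x hx => Finset.sum_eq_zero fun y hy => ?_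
  simp only [II, Finset.mem_filter, Finset.mem_Icc] at hx hy
  omega

/-- The order controls `σ_{ij}` for `i < j` only. By inclusion and exclusion these numbers give the
entries above the diagonal; the symmetry gives those below, and the row sums give the diagonal. -/
theorem algLe_antisymm {A B : ℤ → ℤ → ℕ} (hA : A ∈ Xi m n d) (hB : B ∈ Xi m n d)
    (h : algLe m n A B) (h' : algLe m n B A) : A = B := by
  have hsig : ∀ i j, i < j → sig m n A i j = sig m n B i j := fun i j hij => by
    by_cases hc : i ∈ II m n ∧ j ∈ II m n
    · exact le_antisymm (h.2.2 i hc.1 j hc.2 hij) (h'.2.2 i hc.1 j hc.2 hij)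
    · rw [sig_eq_zero A hij hc, sig_eq_zero B hij hc]
  have hlt : ∀ i j, i < j → A i j = B i j := fun i j hij => by
    by_cases hc : i ∈ II m n ∧ j ∈ II m n
    · have h1 := sig_succ A hc.1 hc.2
      have h2 := sig_succ B hc.1 hc.2
      rw [hsig i j hij, hsig (i - 1) j (by omega), hsig i (j + 1) (by omega),
        hsig (i - 1) (j + 1) (by omega)] at h1
      omega
    · have h1 := mt (hA.1 i j) hc
      have h2 := mt (hB.1 i j) hc
      omega
  have hne : ∀ i j, i ≠ j → A i j = B i j := fun i j hij => by
    rcases lt_or_gt_of_ne hij with h1 | h1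
    · exact hlt i j h1
    · rw [hA.2.2.1, hB.2.2.1]
      exact hlt _ _ (neg_lt_neg h1)
  funext i j
  by_cases hij : i = j
  · subst hij
    by_cases hi : i ∈ II m n
    · have h1 := Xi_row_sum hA i
      rw [h.1, ← Xi_row_sum hB i, ← Finset.add_sum_erase _ _ hi, ← Finset.add_sum_erase _ _ hi,
        Finset.sum_congr rfl fun j hj => hne i j (Finset.ne_of_mem_erase hj).symm] at h1
      exact Nat.add_right_cancel h1
    · have h1 := mt (fun h => (hA.1 i i h).1) hi
      have h2 := mt (fun h => (hB.1 i i h).1) hi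
      omega
  · exact hne i j hij

lemma algLe_trans {A B C : ℤ → ℤ → ℕ} (h : algLe m n A B) (h' : algLe m n B C) : algLe m n A C :=
  ⟨h.1.trans h'.1, h.2.1.trans h'.2.1, fun i hi j hj hij =>
    (h.2.2 i hi j hj hij).trans (h'.2.2 i hi j hj hij)⟩

lemma algLt_trans {A B C : ℤ → ℤ → ℕ} (hA : A ∈ Xi m n d) (hB : B ∈ Xi m n d)
    (h : algLt m n A B) (h' : algLt m n B C) : algLt m n A C :=
  ⟨algLe_trans h.1 h'.1, fun he => h.2 (algLe_antisymm hA hB h.1 (he ▸ h'.1))⟩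

/-! ### The bar involution on eigenvectors -/

lemma invert_eigVal_mul (lam : Comp m n) (k : Fin d) :
    eigVal lam k * LaurentPolynomial.invert (eigVal lam k) = 1 := by
  unfold eigVal
  split_ifs
  · rw [LaurentPolynomial.invert_T, vpow_mul_neg]
  · rw [map_neg, map_one, neg_mul_neg, one_mul]

/-- The bar involution turns `T_s z = e z` into an equation for `T_s⁻¹` with eigenvalue the
conjugate of `e`, and this conjugate is `e⁻¹` for both `e = q` and `e = -1`. -/
lemma IsLeftEig.bar {lam : Comp m n} {z : Hecke d} (hz : IsLeftEig lam z) :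
    IsLeftEig lam (heckeBar d z) := fun k hk => by
  have h := congrArg (heckeBar d) (hz k hk)
  rw [map_mul, heckeBar_simple, heckeBar_smul] at h
  have h2 := congrArg (fun x => eigVal lam k • (TT (simpleRefl k) * x)) h
  simp only [← mul_assoc, simple_mul_simpleInv, one_mul, mul_smul_comm, smul_smul,
    invert_eigVal_mul, one_smul] at h2
  exact h2.symm

lemma IsRightEig.bar {lam : Comp m n} {z : Hecke d} (hz : IsRightEig lam z) :
    IsRightEig lam (heckeBar d z) := fun k hk => by
  have h := congrArg (heckeBar d) (hz k hk)
  rw [map_mul, heckeBar_simple, heckeBar_smul] at h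
  have h2 := congrArg (fun x => eigVal lam k • (x * TT (simpleRefl k))) h
  simp only [mul_assoc, simpleInv_mul_simple, mul_one, smul_mul_assoc, smul_smul,
    invert_eigVal_mul, one_smul] at h2
  exact h2.symm

lemma coef_heckeBar (z : Hecke d) (y : weylB d) : coef (heckeBar d z) y =
    ∑ w, LaurentPolynomial.invert (coef z w) * coef (heckeBar d (TT w)) y := by
  conv_lhs => rw [← sum_coef_TT z]
  simp only [map_sum, heckeBar_smul, map_smul, Finset.sum_apply, Pi.smul_apply, smul_eq_mul]

lemma exists_rankLe_of_coef_bar {lam mu : Comp m n} {A : ℤ → ℤ → ℕ} {y : weylB d}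
    (h : coef (heckeBar d (cosetElt d lam mu A)) y ≠ 0) :
    ∃ w : weylB d, kappa lam w mu = A ∧ RankLe y w := by
  rw [coef_heckeBar] at h
  obtain ⟨w, -, hw⟩ := Finset.exists_ne_zero_of_sum_ne_zero h
  refine ⟨w, ?_, ((coef_heckeBar_TT w).2 y (right_ne_zero_of_mul hw)).1⟩
  by_contra hc
  apply left_ne_zero_of_mul hw
  rw [coef_cosetElt, cosetFun, if_neg hc, map_zero]

/-- Apart from `T_w` itself, the conjugate of `T_w` involves shorter elements only. No element of
the coset is longer than `g`, so only `w = g` contributes to the coefficient of `T_g`. -/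
lemma coef_bar_longest {lam mu : Comp m n} {A : ℤ → ℤ → ℕ} {g : weylB d}
    (hg : kappa lam g mu = A) (hmax : ∀ u : weylB d, kappa lam u mu = A → len u ≤ len g) :
    coef (heckeBar d (cosetElt d lam mu A)) g =
      LaurentPolynomial.invert (negQ (oddLen lam mu g)) * vpow (-2 * (len g : ℤ)) := by
  rw [coef_heckeBar, Finset.sum_eq_single g]
  · rw [(coef_heckeBar_TT g).1, coef_cosetElt, cosetFun, if_pos hg]
  · intro w _ hw
    by_contra hne
    have h1 := (coef_heckeBar_TT w).2 g (right_ne_zero_of_mul hne)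
    have h2 : kappa lam w mu = A := by
      by_contra hc
      apply left_ne_zero_of_mul hne
      rw [coef_cosetElt, cosetFun, if_neg hc, map_zero]
    have h3 := hmax w h2
    rcases h1.2 with h4 | h4
    · exact hw h4.symm
    · omega
  · intro h
    exact absurd (Finset.mem_univ g) h

lemma exists_maxRep {A : ℤ → ℤ → ℕ} (hA : A ∈ Xi m n d) : ∃ g : weylB d,
    kappa (rowW m n A) g (colW m n A) = A ∧
      (∀ u : weylB d, kappa (rowW m n A) u (colW m n A) = A → len u ≤ len g) ∧
      (∀ a ∈ pts d, ∀ b ∈ pts d, a < b → bl (colW m n A) a = bl (colW m n A) b →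
        g.1 b < g.1 a) ∧
      (∀ a ∈ pts d, ∀ b ∈ pts d, a < b → bl (rowW m n A) a = bl (rowW m n A) b →
        g⁻¹.1 b < g⁻¹.1 a) := by
  obtain ⟨w, hw⟩ := exists_kappa_eq hA
  have := exists_longest (rowW_mem hA) (colW_mem hA) w
  rwa [hw] at this

open Classical in
/-- The longest element of the double coset which belongs to `A`. -/
def maxRep (m n d : ℕ) (A : ℤ → ℤ → ℕ) : weylB d :=
  if h : A ∈ Xi m n d then (exists_maxRep h).choose else 1

lemma maxRep_spec {A : ℤ → ℤ → ℕ} (hA : A ∈ Xi m n d) :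
    kappa (rowW m n A) (maxRep m n d A) (colW m n A) = A ∧
      (∀ u : weylB d, kappa (rowW m n A) u (colW m n A) = A → len u ≤ len (maxRep m n d A)) ∧
      (∀ a ∈ pts d, ∀ b ∈ pts d, a < b → bl (colW m n A) a = bl (colW m n A) b →
        (maxRep m n d A).1 b < (maxRep m n d A).1 a) ∧
      (∀ a ∈ pts d, ∀ b ∈ pts d, a < b → bl (rowW m n A) a = bl (rowW m n A) b →
        (maxRep m n d A)⁻¹.1 b < (maxRep m n d A)⁻¹.1 a) := by
  rw [maxRep, dif_pos hA]; exact (exists_maxRep hA).choose_spec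

/-- The length of the longest element of a double coset, in which odd inversions count
negatively. -/
def topLen (m n d : ℕ) (A : ℤ → ℤ → ℕ) : ℤ :=
  len (maxRep m n d A) - 2 * oddLen (rowW m n A) (colW m n A) (maxRep m n d A)

lemma invert_negQ_mul (N : ℕ) : negQ N * LaurentPolynomial.invert (negQ N) = 1 := by
  rw [negQ, map_mul, map_pow, map_neg, map_one, LaurentPolynomial.invert_T]
  linear_combination vpow (-2 * (N : ℤ)) * vpow (-(-2 * (N : ℤ))) * sign_mul_self N +
    vpow_mul_neg (-2 * (N : ℤ))

lemma invert_negQ_mul_self (N : ℕ) :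
    LaurentPolynomial.invert (negQ N) * LaurentPolynomial.invert (negQ N) =
      vpow (4 * (N : ℤ)) := by
  rw [negQ, map_mul, map_pow, map_neg, map_one, LaurentPolynomial.invert_T]
  have h : vpow (4 * (N : ℤ)) = vpow (-(-2 * (N : ℤ))) * vpow (-(-2 * (N : ℤ))) := by
    rw [← LaurentPolynomial.T_add]; congr 1; ring
  rw [h]
  linear_combination vpow (-(-2 * (N : ℤ))) * vpow (-(-2 * (N : ℤ))) * sign_mul_self N

/-- The conjugate is again a two-sided eigenvector, so its coefficient at the longest element is
`(-q)^(-N)` times the one sought. The former is known, and the two occurrences of `(-q)^N` combine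
to `v^{4N}`. -/
theorem coef_bar_minRep {A : ℤ → ℤ → ℕ} (hA : A ∈ Xi m n d) :
    coef (heckeBar d (cosetElt d (rowW m n A) (colW m n A) A)) (minRep m n d A) =
      vpow (-2 * topLen m n d A) := by
  obtain ⟨h1, h2, -⟩ := maxRep_spec hA
  have hl := rowW_mem hA
  have hm := colW_mem hA
  have h3 := coef_eq_of_eig hl hm (isLeftEig_cosetElt hl hm A).bar
    (isRightEig_cosetElt hl hm (Xi_le_one hA)).bar (maxRep m n d A)
  rw [h1, if_pos hA, coef_bar_longest h1 h2, cosetFun, if_pos h1] at h3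
  set N := oddLen (rowW m n A) (colW m n A) (maxRep m n d A) with hN
  have h4 : vpow (-2 * topLen m n d A) =
      vpow (4 * (N : ℤ)) * vpow (-2 * (len (maxRep m n d A) : ℤ)) := by
    rw [← LaurentPolynomial.T_add, topLen]; congr 1; ring
  rw [h4, ← invert_negQ_mul_self]
  linear_combination -LaurentPolynomial.invert (negQ N) * h3 -
    coef (heckeBar d (cosetElt d (rowW m n A) (colW m n A) A)) (minRep m n d A) *
      invert_negQ_mul N

/-- The diagonal matrix of `μ`. -/
def diagMat (d : ℕ) (mu : Comp m n) : ℤ → ℤ → ℕ := kappa mu (1 : weylB d) mu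

lemma diagMat_mem {mu : Comp m n} (hm : mu ∈ Lam m n d) : diagMat d mu ∈ Xi m n d :=
  kappa_mem_Xi hm hm _ fun _ _ => kappa_le_one_of_DDo hm hm (one_mem_DDo hm)

lemma rowW_diagMat {mu : Comp m n} (hm : mu ∈ Lam m n d) : rowW m n (diagMat d mu) = mu :=
  rowW_kappa hm hm _

lemma colW_diagMat {mu : Comp m n} (hm : mu ∈ Lam m n d) : colW m n (diagMat d mu) = mu :=
  colW_kappa hm hm _

lemma diagMat_algLe {mu : Comp m n} (hm : mu ∈ Lam m n d) (w : weylB d) :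
    algLe m n (diagMat d mu) (kappa mu w mu) := by
  refine ⟨by rw [rowW_diagMat hm, rowW_kappa hm hm], by rw [colW_diagMat hm, colW_kappa hm hm],
    fun i _ j _ hij => ?_⟩
  have : sig m n (diagMat d mu) i j = 0 :=
    Finset.sum_eq_zero fun x hx => Finset.sum_eq_zero fun y hy => kappa_one hm (by
      rw [Finset.mem_filter] at hx hy
      omega)
  rw [this]
  exact Nat.zero_le _

/-- `[xy]_μ` belongs to the diagonal matrix, which is the least one with its row and column sums;
triangularity leaves nothing below it. -/
theorem heckeBar_xy {mu : Comp m n} (hm : mu ∈ Lam m n d) :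
    heckeBar d (xy d mu) = vpow (-2 * topLen m n d (diagMat d mu)) • xy d mu := by
  have hI := diagMat_mem (d := d) hm
  have hxy : xy d mu = cosetElt d mu mu (diagMat d mu) := xy_eq_cosetElt hm
  refine coef_injective (funext fun w => ?_)
  rw [map_smul, Pi.smul_apply, smul_eq_mul,
    coef_eq_of_eig hm hm (isLeftEig_xy hm).bar (isRightEig_xy hm).bar]
  by_cases h : kappa mu w mu = diagMat d mu
  · have h1 := coef_bar_minRep hI
    rw [rowW_diagMat hm, colW_diagMat hm, ← hxy] at h1
    rw [h, if_pos hI, h1]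
    conv_rhs => rw [hxy, coef_cosetElt]
  · have h2 : coef (xy d mu) w = 0 := by
      rw [hxy, coef_cosetElt, cosetFun, if_neg h]
    rw [h2, mul_zero]
    split_ifs with h3
    · by_contra hne
      have h4 := left_ne_zero_of_mul hne
      rw [hxy] at h4
      obtain ⟨u, hu, hr⟩ := exists_rankLe_of_coef_bar h4
      have h5 := hr.algLe hm hm
      have h6 := kappa_minRep h3
      rw [rowW_kappa hm hm, colW_kappa hm hm] at h6
      rw [h6, hu] at h5
      exact h (algLe_antisymm h3 hI h5 (diagMat_algLe hm w))
    · rfl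

end

end

end IotaSchur

namespace IotaSchur

noncomputable section

/-! ### The bar involution of the Schur superalgebra -/

section

variable {m n d : ℕ} {P : Set (Comp m n)}

lemma IsLeftEig.smul {lam : Comp m n} {z : Hecke d} (hz : IsLeftEig lam z) (c : Lau) :
    IsLeftEig lam (c • z) := fun k hk => by
  rw [mul_smul_comm, hz k hk, smul_comm]

lemma IsRightEig.smul {lam : Comp m n} {z : Hecke d} (hz : IsRightEig lam z) (c : Lau) :
    IsRightEig lam (c • z) := fun k hk => by
  rw [smul_mul_assoc, hz k hk, smul_comm]

/-- The conjugate of `[xy]_λ` is a power of `v` times `[xy]_λ`, so `f'` is determined on the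
generators, and its bar condition can be read entry by entry. -/
lemma isBar_iff (hP : P ⊆ Lam m n d) (f f' : Schur d P) : IsBar f f' ↔ ∀ lam mu : P,
    vpow (-2 * topLen m n d (diagMat d lam.1)) • genEntry lam mu f' =
      heckeBar d (genEntry lam mu f) := by
  have key : ∀ (lam : P) (y : xyMod d lam.1), (y : Hecke d) = heckeBar d (xy d lam.1) →
      ∀ mu, entry f' lam mu y =
        vpow (-2 * topLen m n d (diagMat d lam.1)) • genEntry lam mu f' := by
    intro lam y hy mu
    have : y = vpow (-2 * topLen m n d (diagMat d lam.1)) • xyGen d lam.1 :=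
      Subtype.ext (hy.trans (heckeBar_xy (hP lam.2)))
    rw [this, entry_scalar_smul]
    rfl
  constructor
  · intro h lam mu
    obtain ⟨y, hy, h1⟩ := h lam
    rw [← key lam y hy]
    exact h1 mu
  · intro h lam
    refine ⟨⟨heckeBar d (xy d lam.1), ?_⟩, rfl, fun mu => ?_⟩
    · rw [heckeBar_xy (hP lam.2)]
      exact smul_mem_xyMod (Submodule.subset_span rfl) _
    · rw [key _ _ rfl]
      exact h lam mu

theorem genEntry_schurBar (hP : P ⊆ Lam m n d) (f : Schur d P) (lam mu : P) :
    genEntry lam mu (schurBar f) =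
      vpow (2 * topLen m n d (diagMat d lam.1)) • heckeBar d (genEntry lam mu f) := by
  obtain ⟨f', hf'⟩ := exists_genEntry hP
    (fun lam mu => vpow (2 * topLen m n d (diagMat d lam.1)) • heckeBar d (genEntry lam mu f))
    (fun lam mu => (isLeftEig_genEntry hP f lam mu).bar.smul _)
    (fun lam mu => (isRightEig_genEntry hP f lam mu).bar.smul _)
  have hex : ∃ f', IsBar f f' := ⟨f', (isBar_iff hP f f').2 fun lam mu => by
    rw [hf', smul_smul, neg_mul, vpow_neg_mul, one_smul]⟩
  have h := (isBar_iff hP f _).1 (Classical.epsilon_spec hex) lam mu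
  rw [← h, smul_smul, neg_mul, vpow_mul_neg, one_smul]
  rfl

lemma schurBar_add (hP : P ⊆ Lam m n d) (f f' : Schur d P) :
    schurBar (f + f') = schurBar f + schurBar f' :=
  genEntry_ext hP fun lam mu => by
    simp only [map_add, genEntry_schurBar hP, smul_add]

lemma schurBar_smul (hP : P ⊆ Lam m n d) (c : Lau) (f : Schur d P) :
    schurBar (c • f) = LaurentPolynomial.invert c • schurBar f :=
  genEntry_ext hP fun lam mu => by
    simp only [map_smul, genEntry_schurBar hP, heckeBar_smul]
    rw [smul_comm]

lemma schurBar_schurBar (hP : P ⊆ Lam m n d) (f : Schur d P) : schurBar (schurBar f) = f :=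
  genEntry_ext hP fun lam mu => by
    rw [genEntry_schurBar hP, genEntry_schurBar hP, heckeBar_smul, heckeBar_heckeBar, smul_smul,
      LaurentPolynomial.invert_T, vpow_mul_neg, one_smul]

lemma schurIncl_schurBar {Q : Set (Comp m n)} (hQ : Q ⊆ Lam m n d) (h : P ⊆ Q)
    (f : Schur d P) : schurIncl d h (schurBar f) = schurBar (schurIncl d h f) :=
  genEntry_ext hQ fun lam mu => by
    rw [genEntry_schurBar hQ, genEntry_schurIncl, genEntry_schurIncl]
    split_ifs with hlm
    · rw [genEntry_schurBar (h.trans hQ)]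
    · rw [map_zero, smul_zero]

lemma algLe_of_eCoord_schurBar (hP : P ⊆ Lam m n d) {A B : XiOf m n d P}
    (h : eCoord B (schurBar (eStd d P A.1)) ≠ 0) : algLe m n B.1 A.1 := by
  rw [eCoord_apply, genEntry_schurBar hP, genEntry_eStd hP A.2.1] at h
  split_ifs at h with h1
  · dsimp only at h1
    rw [map_smul, Pi.smul_apply] at h
    obtain ⟨w, hw, hr⟩ := exists_rankLe_of_coef_bar (right_ne_zero_of_smul h)
    have h2 := hr.algLe (rowW_mem A.2.1) (colW_mem A.2.1)
    have h3 := kappa_minRep B.2.1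
    rw [h1.1, h1.2] at h3
    rwa [h3, hw] at h2
  · rw [map_zero, smul_zero, map_zero, Pi.zero_apply] at h
    exact absurd rfl h

lemma eCoord_schurBar_self (hP : P ⊆ Lam m n d) (A : XiOf m n d P) :
    eCoord A (schurBar (eStd d P A.1)) =
      vpow (2 * topLen m n d (diagMat d (colW m n A.1)) - 2 * topLen m n d A.1) := by
  rw [eCoord_apply, genEntry_schurBar hP, genEntry_eStd hP A.2.1, if_pos ⟨rfl, rfl⟩, map_smul,
    Pi.smul_apply, coef_bar_minRep A.2.1, smul_eq_mul, ← LaurentPolynomial.T_add]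
  congr 1
  ring

end

end

end IotaSchur

namespace IotaSchur

noncomputable section

/-! ### Lengths in terms of matrices -/

section

variable {m n d : ℕ}

/-- A sum over all pairs of points. -/
def pairSum (d : ℕ) (φ : ℤ → ℤ → ℤ) : ℤ := ∑ u ∈ pts d, ∑ y ∈ pts d, φ u y

lemma pairSum_add (φ ψ : ℤ → ℤ → ℤ) :
    pairSum d (fun u y => φ u y + ψ u y) = pairSum d φ + pairSum d ψ := by
  simp only [pairSum, Finset.sum_add_distrib]

lemma pairSum_swap (φ : ℤ → ℤ → ℤ) : pairSum d (fun u y => φ y u) = pairSum d φ :=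
  Finset.sum_comm

lemma sum_pts_neg (f : ℤ → ℤ) : ∑ u ∈ pts d, f (-u) = ∑ u ∈ pts d, f u :=
  Finset.sum_nbij' (fun u => -u) (fun u => -u) (fun _ h => neg_mem_pts.2 h)
    (fun _ h => neg_mem_pts.2 h) (fun _ _ => neg_neg _) (fun _ _ => neg_neg _) fun _ _ => rfl

lemma pairSum_neg (φ : ℤ → ℤ → ℤ) : pairSum d (fun u y => φ (-u) (-y)) = pairSum d φ := by
  unfold pairSum
  rw [← sum_pts_neg fun u => ∑ y ∈ pts d, φ u y]
  exact Finset.sum_congr rfl fun u _ => sum_pts_neg fun y => φ (-u) y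

lemma pairSum_congr {φ ψ : ℤ → ℤ → ℤ} (h : ∀ u ∈ pts d, ∀ y ∈ pts d, φ u y = ψ u y) :
    pairSum d φ = pairSum d ψ :=
  Finset.sum_congr rfl fun u hu => Finset.sum_congr rfl fun y hy => h u hu y hy

lemma four_len_eq (w : weylB d) :
    (4 * len w : ℤ) = pairSum d fun u y => if u ≠ 0 ∧ Inverted w.1 u y then 1 else 0 := by
  have h : invPairs w = (pts d ×ˢ pts d).filter fun p => p.1 ≠ 0 ∧ Inverted w.1 p.1 p.2 := by
    ext ⟨u, y⟩
    simp only [invPairs, Finset.mem_filter, Finset.mem_product, Finset.mem_erase]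
    exact ⟨fun ⟨⟨⟨h1, h2⟩, h3⟩, h4⟩ => ⟨⟨h2, h3⟩, h1, h4⟩,
      fun ⟨⟨h2, h3⟩, h1, h4⟩ => ⟨⟨⟨h1, h2⟩, h3⟩, h4⟩⟩
  have h1 := card_invPairs w
  rw [h, Finset.card_filter, Finset.sum_product] at h1
  rw [pairSum]
  exact_mod_cast h1.symm

/-- The points `u ≠ y` lie in a common odd block for `λ` or `μ`. -/
def OddAbs (lam mu : Comp m n) (w : weylB d) (u y : ℤ) : Prop :=
  u ≠ y ∧ ((bl lam (w.1 u) = bl lam (w.1 y) ∧ (m : ℤ) < |bl lam (w.1 u)|) ∨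
    (bl mu u = bl mu y ∧ (m : ℤ) < |bl mu u| ∧ bl lam (w.1 u) ≠ bl lam (w.1 y)))

instance (lam mu : Comp m n) (w : weylB d) (u y : ℤ) : Decidable (OddAbs lam mu w u y) := by
  unfold OddAbs; infer_instance

/-- If `w` decreases on all blocks, every pair in a common block is inverted, and only membership in
odd blocks remains to be counted. The factor four comes from the two orders of a pair and from its
opposite. -/
lemma four_oddLen_eq {lam mu : Comp m n} {w : weylB d}
    (h1 : ∀ a ∈ pts d, ∀ b ∈ pts d, a < b → bl mu a = bl mu b → w.1 b < w.1 a)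
    (h2 : ∀ a ∈ pts d, ∀ b ∈ pts d, a < b → bl lam a = bl lam b → w⁻¹.1 b < w⁻¹.1 a) :
    (4 * oddLen lam mu w : ℤ) = pairSum d fun u y => if OddAbs lam mu w u y then 1 else 0 := by
  set c : ℤ → ℤ → ℤ := fun u y => if u < y ∧ OddCond lam mu w u y then 1 else 0 with hc
  have h3 : ∀ a ∈ pts d, ∀ b ∈ pts d, a < b → bl lam (w.1 a) = bl lam (w.1 b) →
      w.1 b < w.1 a := by
    intro a ha b hb hab h
    by_contra hcon
    have h4 : w.1 a ≠ w.1 b := fun he => hab.ne (w.1.injective he)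
    have h5 := h2 _ ((weylB_mem_pts w).2 ha) _ ((weylB_mem_pts w).2 hb) (by omega) h
    rw [inv_val_apply_val, inv_val_apply_val] at h5
    omega
  have hodd : (oddLen lam mu w : ℤ) = pairSum d c := by
    have h4 : oddPairs lam mu w =
        (pts d ×ˢ pts d).filter fun p => p.1 < p.2 ∧ OddCond lam mu w p.1 p.2 := by
      refine Finset.filter_congr fun p hp => and_congr_right fun hlt => and_iff_right_of_imp ?_
      rw [Finset.mem_product] at hp
      rintro (h | h)
      · exact h3 _ hp.1 _ hp.2 hlt h.1
      · exact h1 _ hp.1 _ hp.2 hlt h.1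
    rw [oddLen, h4, Finset.card_filter, Finset.sum_product, pairSum]
    push_cast
    rfl
  have h4 : pairSum d (fun u y => if OddAbs lam mu w u y then 1 else 0) =
      pairSum d (fun u y => (c u y + c y u) + (c (-u) (-y) + c (-y) (-u))) := by
    refine pairSum_congr fun u _ y _ => ?_
    have c1 : ∀ a b, OddCond lam mu w a b ↔
      ((bl lam (w.1 a) = bl lam (w.1 b) ∧ (m : ℤ) < bl lam (w.1 a)) ∨
        (bl mu a = bl mu b ∧ (m : ℤ) < bl mu a ∧ bl lam (w.1 a) ≠ bl lam (w.1 b))) :=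
      fun _ _ => Iff.rfl
    have c2 : OddAbs lam mu w u y ↔
      (u ≠ y ∧ ((bl lam (w.1 u) = bl lam (w.1 y) ∧ (m : ℤ) < |bl lam (w.1 u)|) ∨
        (bl mu u = bl mu y ∧ (m : ℤ) < |bl mu u| ∧ bl lam (w.1 u) ≠ bl lam (w.1 y)))) := Iff.rfl
    have hm0 : (0 : ℤ) ≤ m := Int.natCast_nonneg m
    simp only [hc, c1, c2, bl_neg, weylB_neg, lt_abs]
    clear c1 c2 hodd hc
    generalize bl lam (w.1 u) = X
    generalize bl lam (w.1 y) = X'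
    generalize bl mu u = Y
    generalize bl mu y = Y'
    split_ifs <;> omega
  rw [h4, pairSum_add, pairSum_add, pairSum_add, pairSum_swap c, pairSum_neg c,
    pairSum_neg fun u y => c y u, pairSum_swap c, hodd]
  ring

/-- The block positions of two points are strictly inverted. -/
def StrictInv (i j i' j' : ℤ) : Prop := (i' < i ∧ j < j') ∨ (i < i' ∧ j' < j)

instance (i j i' j' : ℤ) : Decidable (StrictInv i j i' j') := by
  unfold StrictInv; infer_instance

/-- The sign of the parity of a block. -/
def parSign (m : ℕ) (i : ℤ) : ℤ := if |i| ≤ m then 1 else -1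

lemma parSign_neg (m : ℕ) (i : ℤ) : parSign m (-i) = parSign m i := by
  unfold parSign; rw [abs_neg]

lemma label_sum {lam mu : Comp m n} (hl : lam ∈ Lam m n d) (hm : mu ∈ Lam m n d) (w : weylB d)
    (G : ℤ → ℤ → ℤ) : ∑ u ∈ pts d, G (bl lam (w.1 u)) (bl mu u) =
      ∑ p ∈ II m n ×ˢ II m n, (kappa lam w mu p.1 p.2 : ℤ) * G p.1 p.2 := by
  rw [← Finset.sum_fiberwise_of_maps_to (g := fun u => (bl lam (w.1 u), bl mu u))
    (t := II m n ×ˢ II m n) fun u _ => Finset.mem_product.2 ⟨bl_mem_II _ _, bl_mem_II _ _⟩]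
  refine Finset.sum_congr rfl fun p _ => ?_
  rw [Finset.sum_congr rfl (g := fun _ => G p.1 p.2) fun u hu => by
    rw [← (Finset.mem_filter.1 hu).2], Finset.sum_const, nsmul_eq_mul, kappa_apply hl hm]
  congr 3
  ext u
  simp only [Finset.mem_filter, Prod.ext_iff]
  exact and_congr_right fun _ => and_comm

lemma mem_Ic {p : ℤ × ℤ} : p ∈ Ic m n ↔ p ∈ II m n ×ˢ II m n ∧ (0 < p.1 ∨ p.1 = 0 ∧ 0 ≤ p.2) :=
  Finset.mem_filter

lemma zero_mem_Ic : ((0, 0) : ℤ × ℤ) ∈ Ic m n := by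
  have h : (0 : ℤ) ∈ II m n := by rw [II, Finset.mem_Icc]; omega
  exact mem_Ic.2 ⟨Finset.mem_product.2 ⟨h, h⟩, Or.inr ⟨rfl, le_rfl⟩⟩

/-- `I_c` and its negative cover all positions and share only `(0, 0)`. Subtracting `G 0 0` removes
the single point `0`; what remains at `(0, 0)` is twice `a^♮_{00}`. -/
lemma Ic_sum {A : ℤ → ℤ → ℕ} (hA : A ∈ Xi m n d) {G : ℤ → ℤ → ℤ}
    (hG : ∀ i j, G (-i) (-j) = G i j) :
    ∑ p ∈ II m n ×ˢ II m n, (A p.1 p.2 : ℤ) * G p.1 p.2 - G 0 0 =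
      2 * ∑ p ∈ Ic m n, (natural A p.1 p.2 : ℤ) * G p.1 p.2 := by
  set F : ℤ × ℤ → ℤ := fun p => (A p.1 p.2 : ℤ) * G p.1 p.2 with hF
  have h1 : ∑ p ∈ II m n ×ˢ II m n, F p =
      ∑ p ∈ Ic m n, F p + ∑ p ∈ (Ic m n).erase (0, 0), F p := by
    rw [← Finset.sum_filter_add_sum_filter_not (II m n ×ˢ II m n)
      fun p => 0 < p.1 ∨ (p.1 = 0 ∧ 0 ≤ p.2)]
    congr 1
    refine Finset.sum_nbij' (fun p => -p) (fun p => -p) ?_ ?_ (fun _ _ => neg_neg _)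
      (fun _ _ => neg_neg _) ?_
    · rintro ⟨i, j⟩ hp
      rw [Finset.mem_filter, Finset.mem_product] at hp
      rw [Finset.mem_erase, mem_Ic, Finset.mem_product]
      dsimp only [Prod.neg_mk] at hp ⊢
      rw [neg_mem_II, neg_mem_II]
      refine ⟨fun h => ?_, hp.1, by omega⟩
      rw [Prod.mk.injEq] at h
      omega
    · rintro ⟨i, j⟩ hp
      rw [Finset.mem_erase, mem_Ic, Finset.mem_product] at hp
      rw [Finset.mem_filter, Finset.mem_product]
      dsimp only [Prod.neg_mk] at hp ⊢
      rw [neg_mem_II, neg_mem_II]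
      refine ⟨hp.2.1, ?_⟩
      have := hp.1
      rw [ne_eq, Prod.mk.injEq] at this
      omega
    · rintro ⟨i, j⟩ _
      simp only [hF, Prod.neg_mk]
      rw [hG, ← hA.2.2.1]
  have h2 := Finset.add_sum_erase (Ic m n) F zero_mem_Ic
  have h3 := Finset.add_sum_erase (Ic m n) (fun p => (natural A p.1 p.2 : ℤ) * G p.1 p.2)
    zero_mem_Ic
  have h4 : ∑ p ∈ (Ic m n).erase (0, 0), (natural A p.1 p.2 : ℤ) * G p.1 p.2 =
      ∑ p ∈ (Ic m n).erase (0, 0), F p := by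
    refine Finset.sum_congr rfl fun p hp => ?_
    rw [natural, if_neg]
    rintro ⟨e1, e2⟩
    exact (Finset.mem_erase.1 hp).1 (Prod.ext e1 e2)
  have h5 : (A 0 0 : ℤ) = 2 * (natural A 0 0 : ℤ) + 1 := by
    have := Xi_zero_odd hA
    rw [natural, if_pos ⟨rfl, rfl⟩]
    omega
  rw [h1, ← h3, h4, ← h2]
  simp only [hF]
  rw [h5]
  ring

/-- Sums over pairs of points in terms of block positions. -/
lemma pairSum_labels {A : ℤ → ℤ → ℕ} (hA : A ∈ Xi m n d) {w : weylB d}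
    (hw : kappa (rowW m n A) w (colW m n A) = A) {φ : ℤ → ℤ → ℤ → ℤ → ℤ}
    (hφ : ∀ i j i' j', φ (-i) (-j) (-i') (-j') = φ i j i' j') :
    (pairSum d fun u y => if u ≠ 0 then φ (bl (rowW m n A) (w.1 u)) (bl (colW m n A) u)
      (bl (rowW m n A) (w.1 y)) (bl (colW m n A) y) else 0) =
      2 * ∑ p ∈ Ic m n, (natural A p.1 p.2 : ℤ) *
        ∑ r ∈ II m n ×ˢ II m n, (A r.1 r.2 : ℤ) * φ p.1 p.2 r.1 r.2 := by
  have hl := rowW_mem hA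
  have hm := colW_mem hA
  set G : ℤ → ℤ → ℤ := fun i j => ∑ r ∈ II m n ×ˢ II m n, (A r.1 r.2 : ℤ) * φ i j r.1 r.2 with hG
  have hG1 : ∀ i j, G i j =
      ∑ y ∈ pts d, φ i j (bl (rowW m n A) (w.1 y)) (bl (colW m n A) y) := fun i j => by
    rw [label_sum hl hm w fun i' j' => φ i j i' j', hw]
  have hGneg : ∀ i j, G (-i) (-j) = G i j := fun i j => by
    rw [hG1, hG1, ← sum_pts_neg]
    refine Finset.sum_congr rfl fun y _ => ?_
    rw [weylB_neg, bl_neg, bl_neg, hφ]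
  have h1 := label_sum hl hm w G
  rw [hw] at h1
  rw [← Ic_sum hA hGneg, ← h1, pairSum, ← Finset.add_sum_erase _ _ (zero_mem_pts d),
    ← Finset.add_sum_erase (pts d) (fun u => G _ _) (zero_mem_pts d), weylB_zero, bl_zero, bl_zero,
    add_sub_cancel_left]
  simp only [ne_eq, not_true_eq_false, if_false, Finset.sum_const_zero, zero_add]
  refine Finset.sum_congr rfl fun u hu => ?_
  rw [hG1]
  refine Finset.sum_congr rfl fun y _ => ?_
  rw [if_pos (Finset.ne_of_mem_erase hu)]

/-- The contribution of the strict inversions. -/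
lemma four_len_minRep {A : ℤ → ℤ → ℕ} (hA : A ∈ Xi m n d) :
    (4 * len (minRep m n d A) : ℤ) = 2 * ∑ p ∈ Ic m n, (natural A p.1 p.2 : ℤ) *
        ∑ r ∈ II m n ×ˢ II m n, (A r.1 r.2 : ℤ) *
          if StrictInv p.1 p.2 r.1 r.2 then 1 else 0 := by
  have hg := (minRep_mem hA).1
  rw [← pairSum_labels hA (kappa_minRep hA)
    (φ := fun i j i' j' => if StrictInv i j i' j' then 1 else 0) fun i j i' j' => by
      simp only [StrictInv, neg_lt_neg_iff]
      exact if_congr or_comm rfl rfl, four_len_eq]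
  refine pairSum_congr fun u _ y _ => ?_
  set w := minRep m n d A
  by_cases hu : u ≠ 0
  · simp only [hu, ne_eq, not_false_eq_true, true_and, if_true]
    refine if_congr ?_ rfl rfl
    -- The shortest element increases on the blocks of both sides, so two points are inverted
    -- exactly if their positions are strictly inverted.
    have e1 := DD_right hg (a := u) (b := y)
    have e2 := DD_right hg (a := y) (b := u)
    have e3 := DD_left hg (a := w.1 u) (b := w.1 y)
    have e4 := DD_left hg (a := w.1 y) (b := w.1 u)
    rw [inv_val_apply_val, inv_val_apply_val] at e3 e4
    have m1 := @bl_mono _ _ (colW m n A) u y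
    have m2 := @bl_mono _ _ (colW m n A) y u
    have m3 := @bl_mono _ _ (rowW m n A) (w.1 u) (w.1 y)
    have m4 := @bl_mono _ _ (rowW m n A) (w.1 y) (w.1 u)
    have inj : w.1 u = w.1 y → u = y := fun h => w.1.injective h
    unfold Inverted StrictInv
    omega
  · simp only [hu, false_and, if_false]

/-- The contribution of the inversions in blocks of `μ`. -/
def colPairs (d : ℕ) (mu : Comp m n) : ℤ := pairSum d fun u y =>
  if u ≠ 0 ∧ u ≠ y ∧ bl mu u = bl mu y then parSign m (bl mu u) else 0

lemma NoMixed_of_Xi {A : ℤ → ℤ → ℕ} (hA : A ∈ Xi m n d) {w : weylB d}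
    (hw : kappa (rowW m n A) w (colW m n A) = A) : NoMixed (rowW m n A) w (colW m n A) := by
  rw [noMixed_iff (rowW_mem hA) (colW_mem hA), hw]
  exact Xi_le_one hA

/-- For the longest element the inverted pairs are the strictly inverted ones and all those in a
common block. In `topLen` a pair in an odd block has weight `1 - 2 = -1`, which produces the sign of
the parity. A pair sharing blocks on both sides is attributed to the column, as parities agree by
`NoMixed`. -/
lemma four_topLen_eq {A : ℤ → ℤ → ℕ} (hA : A ∈ Xi m n d) :
    4 * topLen m n d A =
      (pairSum d fun u y => if u ≠ 0 then
        (if StrictInv (bl (rowW m n A) ((maxRep m n d A).1 u)) (bl (colW m n A) u)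
          (bl (rowW m n A) ((maxRep m n d A).1 y)) (bl (colW m n A) y) then 1 else 0) +
        (if bl (rowW m n A) ((maxRep m n d A).1 u) = bl (rowW m n A) ((maxRep m n d A).1 y) ∧
          bl (colW m n A) u ≠ bl (colW m n A) y then
            parSign m (bl (rowW m n A) ((maxRep m n d A).1 u)) else 0) else 0) +
      colPairs d (colW m n A) := by
  obtain ⟨h0, -, h1, h2⟩ := maxRep_spec hA
  have hmix := NoMixed_of_Xi hA h0
  have e1 := four_len_eq (maxRep m n d A)
  have e2 := four_oddLen_eq h1 h2
  have e3 : 4 * topLen m n d A = pairSum d fun u y =>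
      (if u ≠ 0 ∧ Inverted (maxRep m n d A).1 u y then 1 else 0) +
      -2 * (if OddAbs (rowW m n A) (colW m n A) (maxRep m n d A) u y then 1 else 0) := by
    rw [pairSum_add, ← e1]
    have : pairSum d (fun u y => -2 * (if OddAbs (rowW m n A) (colW m n A) (maxRep m n d A) u y
        then 1 else 0)) = -2 * (4 * oddLen (rowW m n A) (colW m n A) (maxRep m n d A) : ℤ) := by
      rw [e2, pairSum, pairSum]
      simp only [Finset.mul_sum]
    rw [this, topLen]
    ring
  rw [e3, colPairs, ← pairSum_add]
  refine pairSum_congr fun u hu y hy => ?_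
  set w := maxRep m n d A
  have d1 := h1 u hu y hy
  have d2 := h1 y hy u hu
  have d3 := h2 _ ((weylB_mem_pts w).2 hu) _ ((weylB_mem_pts w).2 hy)
  have d4 := h2 _ ((weylB_mem_pts w).2 hy) _ ((weylB_mem_pts w).2 hu)
  rw [inv_val_apply_val, inv_val_apply_val] at d3 d4
  have m1 := @bl_mono _ _ (colW m n A) u y
  have m2 := @bl_mono _ _ (colW m n A) y u
  have m3 := @bl_mono _ _ (rowW m n A) (w.1 u) (w.1 y)
  have m4 := @bl_mono _ _ (rowW m n A) (w.1 y) (w.1 u)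
  have inj : w.1 u = w.1 y → u = y := fun h => w.1.injective h
  have hx := hmix u hu y hy
  have hw0 : u = 0 → bl (rowW m n A) (w.1 u) = 0 := fun h => by rw [h, weylB_zero, bl_zero]
  have hu0 : u = 0 → bl (colW m n A) u = 0 := fun h => by rw [h, bl_zero]
  rw [abs_le, abs_le] at hx
  have c1 : ∀ i j i' j', StrictInv i j i' j' ↔ (i' < i ∧ j < j') ∨ (i < i' ∧ j' < j) :=
    fun _ _ _ _ => Iff.rfl
  have c2 : OddAbs (rowW m n A) (colW m n A) w u y ↔ u ≠ y ∧
      ((bl (rowW m n A) (w.1 u) = bl (rowW m n A) (w.1 y) ∧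
        (m : ℤ) < |bl (rowW m n A) (w.1 u)|) ∨
      (bl (colW m n A) u = bl (colW m n A) y ∧ (m : ℤ) < |bl (colW m n A) u| ∧
        bl (rowW m n A) (w.1 u) ≠ bl (rowW m n A) (w.1 y))) := Iff.rfl
  have c3 : Inverted w.1 u y ↔ (u < y ∧ w.1 y < w.1 u) ∨ (y < u ∧ w.1 u < w.1 y) := Iff.rfl
  have hXY : u = y → bl (rowW m n A) (w.1 u) = bl (rowW m n A) (w.1 y) ∧
      bl (colW m n A) u = bl (colW m n A) y := fun h => by rw [h]; exact ⟨rfl, rfl⟩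
  simp only [parSign, c1, c2, c3, lt_abs, abs_le]
  clear c1 c2 c3 e1 e2 e3 hmix h1 h2
  generalize bl (rowW m n A) (w.1 u) = X at *
  generalize bl (rowW m n A) (w.1 y) = X' at *
  generalize bl (colW m n A) u = Y at *
  generalize bl (colW m n A) y = Y' at *
  generalize w.1 u = wu at *
  generalize w.1 y = wy at *
  have hm0 : (0 : ℤ) ≤ m := Int.natCast_nonneg m
  generalize (m : ℤ) = M at *
  clear hA h0 hu hy
  -- The longest element decreases on common blocks, and monotone labels settle the order of points
  -- in different blocks.
  have hinv : u ≠ y → ((u < y ∧ wy < wu ∨ y < u ∧ wu < wy) ↔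
      (X = X' ∨ Y = Y' ∨ (X' < X ∧ Y < Y' ∨ X < X' ∧ Y' < Y))) := by
    intro hne
    rcases lt_or_gt_of_ne hne with h | h
    · clear hx; omega
    · clear hx; omega
  clear d1 d2 d3 d4 m1 m2 m3 m4 inj
  by_cases hz : u = 0
  · replace hw0 := hw0 hz
    replace hu0 := hu0 hz
    subst hw0 hu0
    simp only [hz, ne_eq, not_true_eq_false, false_and, if_false, zero_add]
    rw [if_neg (by omega)]
    rfl
  by_cases h : u = y
  · obtain ⟨hX, hY⟩ := hXY h
    subst h hX hY
    simp only [hz, ne_eq, not_true_eq_false, not_false_eq_true, lt_irrefl, false_and, and_false,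
      or_false, if_false, if_true, mul_zero, add_zero]
  replace hinv := hinv h
  replace hx := hx h
  simp only [hinv, hz, h, ne_eq, not_false_eq_true, true_and, if_true]
  by_cases hX : X = X' <;> by_cases hY : Y = Y'
  · subst hX hY
    replace hx := hx rfl rfl
    simp only [if_true, lt_irrefl, and_false, or_false, if_false, true_and, not_true_eq_false,
      zero_add, or_self]
    split_ifs <;> omega
  · subst hX
    simp only [hY, if_true, lt_irrefl, false_and, and_false, or_false, if_false, true_and,
      not_true_eq_false, not_false_eq_true, zero_add, or_self, add_zero]
    split_ifs <;> omega
  · subst hY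
    simp only [hX, or_true, if_true, lt_irrefl, false_and, and_false, or_false, if_false,
      true_and, not_true_eq_false, not_false_eq_true, zero_add, or_self, false_or, and_true]
    split_ifs <;> omega
  · simp only [hX, hY, false_or, false_and, or_self, if_false, mul_zero, add_zero]

/-- For the diagonal matrix both labels of a point coincide, so no pair is strictly inverted or
shares a row block but not a column block. -/
lemma four_topLen_diagMat {mu : Comp m n} (hm : mu ∈ Lam m n d) :
    4 * topLen m n d (diagMat d mu) = colPairs d mu := by
  have hI := diagMat_mem (d := d) hm
  have h0 := (maxRep_spec hI).1
  have h1 := four_topLen_eq hI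
  rw [rowW_diagMat hm, colW_diagMat hm] at h0 h1
  set w := maxRep m n d (diagMat d mu)
  have hbl : ∀ u ∈ pts d, bl mu (w.1 u) = bl mu u := fun u hu => by
    by_contra hne
    have h2 := kappa_one (d := d) hm hne
    change diagMat d mu _ _ = 0 at h2
    rw [← h0, kappa_apply hm hm, Finset.card_eq_zero, Finset.filter_eq_empty_iff] at h2
    exact h2 hu ⟨rfl, rfl⟩
  rw [h1, add_eq_right]
  refine Finset.sum_eq_zero fun u hu => Finset.sum_eq_zero fun y hy => ?_
  beta_reduce
  rw [hbl u hu, hbl y hy, if_neg (c := StrictInv _ _ _ _), if_neg (c := _ ∧ _), add_zero, ite_self]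
  · exact fun h => h.2 h.1
  · unfold StrictInv; omega

/-- The exponent `ℓ̂(A)` in terms of the longest elements of double cosets. -/
theorem ellHat_eq {A : ℤ → ℤ → ℕ} (hA : A ∈ Xi m n d) :
    ellHat m n A = topLen m n d A - topLen m n d (diagMat d (colW m n A)) := by
  have h1 := four_topLen_eq hA
  rw [pairSum_labels hA (maxRep_spec hA).1 (φ := fun i j i' j' =>
    (if StrictInv i j i' j' then 1 else 0) + if i = i' ∧ j ≠ j' then parSign m i else 0)
    (fun i j i' j' => by
      congr 1
      · simp only [StrictInv, neg_lt_neg_iff]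
        exact if_congr or_comm rfl rfl
      · simp only [neg_inj, parSign_neg, ne_eq]), ← four_topLen_diagMat (colW_mem hA)] at h1
  -- This shows that the double sum in `ℓ(A)` is even; with `h1` the sum in `ℓ°(A)` is even too, so
  -- both divisions by 2 are exact.
  have h2 := four_len_minRep hA
  simp only [mul_add, Finset.sum_add_distrib] at h1
  have hN1 : ∑ p ∈ Ic m n, (natural A p.1 p.2 : ℤ) * ∑ r ∈ II m n ×ˢ II m n,
      (A r.1 r.2 : ℤ) * (if StrictInv p.1 p.2 r.1 r.2 then 1 else 0) =
      (∑ p ∈ Ic m n, ∑ r ∈ II m n ×ˢ II m n,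
        if (r.1 < p.1 ∧ p.2 < r.2) ∨ (p.1 < r.1 ∧ r.2 < p.2) then
          natural A p.1 p.2 * A r.1 r.2 else 0 : ℕ) := by
    push_cast
    refine Finset.sum_congr rfl fun p _ => ?_
    rw [Finset.mul_sum]
    refine Finset.sum_congr rfl fun r _ => ?_
    simp only [mul_ite, mul_one, mul_zero]
    rfl
  have hN2 : ∑ p ∈ Ic m n, (natural A p.1 p.2 : ℤ) * ∑ r ∈ II m n ×ˢ II m n,
      (A r.1 r.2 : ℤ) * (if p.1 = r.1 ∧ p.2 ≠ r.2 then parSign m p.1 else 0) =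
      ∑ p ∈ Ic m n, ∑ l ∈ II m n with l ≠ p.2,
        (if |p.1| ≤ m then 1 else -1) * (natural A p.1 p.2 : ℤ) * (A p.1 l : ℤ) := by
    refine Finset.sum_congr rfl fun p hp => ?_
    have hp1 := (Finset.mem_product.1 (mem_Ic.1 hp).1).1
    rw [Finset.sum_product, Finset.sum_eq_single p.1, Finset.mul_sum, Finset.sum_filter]
    · refine Finset.sum_congr rfl fun l _ => ?_
      by_cases h : l = p.2
      · rw [if_neg (fun h' => h'.2 h.symm), if_neg (not_not.2 h), mul_zero, mul_zero]
      · rw [if_pos ⟨rfl, fun h' => h h'.symm⟩, if_pos h, parSign]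
        ring
    · intro i _ hi
      refine Finset.sum_eq_zero fun l _ => ?_
      rw [if_neg fun h => hi h.1.symm, mul_zero]
    · exact fun h => absurd hp1 h
  rw [hN1] at h1 h2
  rw [hN2] at h1
  rw [ellHat, ell, ellCirc]
  omega

end

end

end IotaSchur

namespace IotaSchur

noncomputable section

/-! ### Canonical bases of modules with a bar involution -/

/-- The Laurent polynomials with negative exponents only. -/
def negPart : AddSubgroup Lau where
  carrier := {p | ∀ k : ℤ, 0 ≤ k → p.coeff k = 0}
  zero_mem' _ _ := rfl
  add_mem' := by
    intro a b ha hb k hk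
    rw [AddMonoidAlgebra.coeff_add, Finsupp.add_apply, ha k hk, hb k hk, add_zero]
  neg_mem' := by
    intro a ha k hk
    rw [AddMonoidAlgebra.coeff_neg, Finsupp.neg_apply, ha k hk, neg_zero]

lemma vpow_mem_negPart (k : ℕ) : vpow (-(k : ℤ) - 1) ∈ negPart := by
  intro j hj
  rw [LaurentPolynomial.T_apply, if_neg (by omega)]

lemma eq_zero_of_mem_negPart {p : Lau} (hp : p ∈ negPart)
    (h : LaurentPolynomial.invert p = p) : p = 0 := by
  refine LaurentPolynomial.ext fun k => ?_
  rw [AddMonoidAlgebra.coeff_zero, Finsupp.zero_apply]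
  by_cases hk : 0 ≤ k
  · exact hp k hk
  · rw [← h, LaurentPolynomial.invert_apply]
    exact hp _ (by omega)

/-- `r` is the part of `p` with negative exponents; antisymmetry supplies the part with positive
exponents and kills the constant term, as `ℤ` has no 2-torsion. -/
lemma exists_sub_invert {p : Lau} (h : LaurentPolynomial.invert p = -p) :
    ∃ r ∈ negPart, p = r - LaurentPolynomial.invert r := by
  classical
  have hc : ∀ k, (AddMonoidAlgebra.ofCoeff (p.coeff.filter fun k => k < 0) : Lau).coeff k =
      if k < 0 then p.coeff k else 0 := fun k => by
    rw [AddMonoidAlgebra.coeff_ofCoeff, Finsupp.filter_apply]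
  refine ⟨AddMonoidAlgebra.ofCoeff (p.coeff.filter fun k => k < 0), fun k hk => ?_, ?_⟩
  · rw [hc, if_neg (by omega)]
  · refine LaurentPolynomial.ext fun k => ?_
    have h1 : p.coeff (-k) = -p.coeff k := by
      rw [← LaurentPolynomial.invert_apply, h]; rfl
    rw [AddMonoidAlgebra.coeff_sub, Finsupp.sub_apply, LaurentPolynomial.invert_apply, hc, hc]
    rcases lt_trichotomy k 0 with hk | rfl | hk
    · rw [if_pos hk, if_neg (by omega), sub_zero]
    · rw [neg_zero] at h1
      rw [if_neg (by omega), if_neg (by omega)]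
      omega
    · rw [if_neg (by omega), if_pos (by omega), h1]
      omega

lemma eq_sum_vpow (p : Lau) : p = ∑ k ∈ p.coeff.support, p.coeff k • vpow k := by
  refine LaurentPolynomial.ext fun j => ?_
  rw [AddMonoidAlgebra.coeff_sum, Finset.sum_apply']
  simp only [AddMonoidAlgebra.coeff_smul_apply, LaurentPolynomial.T_apply, smul_eq_mul, mul_ite,
    mul_one, mul_zero, Finset.sum_ite_eq', Finsupp.mem_support_iff]
  split_ifs with h
  · rfl
  · exact not_not.1 h

/-- A module over `ℤ[v, v⁻¹]` with a finite ordered basis `b`, with coordinate functions `c`, and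
with a unitriangular bar involution. -/
structure BarModule (ι S : Type*) [Fintype ι] [AddCommGroup S] [Module Lau S] where
  /-- The standard basis. -/
  b : ι → S
  /-- The coordinates. -/
  c : ι → S →ₗ[Lau] Lau
  /-- The order. -/
  lt : ι → ι → Prop
  /-- The bar involution. -/
  bar : S → S
  c_b : ∀ i j, i ≠ j → c i (b j) = 0
  c_b_self : ∀ i, c i (b i) = 1
  eq_zero : ∀ x, (∀ i, c i x = 0) → x = 0
  irrefl : ∀ i, ¬ lt i i
  trans : ∀ i j k, lt i j → lt j k → lt i k
  bar_add : ∀ x y, bar (x + y) = bar x + bar y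
  bar_smul : ∀ (a : Lau) x, bar (a • x) = LaurentPolynomial.invert a • bar x
  bar_bar : ∀ x, bar (bar x) = x
  c_bar_self : ∀ i, c i (bar (b i)) = 1
  c_bar : ∀ i j, c j (bar (b i)) ≠ 0 → j = i ∨ lt j i

namespace BarModule

variable {ι S : Type*} [Fintype ι] [AddCommGroup S] [Module Lau S] (M : BarModule ι S)

/-- The combinations of lower basis elements with coefficients in `v⁻¹ ℤ[v⁻¹]`. -/
def lower (i : ι) : AddSubgroup S :=
  AddSubgroup.closure {x | ∃ j, M.lt j i ∧ ∃ k : ℕ, x = vpow (-(k : ℤ) - 1) • M.b j}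

lemma c_sum (a : ι → Lau) (i : ι) : M.c i (∑ j, a j • M.b j) = a i := by
  rw [map_sum, Finset.sum_eq_single i]
  · rw [map_smul, M.c_b_self, smul_eq_mul, mul_one]
  · intro j _ hj
    rw [map_smul, M.c_b i j hj.symm, smul_zero]
  · exact fun h => absurd (Finset.mem_univ i) h

lemma eq_of_c {x y : S} (h : ∀ i, M.c i x = M.c i y) : x = y := by
  rw [← sub_eq_zero]
  exact M.eq_zero _ fun i => by rw [map_sub, h, sub_self]

lemma sum_c (x : S) : ∑ i, M.c i x • M.b i = x := M.eq_of_c fun i => M.c_sum _ i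

lemma bar_zero : M.bar 0 = 0 := by
  have h := M.bar_smul 0 0
  rwa [zero_smul, map_zero, zero_smul] at h

lemma bar_neg (x : S) : M.bar (-x) = -M.bar x := by
  have h := M.bar_smul (-1) x
  rwa [map_neg, map_one, neg_one_smul, neg_one_smul] at h

lemma bar_sum {κ : Type*} (s : Finset κ) (f : κ → S) :
    M.bar (∑ i ∈ s, f i) = ∑ i ∈ s, M.bar (f i) := by
  classical
  induction s using Finset.induction_on with
  | empty => rw [Finset.sum_empty, Finset.sum_empty, M.bar_zero]
  | insert i s hi ih => rw [Finset.sum_insert hi, Finset.sum_insert hi, M.bar_add, ih]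

lemma mem_lower {i : ι} {x : S} :
    x ∈ M.lower i ↔ ∀ j, M.c j x ∈ negPart ∧ (M.c j x ≠ 0 → M.lt j i) := by
  constructor
  · intro h
    induction h using AddSubgroup.closure_induction with
    | mem x hx =>
      obtain ⟨j, hj, k, rfl⟩ := hx
      intro l
      by_cases hl : l = j
      · subst hl
        rw [map_smul, M.c_b_self, smul_eq_mul, mul_one]
        exact ⟨vpow_mem_negPart k, fun _ => hj⟩
      · rw [map_smul, M.c_b l j hl, smul_zero]
        exact ⟨zero_mem _, fun h => absurd rfl h⟩
    | zero => exact fun j => by rw [map_zero]; exact ⟨zero_mem _, fun h => absurd rfl h⟩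
    | add x y _ _ hx hy =>
      intro j
      rw [map_add]
      refine ⟨add_mem (hx j).1 (hy j).1, fun h => ?_⟩
      by_cases h1 : M.c j x = 0
      · exact (hy j).2 fun h2 => h (by rw [h1, h2, add_zero])
      · exact (hx j).2 h1
    | neg x _ hx =>
      intro j
      rw [map_neg]
      exact ⟨neg_mem (hx j).1, fun h => (hx j).2 (neg_ne_zero.1 h)⟩
  · intro h
    rw [← M.sum_c x]
    refine AddSubgroup.sum_mem _ fun j _ => ?_
    by_cases hj : M.c j x = 0
    · rw [hj, zero_smul]; exact zero_mem _
    rw [eq_sum_vpow (M.c j x), Finset.sum_smul]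
    refine AddSubgroup.sum_mem _ fun k hk => ?_
    rw [smul_assoc]
    have hk0 : k < 0 := by
      by_contra hcon
      exact (Finsupp.mem_support_iff.1 hk) ((h j).1 k (not_lt.1 hcon))
    have hmem : vpow k • M.b j ∈ M.lower i := by
      refine AddSubgroup.subset_closure ⟨j, (h j).2 hj, (-k - 1).toNat, ?_⟩
      congr 2
      omega
    exact AddSubgroup.zsmul_mem _ hmem _

lemma exists_max (p : ι → Prop) (h : ∃ i, p i) : ∃ i, p i ∧ ∀ j, p j → ¬ M.lt i j := by
  have : IsTrans ι fun i j => M.lt j i := ⟨fun i j k h1 h2 => M.trans _ _ _ h2 h1⟩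
  have : Std.Irrefl fun i j => M.lt j i := ⟨M.irrefl⟩
  obtain ⟨i, hi, hmin⟩ := (Finite.wellFounded_of_trans_of_irrefl fun i j => M.lt j i).has_min
    {i | p i} h
  exact ⟨i, hi, fun j hj => hmin j hj⟩

/-- Conjugating a basis element adds lower terms only, so nothing else in the support of `x` reaches
`i`. -/
lemma c_bar_max {x : S} {i : ι} (h : ∀ j, M.c j x ≠ 0 → ¬ M.lt i j) :
    M.c i (M.bar x) = LaurentPolynomial.invert (M.c i x) := by
  conv_lhs => rw [← M.sum_c x]
  rw [M.bar_sum, map_sum, Finset.sum_eq_single i]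
  · rw [M.bar_smul, map_smul, M.c_bar_self, smul_eq_mul, mul_one]
  · intro j _ hj
    rw [M.bar_smul, map_smul]
    by_contra hne
    rcases M.c_bar j i (right_ne_zero_of_smul hne) with h1 | h1
    · exact hj h1.symm
    · refine h j (fun h2 => left_ne_zero_of_smul hne ?_) h1
      rw [h2, map_zero]
  · exact fun h => absurd (Finset.mem_univ i) h

/-- At a maximal index of the support the coefficient would be invariant under `v ↦ v⁻¹` and have
negative exponents only. -/
lemma eq_zero_of_bar {x : S} (hx : M.bar x = x) (h : ∀ i, M.c i x ∈ negPart) : x = 0 := by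
  by_contra hne
  obtain ⟨i, hi, hmax⟩ := M.exists_max (fun i => M.c i x ≠ 0) (by
    by_contra! hcon
    exact hne (M.eq_zero x hcon))
  have h1 := M.c_bar_max hmax
  rw [hx] at h1
  exact hi (eq_zero_of_mem_negPart (h i) h1.symm)

/-- The uniqueness of canonical basis elements. -/
theorem unique {i : ι} {x y : S} (hx : M.bar x = x) (hy : M.bar y = y)
    (hx' : x - M.b i ∈ M.lower i) (hy' : y - M.b i ∈ M.lower i) : x = y := by
  rw [← sub_eq_zero]
  refine M.eq_zero_of_bar ?_ fun j => ?_
  · rw [sub_eq_add_neg, M.bar_add, M.bar_neg, hx, hy]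
  · have h := sub_mem hx' hy'
    rw [sub_sub_sub_cancel_right] at h
    exact (M.mem_lower.1 h j).1

/-- The Kazhdan–Lusztig recursion: at a maximal index `i` of the down-closed set `s` the coefficient
of an anti-invariant `y` is antisymmetric, hence `r` minus its conjugate. Subtracting `r b_i` minus
its conjugate from `y` removes `i` from `s`. -/
lemma exists_sub_bar (N : ℕ) : ∀ (s : Finset ι), s.card = N →
    (∀ i ∈ s, ∀ j, M.lt j i → j ∈ s) → ∀ y, M.bar y = -y → (∀ i, M.c i y ≠ 0 → i ∈ s) →
    ∃ z, y = z - M.bar z ∧ ∀ i, M.c i z ∈ negPart ∧ (M.c i z ≠ 0 → i ∈ s) := by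
  classical
  induction N with
  | zero =>
    intro s hs _ y _ hy
    rw [Finset.card_eq_zero] at hs
    subst hs
    have : y = 0 := M.eq_zero _ fun i => by
      by_contra h
      exact absurd (hy i h) (Finset.notMem_empty i)
    exact ⟨0, by rw [this, M.bar_zero, sub_zero], fun i => by
      rw [map_zero]; exact ⟨zero_mem _, fun h => absurd rfl h⟩⟩
  | succ N ih =>
    intro s hs hlow y hbar hy
    obtain ⟨i, hi, hmax⟩ := M.exists_max (fun i => i ∈ s)
      (Finset.card_pos.1 (by omega : 0 < s.card))
    have h1 := M.c_bar_max (x := y) (i := i) fun j hj => hmax j (hy j hj)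
    rw [hbar, map_neg] at h1
    obtain ⟨r, hr, hyr⟩ := exists_sub_invert h1.symm
    have hc : ∀ j, M.c j (y - (r • M.b i - M.bar (r • M.b i))) ≠ 0 → j ∈ s.erase i := by
      intro j hj
      rw [map_sub, map_sub, M.bar_smul, map_smul, map_smul] at hj
      rw [Finset.mem_erase]
      by_cases hji : j = i
      · subst hji
        rw [M.c_b_self, M.c_bar_self, smul_eq_mul, mul_one, smul_eq_mul, mul_one, hyr,
          sub_self] at hj
        exact absurd rfl hj
      · refine ⟨hji, ?_⟩
        rw [M.c_b j i hji, smul_zero, zero_sub, sub_neg_eq_add] at hj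
        by_cases h2 : M.c j y = 0
        · rw [h2, zero_add] at hj
          rcases M.c_bar i j (right_ne_zero_of_smul hj) with h3 | h3
          · exact absurd h3 hji
          · exact hlow i hi j h3
        · exact hy j h2
    obtain ⟨z, hz, hz'⟩ := ih (s.erase i) (by rw [Finset.card_erase_of_mem hi]; omega)
      (fun j hj k hk => Finset.mem_erase.2 ⟨fun h => hmax j (Finset.mem_of_mem_erase hj) (h ▸ hk),
        hlow j (Finset.mem_of_mem_erase hj) k hk⟩) (y - (r • M.b i - M.bar (r • M.b i)))
      (by
        rw [sub_eq_add_neg, sub_eq_add_neg (r • M.b i), M.bar_add, M.bar_neg, M.bar_add, M.bar_neg,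
          M.bar_bar, hbar]
        abel) hc
    refine ⟨z + r • M.b i, ?_, fun j => ?_⟩
    · rw [M.bar_add, ← sub_eq_zero]
      rw [← sub_eq_zero] at hz
      rw [← hz]
      abel
    · rw [map_add, map_smul]
      by_cases hji : j = i
      · subst hji
        rw [M.c_b_self, smul_eq_mul, mul_one]
        exact ⟨add_mem (hz' j).1 hr, fun _ => hi⟩
      · rw [M.c_b j i hji, smul_zero, add_zero]
        exact ⟨(hz' j).1, fun h => Finset.mem_of_mem_erase ((hz' j).2 h)⟩

/-- The existence of canonical basis elements. -/
theorem exists_canonical (i : ι) : ∃ x, M.bar x = x ∧ x - M.b i ∈ M.lower i := by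
  classical
  -- The difference between the conjugate of `b_i` and `b_i` is anti-invariant and lies strictly
  -- below `i`. Written as `z` minus the conjugate of `z`, it makes `b_i + z` invariant.
  obtain ⟨z, hz, hz'⟩ := M.exists_sub_bar _ (Finset.univ.filter fun j => M.lt j i) rfl
    (fun j hj k hk => Finset.mem_filter.2 ⟨Finset.mem_univ k,
      M.trans _ _ _ hk (Finset.mem_filter.1 hj).2⟩) (M.bar (M.b i) - M.b i)
    (by
      rw [sub_eq_add_neg, M.bar_add, M.bar_neg, M.bar_bar]
      abel)
    (fun j hj => by
      rw [map_sub] at hj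
      rw [Finset.mem_filter]
      refine ⟨Finset.mem_univ j, ?_⟩
      by_cases hji : j = i
      · subst hji
        rw [M.c_bar_self, M.c_b_self, sub_self] at hj
        exact absurd rfl hj
      · rw [M.c_b j i hji, sub_zero] at hj
        exact (M.c_bar i j hj).resolve_left hji)
  refine ⟨M.b i + z, ?_, ?_⟩
  · rw [M.bar_add, ← sub_eq_zero]
    rw [← sub_eq_zero] at hz
    rw [← hz]
    abel
  · rw [add_sub_cancel_left, M.mem_lower]
    exact fun j => ⟨(hz' j).1, fun h => (Finset.mem_filter.1 ((hz' j).2 h)).2⟩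

/-- A unitriangular family is a basis. -/
theorem isBasisFamily_of_triangular {C : ι → S} (h : ∀ i, C i - M.b i ∈ M.lower i) :
    IsBasisFamily C := by
  classical
  have hself : ∀ i, M.c i (C i) = 1 := fun i => by
    have h1 := M.mem_lower.1 (h i) i
    have h2 : M.c i (C i - M.b i) = 0 := by
      by_contra hne
      exact M.irrefl i (h1.2 hne)
    rwa [map_sub, M.c_b_self, sub_eq_zero] at h2
  have hne : ∀ i j, j ≠ i → M.c j (C i) ≠ 0 → M.lt j i := fun i j hji hc => by
    have h1 := M.mem_lower.1 (h i) j
    rw [map_sub, M.c_b j i hji, sub_zero] at h1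
    exact h1.2 hc
  constructor
  · rw [Fintype.linearIndependent_iff]
    intro g hg
    by_contra! hcon
    obtain ⟨i, hi, hmax⟩ := M.exists_max (fun i => g i ≠ 0) hcon
    have h1 := congrArg (M.c i) hg
    rw [map_sum, map_zero, Finset.sum_eq_single i, map_smul, hself, smul_eq_mul, mul_one] at h1
    · exact hi h1
    · intro j _ hj
      rw [map_smul]
      by_contra hc
      exact hmax j (left_ne_zero_of_smul hc) (hne j i hj.symm (right_ne_zero_of_smul hc))
    · exact fun h => absurd (Finset.mem_univ i) h
  -- A minimal `b_i` outside the span would equal `C i` minus a combination of lower basis elements,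
  -- which do lie in the span.
  · have hb : ∀ i, M.b i ∈ Submodule.span Lau (Set.range C) := by
      by_contra! hcon
      have : IsTrans ι M.lt := ⟨M.trans⟩
      have : Std.Irrefl M.lt := ⟨M.irrefl⟩
      obtain ⟨i, hi, hmin⟩ := (Finite.wellFounded_of_trans_of_irrefl M.lt).has_min
        {i | M.b i ∉ Submodule.span Lau (Set.range C)} hcon
      apply hi
      have h1 : M.b i = C i - ∑ j, M.c j (C i - M.b i) • M.b j := by
        rw [M.sum_c, sub_sub_cancel]
      rw [h1]
      refine Submodule.sub_mem _ (Submodule.subset_span ⟨i, rfl⟩)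
        (Submodule.sum_mem _ fun j _ => ?_)
      by_cases hj : M.c j (C i - M.b i) = 0
      · rw [hj, zero_smul]; exact zero_mem _
      · refine Submodule.smul_mem _ _ ?_
        by_contra hc
        exact hmin j hc ((M.mem_lower.1 (h i) j).2 hj)
    rw [Submodule.eq_top_iff']
    intro x
    rw [← M.sum_c x]
    exact Submodule.sum_mem _ fun j _ => Submodule.smul_mem _ _ (hb j)

end BarModule

end

end IotaSchur

/-! ### ### Canonical bases of the Schur superalgebras and extension by zero -/

namespace IotaSchur

noncomputable section

open LaurentPolynomial

variable {m n d : ℕ} {P Q : Set (Comp m n)}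

lemma invert_sign_mul_vpow (N : ℕ) (k : ℤ) :
    LaurentPolynomial.invert ((-1 : Lau) ^ N * vpow k) = (-1) ^ N * vpow (-k) := by
  rw [map_mul, map_pow, map_neg, map_one, vpow, LaurentPolynomial.invert_T, vpow]

/-- The algebra `𝓢_P` with its standard basis and its bar involution. -/
def schurBarModule (hP : P ⊆ Lam m n d) : BarModule (XiOf m n d P) (Schur d P) where
  b A := std d P A.1
  c := stdCoord
  lt A B := algLt m n A.1 B.1
  bar := schurBar
  c_b A B h := by
    classical
    rw [stdCoord_std hP A B, if_neg h]
  c_b_self A := by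
    classical
    rw [stdCoord_std hP A A, if_pos rfl]
  eq_zero f h := eq_zero_of_stdCoord hP h
  irrefl A h := h.2 rfl
  trans A B C h h' := algLt_trans A.2.1 B.2.1 h h'
  bar_add := schurBar_add hP
  bar_smul := schurBar_smul hP
  bar_bar := schurBar_schurBar hP
  -- Conjugating `v^{-ℓ̂(A)}` gives `v^{ℓ̂(A)}`, and the coordinate of `[A]` gives another
  -- `v^{ℓ̂(A)}`. By `ellHat_eq` the coefficient for `e_A` is `v^{-2ℓ̂(A)}`, and the signs square to
  -- 1.
  c_bar_self A := by
    rw [std, schurBar_smul hP, map_smul, stdCoord, LinearMap.smul_apply, eCoord_schurBar_self hP A,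
      invert_sign_mul_vpow, neg_neg, smul_eq_mul, smul_eq_mul]
    have h : vpow (ellHat m n A.1) * vpow (ellHat m n A.1) *
        vpow (2 * topLen m n d (diagMat d (colW m n A.1)) - 2 * topLen m n d A.1) = 1 := by
      rw [vpow, vpow, ← LaurentPolynomial.T_add, ← LaurentPolynomial.T_add, ellHat_eq A.2.1,
        ← LaurentPolynomial.T_zero]
      congr 1
      ring
    linear_combination h + vpow (ellHat m n A.1) * vpow (ellHat m n A.1) *
        vpow (2 * topLen m n d (diagMat d (colW m n A.1)) - 2 * topLen m n d A.1) *
          sign_mul_self (ell m n (oddRows m A.1))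
  c_bar A B h := by
    by_cases hBA : B = A
    · exact Or.inl hBA
    refine Or.inr ⟨algLe_of_eCoord_schurBar hP fun h0 => h ?_, fun h' => hBA (Subtype.ext h')⟩
    rw [std, schurBar_smul hP, map_smul, stdCoord, LinearMap.smul_apply, h0, smul_zero, smul_zero]

lemma lowerTerms_eq (hP : P ⊆ Lam m n d) (A : XiOf m n d P) :
    lowerTerms d P A.1 = (schurBarModule hP).lower A := by
  refine congrArg AddSubgroup.closure (Set.ext fun x => ⟨?_, ?_⟩)
  · rintro ⟨B, hB, h⟩
    exact ⟨⟨B, hB⟩, h⟩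
  · rintro ⟨B, h⟩
    exact ⟨B.1, B.2, h⟩

/-- The canonical basis exists. -/
theorem exists_isCanonicalBasis (hP : P ⊆ Lam m n d) :
    ∃ C : XiOf m n d P → Schur d P, IsCanonicalBasis d P C := by
  choose C hC hC' using (schurBarModule hP).exists_canonical
  exact ⟨C, isBasisFamily_std hP, (schurBarModule hP).isBasisFamily_of_triangular hC', hC,
    fun A => by rw [lowerTerms_eq hP]; exact hC' A⟩

/-- An element of the canonical basis is determined by its bar invariance and triangularity. -/
theorem canonical_unique (hP : P ⊆ Lam m n d) (A : XiOf m n d P) {f f' : Schur d P}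
    (hf : schurBar f = f) (hf' : schurBar f' = f')
    (h : f - std d P A.1 ∈ lowerTerms d P A.1) (h' : f' - std d P A.1 ∈ lowerTerms d P A.1) :
    f = f' := by
  rw [lowerTerms_eq hP] at h h'
  exact (schurBarModule hP).unique hf hf' h h'

theorem IsCanonicalBasis.unique (hP : P ⊆ Lam m n d) {C C' : XiOf m n d P → Schur d P}
    (h : IsCanonicalBasis d P C) (h' : IsCanonicalBasis d P C') : C = C' :=
  funext fun A => canonical_unique hP A (h.bar_eq A) (h'.bar_eq A) (h.triangular A)
    (h'.triangular A)

lemma schurIncl_mem_lowerTerms (hQ : Q ⊆ Lam m n d) (h : P ⊆ Q) (A : ℤ → ℤ → ℕ) {f : Schur d P}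
    (hf : f ∈ lowerTerms d P A) : schurIncl d h f ∈ lowerTerms d Q A := by
  have h0 : schurIncl d h (0 : Schur d P) = 0 := by
    have h1 := schurIncl_smul hQ h 0 0
    rwa [zero_smul, zero_smul] at h1
  induction hf using AddSubgroup.closure_induction with
  | mem x hx =>
    obtain ⟨B, hB, hlt, k, rfl⟩ := hx
    rw [schurIncl_smul hQ, schurIncl_std hQ h hB]
    exact AddSubgroup.subset_closure ⟨B, xiOf_mono m n d h hB, hlt, k, rfl⟩
  | zero =>
    rw [h0]
    exact zero_mem _
  | add x y _ _ hx hy =>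
    rw [schurIncl_add]
    exact add_mem hx hy
  | neg x _ hx =>
    rw [← zero_sub, schurIncl_sub, h0]
    exact sub_mem (zero_mem _) hx

/-- The canonical bases are compatible with extension by zero. -/
theorem schurIncl_canonical (hQ : Q ⊆ Lam m n d) (h : P ⊆ Q) {C : XiOf m n d P → Schur d P}
    {C' : XiOf m n d Q → Schur d Q} (hC : IsCanonicalBasis d P C) (hC' : IsCanonicalBasis d Q C')
    (A : XiOf m n d P) : schurIncl d h (C A) = C' ⟨A.1, xiOf_mono m n d h A.2⟩ := by
  -- The extension by zero of the smaller canonical element is bar invariant and triangular in the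
  -- larger algebra, so uniqueness there identifies it.
  refine canonical_unique hQ ⟨A.1, xiOf_mono m n d h A.2⟩ ?_ (hC'.bar_eq _) ?_ (hC'.triangular _)
  · rw [← schurIncl_schurBar hQ, hC.bar_eq]
  · rw [← schurIncl_std hQ h A.2, ← schurIncl_sub]
    exact schurIncl_mem_lowerTerms hQ h A.1 (hC.triangular A)

end

end IotaSchur

theorem theorem6p4 (m n d : ℕ) (hd : 0 < d) :
    (∃! C : XiOf m n d (Lam m n d) → Schur d (Lam m n d),
      IsCanonicalBasis d (Lam m n d) C) ∧
    ∀ C : XiOf m n d (Lam m n d) → Schur d (Lam m n d),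
      IsCanonicalBasis d (Lam m n d) C →
      ∀ c : ℕ, ∃ C' : XiOf m n d (LamFix m n d c) → Schur d (LamFix m n d c),
        IsCanonicalBasis d (LamFix m n d c) C' ∧
        (∀ C'' : XiOf m n d (LamFix m n d c) → Schur d (LamFix m n d c),
          IsCanonicalBasis d (LamFix m n d c) C'' → C'' = C') ∧
        (∀ A : XiOf m n d (LamFix m n d c),
          schurIncl d (lamFix_subset m n d c) (std d (LamFix m n d c) A.1) =
            std d (Lam m n d) A.1) ∧
        ∀ A : XiOf m n d (LamFix m n d c),
          schurIncl d (lamFix_subset m n d c) (C' A) =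
            C ⟨A.1, xiOf_mono m n d (lamFix_subset m n d c) A.2⟩ := by
  have hL : Lam m n d ⊆ Lam m n d := subset_rfl
  constructor
  · obtain ⟨C, hC⟩ := exists_isCanonicalBasis hL
    exact ⟨C, hC, fun C' hC' => hC'.unique hL hC⟩
  · intro C hC c
    have hF := lamFix_subset m n d c
    obtain ⟨C', hC'⟩ := exists_isCanonicalBasis hF
    exact ⟨C', hC', fun C'' hC'' => hC''.unique hF hC', fun A => schurIncl_std hL hF A.2,
      fun A => schurIncl_canonical hL hF hC' hC A⟩
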